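/- Let $d\ge 2$ and let $K,h,r,\lambda>0$. There is a constant $v=v(d,K,h,r,\lambda)>0$, depending only on these parameters, such that the following holds. Let $\ell\in\mathbb{R}^d$ be a unit vector and let $X=(X_n)_{n\ge 0}$ be a $\mathbb{Z}^d$-valued stochastic process on a probability space $(\Omega,\mathcal{A},\mathbb{P})$, adapted to a filtration $(\mathcal{F}_n)_{n\ge 0}$, with $X_0=0$ a.s. Suppose that $X$ is a generalized excited random walk in direction $\ell$ with these parameters, that is ($\|\cdot\|$ is the Euclidean norm, and relations between conditional expectations hold almost surely): (B) $\sup_{n\ge 0}\|X_{n+1}-X_n\|\le K$ a.s.; (C$^+$) for every $n\ge 0$, $\mathbb{E}(X_{n+1}-X_n\mid\mathcal{F}_n)=0$ on $\{\text{there exists } k<n \text{ with } X_k=X_n\}$, and $\mathbb{E}(X_{n+1}-X_n\mid\mathcal{F}_n)\cdot\ell\ge\lambda$ on $\{X_k\ne X_n \text{ for all } k<n\}$; (E) for every $n\ge 0$, $\mathbb{P}[(X_{n+1}-X_n)\cdot\ell>r\mid\mathcal{F}_n]\ge h$, and for every $\ell'\in\mathbb{R}^d$ with $\|\ell'\|=1$,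 $\mathbb{P}[(X_{n+1}-X_n)\cdot\ell'>r\mid\mathcal{F}_n]\ge h$ on $\{\mathbb{E}(X_{n+1}-X_n\mid\mathcal{F}_n)=0\}$. Then $$\liminf_{n\to\infty}\frac{X_n\cdot\ell}{n}\ge v\qquad\text{a.s.}$$ -/

import Mathlib

open MeasureTheory ProbabilityTheory Filter Topology

noncomputable section

namespace ExcitedWalk

/-- A site of the lattice `ℤ^d`, seen as a vector of `ℝ^d` with the Euclidean norm. -/
def toVec {d : ℕ} (x : Fin d → ℤ) : EuclideanSpace ℝ (Fin d) :=
  WithLp.toLp 2 (fun i => (x i : ℝ))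

variable {d : ℕ} {Ω : Type*} {m : MeasurableSpace Ω}

/-- The increment `X_{n+1} - X_n` of a lattice-valued process, as a vector of `ℝ^d`. -/
def jump (X : ℕ → Ω → (Fin d → ℤ)) (n : ℕ) (ω : Ω) : EuclideanSpace ℝ (Fin d) :=
  toVec (X (n + 1) ω) - toVec (X n ω)

/-- The conditional drift `E(X_{n+1} - X_n | F_n)`. -/
def drift (μ : Measure Ω) (ℱ : Filtration ℕ m) (X : ℕ → Ω → (Fin d → ℤ)) (n : ℕ) :
    Ω → EuclideanSpace ℝ (Fin d) :=
  μ[jump X n | ℱ n]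

/-- The site occupied at time `n` was already visited at an earlier time. -/
def Revisits (X : ℕ → Ω → (Fin d → ℤ)) (n : ℕ) (ω : Ω) : Prop :=
  ∃ k < n, X k ω = X n ω

/-- Condition B: almost surely all jumps have Euclidean length at most `K`. -/
def ConditionB (μ : Measure Ω) (K : ℝ) (X : ℕ → Ω → (Fin d → ℤ)) : Prop :=
  ∀ᵐ ω ∂μ, ∀ n, ‖jump X n ω‖ ≤ K

/-- Condition C⁺: zero drift at sites visited before, and drift at least `lam` in
direction `l` at first visits. -/
def ConditionCPlus (μ : Measure Ω) (ℱ : Filtration ℕ m) (l : EuclideanSpace ℝ (Fin d))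
    (lam : ℝ) (X : ℕ → Ω → (Fin d → ℤ)) : Prop :=
  ∀ n, (∀ᵐ ω ∂μ, Revisits X n ω → drift μ ℱ X n ω = 0) ∧
    (∀ᵐ ω ∂μ, ¬ Revisits X n ω → lam ≤ inner ℝ (drift μ ℱ X n ω) l)

/-- Condition E (uniform ellipticity): the conditional probability of advancing by more than `r`
is at least `h`, always in direction `l`, and in every direction when the drift vanishes. -/
def ConditionE (μ : Measure Ω) (ℱ : Filtration ℕ m) (l : EuclideanSpace ℝ (Fin d))
    (h r : ℝ) (X : ℕ → Ω → (Fin d → ℤ)) : Prop :=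
  ∀ n, (∀ᵐ ω ∂μ, h ≤ (μ⟦{ω' | r < inner ℝ (jump X n ω') l} | ℱ n⟧) ω) ∧
    ∀ l' : EuclideanSpace ℝ (Fin d), ‖l'‖ = 1 →
      ∀ᵐ ω ∂μ, drift μ ℱ X n ω = 0 →
        h ≤ (μ⟦{ω' | r < inner ℝ (jump X n ω') l'} | ℱ n⟧) ω

/-- `X` is a generalized excited random walk in direction `l`, started at the origin, with
jump bound `K`, ellipticity constants `h`, `r` and first-visit drift `lam`. -/
structure IsGeneralizedExcitedRandomWalk (μ : Measure Ω) (ℱ : Filtration ℕ m)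
    (l : EuclideanSpace ℝ (Fin d)) (K h r lam : ℝ) (X : ℕ → Ω → (Fin d → ℤ)) : Prop where
  adapted : Adapted ℱ X
  start : ∀ᵐ ω ∂μ, X 0 ω = 0
  condB : ConditionB μ K X
  condCPlus : ConditionCPlus μ ℱ l lam X
  condE : ConditionE μ ℱ l h r X

end ExcitedWalk

end

set_option linter.unusedSectionVars false

noncomputable section

namespace ExcitedWalk

universe u

section

/-! ### The Lyapunov function `(‖z‖² + b)^γ` -/

/-! The drift acts only at new sites, so a positive speed requires that old sites absorb little
time. For an elliptic step without drift in dimension at least two, `(‖z‖² + b)^(1/2 - ξ)` is a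
submartingale: its radial concavity almost exactly cancels the radial part of the quadratic gain,
while a direction orthogonal to `z` contributes variance at least `h r²` (`lyapunov_increment`,
`condExp_lyapunov`). Centred at a site `y`, this function gains a fixed amount at every visit to
`y`, apart from a loss at first visits that decays like a power of the distance to `y`. Hence, if
there are about `t^(1/2 + ε)` first visits in `t` steps, a site receives more than `t^(1/2 - 2ε)`
visits only with stretched-exponentially small probability (`measure_localTime_ge_le`).

Suppose the walk stays above a level for `t` steps and few sites above that level were visited
earlier. By counting, it must then typically make at least `t^(1/2 + ε)` first visits. These push it
upward by `lam` each, which beats fluctuations of order `√t`, so a first fall below the level after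
exactly `t` steps is less likely than any power of `1/t` (`measure_fall_le`, `exists_scales`; the
outcome is `FallBound`).

This yields a renewal structure. When a level is reached for the first time, no site above it has
been visited. A forced climb followed by `FallBound` shows that the walk never returns below the
level with probability at least `p` (`exists_escape`). With `w` successive levels to try, it is
unlikely that all of them are lost again (`measure_all_fell_le`), and a strip is left quickly
because the squared height grows on average (`measure_strip_le`). So a unit slab holds fewer than `w
^ 6` times outside an event of probability `w^(-s)`, even conditionally on the past up to a level `κ
w²` below the slab (`card_slabTimes_lt`, `measure_badSlab_le`).

Consequently the conditional mean of the truncated time in a slab is at most a constant `C`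
independent of `w` (`setLIntegral_slabCount_le`), and slabs at distance of order `w²` can be treated
one after another by exponential moments (`measure_sum_slabCount_ge_le`). A walk still below height
`n / (8 C)` at time `n` would have spent far more time in some family of slabs than this permits;
with `n ≈ w ^ 10` the probability is `O(n^(-2))` (`measure_height_lt_le`, `exists_speed`).
Borel–Cantelli concludes. Every constant is fixed before the direction, the space and the process.
-/

theorem one_add_rpow_lower {ξ x : ℝ} (hξ : 0 < ξ) (hξ' : ξ ≤ 1 / 4) (hx : |x| ≤ ξ / (1 + ξ)) :
    1 + (1 / 2 - ξ) * x - (1 / 2 - ξ) * ((1 / 2 + ξ) * (1 + ξ) / 2) * x ^ 2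
      ≤ (1 + x) ^ (1 / 2 - ξ) := by
  set γ : ℝ := 1 / 2 - ξ with hγ
  set ψ : ℝ → ℝ := fun x => (1 + x) ^ γ - (1 + γ * x - γ * ((1 / 2 + ξ) * (1 + ξ) / 2) * x ^ 2)
    with hψ
  have hγ0 : 0 < γ := by rw [hγ]; linarith
  have hx0 : ξ / (1 + ξ) < 1 := by rw [div_lt_one (by linarith)]; linarith
  -- The Taylor coefficient of `x ^ 2` would be `γ (1/2 + ξ) / 2`; the extra factor `1 + ξ` absorbs
  -- the remainder. Bernoulli's inequality fixes the sign of the derivative on each side of 0. On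
  -- the negative side this needs `1 / (1 + y) ≤ 1 + ξ`, which is what the bound `ξ / (1 + ξ)`
  -- gives.
  have hder : ∀ y : ℝ, -1 < y →
      HasDerivAt ψ (γ * ((1 + y) ^ (γ - 1) - 1 + (1 / 2 + ξ) * (1 + ξ) * y)) y := by
    intro y hy
    have h1 : HasDerivAt (fun x : ℝ => (1 + x) ^ γ) (1 * γ * (1 + y) ^ (γ - 1)) y :=
      ((hasDerivAt_id y).const_add 1).rpow_const (Or.inl (by simp; linarith))
    have h2 : HasDerivAt (fun x : ℝ => 1 + γ * x - γ * ((1 / 2 + ξ) * (1 + ξ) / 2) * x ^ 2)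
        (γ * 1 - γ * ((1 / 2 + ξ) * (1 + ξ) / 2) * (2 * y)) y := by
      have h3 := ((hasDerivAt_id y).const_mul γ).const_add 1
      have h4 := ((hasDerivAt_pow 2 y).const_mul (γ * ((1 / 2 + ξ) * (1 + ξ) / 2)))
      have h5 := h3.sub h4
      simp only [id, Nat.cast_ofNat, Nat.add_one_sub_one, pow_one] at h5
      exact h5
    refine (h1.sub h2).congr_deriv ?_
    ring
  have hψ0 : ψ 0 = 0 := by simp [hψ]
  have key : 0 ≤ ψ x := by
    rw [abs_le] at hx
    rcases le_total 0 x with h0 | h0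
    · have hm : MonotoneOn ψ (Set.Ici 0) := by
        apply monotoneOn_of_deriv_nonneg (convex_Ici 0)
        · intro y hy
          exact (hder y (by have : (0 : ℝ) ≤ y := hy; linarith)).continuousAt.continuousWithinAt
        · intro y hy
          rw [interior_Ici] at hy
          exact (hder y (by have : (0 : ℝ) < y := hy; linarith)).differentiableAt.differentiableWithinAt
        · intro y hy
          rw [interior_Ici] at hy
          have hy' : (0 : ℝ) < y := hy
          rw [(hder y (by linarith)).deriv]
          apply mul_nonneg hγ0.le
          have hb : (1 + y) ^ (1 - γ) ≤ 1 + (1 - γ) * y :=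
            rpow_one_add_le_one_add_mul_self (by linarith) (by rw [hγ]; linarith)
              (by rw [hγ]; linarith)
          have hp : 0 < (1 + y) ^ (1 - γ) := Real.rpow_pos_of_pos (by linarith) _
          have he : (1 + y) ^ (γ - 1) = ((1 + y) ^ (1 - γ))⁻¹ := by
            rw [← Real.rpow_neg (by linarith)]; congr 1; ring
          have : 1 - (1 - γ) * y ≤ ((1 + y) ^ (1 - γ))⁻¹ := by
            have h5 : (1 + (1 - γ) * y)⁻¹ ≤ ((1 + y) ^ (1 - γ))⁻¹ := inv_anti₀ hp hb
            refine le_trans ?_ h5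
            have h6 : 0 < 1 + (1 - γ) * y := lt_of_lt_of_le hp hb
            rw [← one_div, le_div_iff₀ h6]
            nlinarith [sq_nonneg ((1 - γ) * y)]
          rw [he]
          have h7 : 1 - γ = 1 / 2 + ξ := by rw [hγ]; ring
          rw [h7] at this ⊢
          nlinarith [mul_pos (mul_pos hξ hy') (by linarith : (0 : ℝ) < 1 / 2 + ξ)]
      have := hm (Set.mem_Ici.2 le_rfl) (Set.mem_Ici.2 h0) h0
      rwa [hψ0] at this
    · have hm : AntitoneOn ψ (Set.Icc (-(ξ / (1 + ξ))) 0) := by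
        apply antitoneOn_of_deriv_nonpos (convex_Icc _ _)
        · intro y hy
          exact (hder y (by linarith [hy.1])).continuousAt.continuousWithinAt
        · intro y hy
          rw [interior_Icc] at hy
          exact (hder y (by linarith [hy.1])).differentiableAt.differentiableWithinAt
        · intro y hy
          rw [interior_Icc] at hy
          have hy1 : -(ξ / (1 + ξ)) < y := hy.1
          have hy0 : y < 0 := hy.2
          have hyp : 0 < 1 + y := by linarith
          rw [(hder y (by linarith)).deriv]
          apply mul_nonpos_of_nonneg_of_nonpos hγ0.le
          have he : (1 + y) ^ (γ - 1) = (1 + (-y / (1 + y))) ^ (1 / 2 + ξ) := by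
            have : 1 + (-y / (1 + y)) = (1 + y)⁻¹ := by field_simp; ring
            rw [this, Real.inv_rpow hyp.le, ← Real.rpow_neg hyp.le]
            congr 1; rw [hγ]; ring
          have hb : (1 + (-y / (1 + y))) ^ (1 / 2 + ξ) ≤ 1 + (1 / 2 + ξ) * (-y / (1 + y)) := by
            apply rpow_one_add_le_one_add_mul_self _ (by linarith) (by linarith)
            have : 0 ≤ -y / (1 + y) := div_nonneg (by linarith) hyp.le
            linarith
          have h8 : -y / (1 + y) ≤ -y * (1 + ξ) := by
            rw [div_le_iff₀ hyp]
            have h9 : 1 ≤ (1 + ξ) * (1 + y) := by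
              have h10 : -(ξ / (1 + ξ)) * (1 + ξ) = -ξ := by field_simp
              nlinarith
            nlinarith
          rw [he]
          nlinarith
      have := hm ⟨hx.1, h0⟩ ⟨by linarith [hx.1], le_rfl⟩ h0
      rwa [hψ0] at this
  simp only [hψ] at key
  linarith

/-- After multiplication by `q`, the dangerous term is `4 κ c² / q` with `4 κ = 1 + O(ξ)`. Bessel's
inequality `hbes` lets `D - g²` pay for the coefficient 1. The excess `5 ξ c²` and the cross terms,
which are of order `s` against `q = s²`, each cost at most `ρ / 2`. -/
theorem second_order_lower {ξ K ρ c g D q s : ℝ} (hξ : 0 < ξ) (hξ' : ξ ≤ 1 / 4) (hK : 0 < K)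
    (hρ : 10 * ξ * K ^ 2 ≤ ρ) (hs1 : 1 ≤ s) (hsq : s ^ 2 = q) (hcK : |c| ≤ s * K) (hD0 : 0 ≤ D)
    (hDK : D ≤ K ^ 2) (hbes : c ^ 2 ≤ q * (D - g ^ 2)) (hb : 2 * (4 * K ^ 3 + K ^ 4) ≤ ρ * s) :
    (2 * c + g ^ 2 - ρ) / q
      ≤ (2 * c + D) / q - ((1 / 2 + ξ) * (1 + ξ) / 2) * ((2 * c + D) / q) ^ 2 := by
  have hq0 : 0 < q := by rw [← hsq]; positivity
  have hρ0 : 0 ≤ ρ := le_trans (by positivity) hρ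
  rw [div_le_iff₀ hq0]
  have e1 : ((2 * c + D) / q - ((1 / 2 + ξ) * (1 + ξ) / 2) * ((2 * c + D) / q) ^ 2) * q
      = 2 * c + D - ((1 / 2 + ξ) * (1 + ξ) / 2) * (2 * c + D) ^ 2 / q := by
    field_simp
  rw [e1]
  obtain ⟨κ, hκ⟩ : ∃ κ, κ = (1 / 2 + ξ) * (1 + ξ) / 2 := ⟨_, rfl⟩
  rw [← hκ]
  have hκ0 : 0 ≤ κ := by rw [hκ]; positivity
  have hξ2 : ξ ^ 2 ≤ ξ * (1 / 4) := by rw [sq]; gcongr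
  have hκ1 : κ ≤ 1 := by rw [hκ]; linarith
  have hκ4 : 4 * κ - 1 ≤ 5 * ξ := by rw [hκ]; linarith
  have hcD : 4 * (c * D) + D ^ 2 ≤ s * (4 * K ^ 3 + K ^ 4) := by
    have a1 : c * D ≤ s * K * K ^ 2 := by
      calc c * D ≤ |c| * D := by gcongr; exact le_abs_self c
        _ ≤ s * K * K ^ 2 := by gcongr
    have a2 : D ^ 2 ≤ s * K ^ 4 := by
      calc D ^ 2 ≤ (K ^ 2) ^ 2 := by gcongr
        _ = 1 * K ^ 4 := by ring
        _ ≤ s * K ^ 4 := by gcongr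
    linarith
  have hcq : c ^ 2 ≤ q * K ^ 2 := by
    refine hbes.trans ?_
    gcongr
    linarith [sq_nonneg g]
  have f1 : κ * (4 * (c * D) + D ^ 2) ≤ q * (ρ / 2) := by
    have h0 : 0 ≤ s * (4 * K ^ 3 + K ^ 4) := by positivity
    have a1 : κ * (4 * (c * D) + D ^ 2) ≤ s * (4 * K ^ 3 + K ^ 4) :=
      calc κ * (4 * (c * D) + D ^ 2) ≤ κ * (s * (4 * K ^ 3 + K ^ 4)) := by gcongr
        _ ≤ 1 * (s * (4 * K ^ 3 + K ^ 4)) := by gcongr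
        _ = _ := one_mul _
    have a2 : s * (2 * (4 * K ^ 3 + K ^ 4)) ≤ s * (ρ * s) := by gcongr
    rw [← hsq]
    linarith
  have f2 : (4 * κ - 1) * c ^ 2 ≤ q * (ρ / 2) := by
    calc (4 * κ - 1) * c ^ 2 ≤ 5 * ξ * c ^ 2 := by gcongr
      _ ≤ 5 * ξ * (q * K ^ 2) := by gcongr
      _ = q * (10 * ξ * K ^ 2 / 2) := by ring
      _ ≤ q * (ρ / 2) := by gcongr
  have f3 : κ * (2 * c + D) ^ 2 / q ≤ D - g ^ 2 + ρ := by
    rw [div_le_iff₀ hq0]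
    linarith
  linarith

/-- At exponent 1/2 the function is essentially the norm, which is flat to second order in the
radial direction. What survives is the squared component of the increment along a direction `e`
orthogonal to `z`; `ρ` collects the errors from `ξ` and from finite jumps. -/
theorem lyapunov_increment {E : Type*} [NormedAddCommGroup E] [InnerProductSpace ℝ E]
    {ξ K ρ b : ℝ} (hξ : 0 < ξ) (hξ' : ξ ≤ 1 / 4) (hK : 0 < K) (hρ : 10 * ξ * K ^ 2 ≤ ρ)
    (hb : 1 ≤ b) (hb1 : (2 * K + K ^ 2) * (1 + ξ) ≤ ξ * √b)
    (hb2 : 2 * (4 * K ^ 3 + K ^ 4) ≤ ρ * √b)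
    (z δ e : E) (he : ‖e‖ = 1) (hze : inner ℝ z e = 0) (hδ : ‖δ‖ ≤ K) :
    (‖z‖ ^ 2 + b) ^ (1 / 2 - ξ) + (1 / 2 - ξ) * (‖z‖ ^ 2 + b) ^ (1 / 2 - ξ - 1) *
        (2 * inner ℝ z δ + (inner ℝ e δ) ^ 2 - ρ)
      ≤ (‖z + δ‖ ^ 2 + b) ^ (1 / 2 - ξ) := by
  set q := ‖z‖ ^ 2 + b with hq
  set c : ℝ := inner ℝ z δ with hc
  set g : ℝ := inner ℝ e δ with hg
  set D : ℝ := ‖δ‖ ^ 2 with hD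
  set s := √q with hs
  have hq1 : 1 ≤ q := by rw [hq]; nlinarith [sq_nonneg ‖z‖]
  have hq0 : 0 < q := by linarith
  have hsq : s ^ 2 = q := Real.sq_sqrt hq0.le
  have hsb : √b ≤ s := Real.sqrt_le_sqrt (by rw [hq]; nlinarith [sq_nonneg ‖z‖])
  have hs1 : 1 ≤ s := by rw [hs]; exact Real.one_le_sqrt.2 hq1
  have hzs : ‖z‖ ≤ s := by
    rw [hs]; apply Real.le_sqrt_of_sq_le; rw [hq]; linarith
  have hD0 : 0 ≤ D := sq_nonneg _
  have hDK : D ≤ K ^ 2 := by rw [hD]; exact pow_le_pow_left₀ (norm_nonneg _) hδ 2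
  have hcK : |c| ≤ s * K := by
    refine (abs_real_inner_le_norm z δ).trans ?_
    exact mul_le_mul hzs hδ (norm_nonneg _) (by linarith)
  have hbes : c ^ 2 ≤ q * (D - g ^ 2) := by
    have h1 : inner ℝ z (δ - g • e) = c := by
      rw [inner_sub_right, inner_smul_right, hze]; simp [hc]
    have h2 : ‖δ - g • e‖ ^ 2 = D - g ^ 2 := by
      rw [norm_sub_sq_real, inner_smul_right, norm_smul, he, real_inner_comm]
      simp only [Real.norm_eq_abs, mul_one, sq_abs, ← hg, ← hD]; ring
    have h3 := abs_real_inner_le_norm z (δ - g • e)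
    rw [h1] at h3
    have h4 : c ^ 2 ≤ ‖z‖ ^ 2 * ‖δ - g • e‖ ^ 2 := by
      rw [← sq_abs, ← mul_pow]; exact pow_le_pow_left₀ (abs_nonneg _) h3 2
    rw [h2] at h4
    have h5 : 0 ≤ D - g ^ 2 := by rw [← h2]; positivity
    have h6 : ‖z‖ ^ 2 ≤ q := by rw [hq]; linarith
    nlinarith
  set x := (2 * c + D) / q with hx
  have hexp : ‖z + δ‖ ^ 2 + b = q * (1 + x) := by
    rw [norm_add_sq_real, hx, hq]
    field_simp
    ring
  have hxs : |x| ≤ ξ / (1 + ξ) := by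
    rw [hx, abs_div, abs_of_pos hq0, div_le_div_iff₀ hq0 (by linarith)]
    have h1 : |2 * c + D| ≤ s * (2 * K + K ^ 2) := by
      have h3 := abs_add_le (2 * c) D
      rw [abs_mul, abs_two, abs_of_nonneg hD0] at h3
      have h4 : 1 * K ^ 2 ≤ s * K ^ 2 := by gcongr
      linarith
    have h2 : (2 * K + K ^ 2) * (1 + ξ) ≤ ξ * s := hb1.trans (by gcongr)
    calc |2 * c + D| * (1 + ξ) ≤ s * (2 * K + K ^ 2) * (1 + ξ) := by gcongr
      _ = s * ((2 * K + K ^ 2) * (1 + ξ)) := by ring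
      _ ≤ s * (ξ * s) := by gcongr
      _ = ξ * q := by rw [← hsq]; ring
  have h1x : 0 ≤ 1 + x := by
    have : ξ / (1 + ξ) < 1 := by rw [div_lt_one (by linarith)]; linarith
    linarith [(abs_le.1 hxs).1]
  have hmain := one_add_rpow_lower hξ hξ' hxs
  rw [hexp, Real.mul_rpow hq0.le h1x]
  have hqg : q ^ (1 / 2 - ξ - 1) = q ^ (1 / 2 - ξ) / q := by
    rw [Real.rpow_sub_one hq0.ne']
  rw [hqg]
  have hqp : 0 < q ^ (1 / 2 - ξ) := Real.rpow_pos_of_pos hq0 _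
  have hnum : (2 * c + g ^ 2 - ρ) / q ≤ x - ((1 / 2 + ξ) * (1 + ξ) / 2) * x ^ 2 :=
    second_order_lower hξ hξ' hK hρ hs1 hsq hcK hD0 hDK hbes (hb2.trans (by
      have : 0 ≤ ρ := le_trans (by positivity) hρ
      gcongr))
  have hγ0 : 0 < 1 / 2 - ξ := by linarith
  calc q ^ (1 / 2 - ξ) + (1 / 2 - ξ) * (q ^ (1 / 2 - ξ) / q) * (2 * c + g ^ 2 - ρ)
      = q ^ (1 / 2 - ξ) * (1 + (1 / 2 - ξ) * ((2 * c + g ^ 2 - ρ) / q)) := by ring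
    _ ≤ q ^ (1 / 2 - ξ) * (1 + (1 / 2 - ξ) * (x - ((1 / 2 + ξ) * (1 + ξ) / 2) * x ^ 2)) := by
        gcongr
    _ ≤ q ^ (1 / 2 - ξ) * (1 + x) ^ (1 / 2 - ξ) := by
        gcongr; linarith

theorem exists_unit_orthogonal {d : ℕ} (hd : 2 ≤ d) (z : EuclideanSpace ℝ (Fin d)) :
    ∃ e : EuclideanSpace ℝ (Fin d), ‖e‖ = 1 ∧ inner ℝ z e = 0 := by
  have h1 : (Submodule.span ℝ {z})ᗮ ≠ ⊥ := by
    intro h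
    have h2 := Submodule.finrank_add_finrank_orthogonal (Submodule.span ℝ {z})
    rw [h, finrank_bot, finrank_euclideanSpace_fin] at h2
    have h3 : Module.finrank ℝ (Submodule.span ℝ {z}) ≤ 1 := by
      simpa using finrank_span_le_card (R := ℝ) ({z} : Set (EuclideanSpace ℝ (Fin d)))
    omega
  obtain ⟨y, hy, hy0⟩ := Submodule.exists_mem_ne_zero_of_ne_bot h1
  have hn : ‖y‖ ≠ 0 := norm_ne_zero_iff.2 hy0
  refine ⟨(‖y‖)⁻¹ • y, ?_, ?_⟩
  · rw [norm_smul, norm_inv, norm_norm, inv_mul_cancel₀ hn]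
  · rw [inner_smul_right, Submodule.mem_orthogonal_singleton_iff_inner_right.1 hy, mul_zero]

end

section

/-! ### Measurability, boundedness and one-step conditional expectations -/

variable {d : ℕ} {Ω : Type*} {m : MeasurableSpace Ω} {μ : Measure Ω} [IsProbabilityMeasure μ]
  {ℱ : Filtration ℕ m} {l : EuclideanSpace ℝ (Fin d)} {K h r lam : ℝ}
  {X : ℕ → Ω → (Fin d → ℤ)}

/-- `f` is determined by the positions up to time `n`. -/
def DeterminedBy {β : Type*} (X : ℕ → Ω → (Fin d → ℤ)) (n : ℕ) (f : Ω → β) : Prop :=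
  ∀ ω ω', (∀ j ≤ n, X j ω = X j ω') → f ω = f ω'

/-- Such a function factors through the history up to time `n`, which takes values in a countable
discrete space where every map is measurable. -/
theorem DeterminedBy.measurable {β : Type*} [MeasurableSpace β] {n : ℕ} {f : Ω → β}
    (hf : DeterminedBy X n f) (hX : Adapted ℱ X) : Measurable[ℱ n] f := by
  rcases isEmpty_or_nonempty Ω with hΩ | hΩ
  · exact @measurable_of_empty _ _ (ℱ n) _ _ _
  set H : Ω → (Fin (n + 1) → (Fin d → ℤ)) := fun ω j => X j ω with hH
  have hHm : Measurable[ℱ n] H := by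
    refine @measurable_pi_lambda _ _ _ (ℱ n) _ _ fun j => ?_
    exact (hX j).mono (ℱ.mono (Nat.lt_succ_iff.1 j.2)) le_rfl
  have hfac : f = (fun y => f (Function.invFun H y)) ∘ H := by
    funext ω
    refine hf _ _ fun j hj => ?_
    have := Function.invFun_eq (f := H) ⟨ω, rfl⟩
    exact (congrFun this ⟨j, Nat.lt_succ_iff.2 hj⟩).symm
  rw [hfac]
  exact (Measurable.of_discrete).comp hHm

theorem measurableSet_of_determined {n : ℕ} {P : Ω → Prop}
    (hX : Adapted ℱ X) (hP : ∀ ω ω', (∀ j ≤ n, X j ω = X j ω') → P ω → P ω') :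
    MeasurableSet[ℱ n] {ω | P ω} := by
  have : DeterminedBy X n P := fun ω ω' hj =>
    propext ⟨hP ω ω' hj, hP ω' ω fun j hjn => (hj j hjn).symm⟩
  have h2 := this.measurable hX (MeasurableSet.singleton True)
  convert h2 using 1
  ext ω
  simp

theorem revisits_congr {n : ℕ} {ω ω' : Ω} (hj : ∀ j ≤ n, X j ω = X j ω') :
    Revisits X n ω ↔ Revisits X n ω' := by
  constructor
  · rintro ⟨k, hk, e⟩
    exact ⟨k, hk, by rw [← hj k hk.le, ← hj n le_rfl, e]⟩
  · rintro ⟨k, hk, e⟩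
    exact ⟨k, hk, by rw [hj k hk.le, hj n le_rfl, e]⟩

/-- The number of first visits among the times `n, …, n + i - 1`. -/
def newCount (X : ℕ → Ω → (Fin d → ℤ)) (n i : ℕ) (ω : Ω) : ℕ :=
  open Classical in ((Finset.range i).filter fun j => ¬ Revisits X (n + j) ω).card

theorem newCount_zero (n : ℕ) (ω : Ω) : newCount X n 0 ω = 0 := by simp [newCount]

open Classical in
theorem newCount_succ (n i : ℕ) (ω : Ω) :
    newCount X n (i + 1) ω = newCount X n i ω + if Revisits X (n + i) ω then 0 else 1 := by
  unfold newCount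
  rw [Finset.range_add_one, Finset.filter_insert]
  split_ifs <;> simp_all

theorem newCount_mono (n : ℕ) (ω : Ω) : Monotone fun i => newCount X n i ω := by
  classical
  refine monotone_nat_of_le_succ fun i => ?_
  rw [newCount_succ]; omega

theorem newCount_congr {n i p : ℕ} (hp : n + i ≤ p + 1) {ω ω' : Ω}
    (hj : ∀ j ≤ p, X j ω = X j ω') : newCount X n i ω = newCount X n i ω' := by
  classical
  unfold newCount
  congr 1
  refine Finset.filter_congr fun j hji => ?_
  rw [Finset.mem_range] at hji
  rw [revisits_congr fun k hk => hj k (by omega)]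

/-- The displacement between times `n` and `n + i`. -/
def disp (X : ℕ → Ω → (Fin d → ℤ)) (n i : ℕ) (ω : Ω) : EuclideanSpace ℝ (Fin d) :=
  toVec (X (n + i) ω) - toVec (X n ω)

theorem disp_zero (n : ℕ) (ω : Ω) : disp X n 0 ω = 0 := by simp [disp]

theorem disp_succ (n i : ℕ) (ω : Ω) : disp X n (i + 1) ω = disp X n i ω + jump X (n + i) ω := by
  simp only [disp, jump, ← add_assoc]; abel

theorem IsGeneralizedExcitedRandomWalk.ae_norm_disp_le
    (hX : IsGeneralizedExcitedRandomWalk μ ℱ l K h r lam X) :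
    ∀ᵐ ω ∂μ, ∀ n i, ‖disp X n i ω‖ ≤ K * i := by
  filter_upwards [hX.condB] with ω hω n i
  induction i with
  | zero => simp [disp_zero]
  | succ i ih =>
    rw [disp_succ]
    refine (norm_add_le _ _).trans ?_
    push_cast
    linarith [hω (n + i)]

theorem IsGeneralizedExcitedRandomWalk.ae_norm_le
    (hX : IsGeneralizedExcitedRandomWalk μ ℱ l K h r lam X) :
    ∀ᵐ ω ∂μ, ∀ n, ‖toVec (X n ω)‖ ≤ K * n := by
  filter_upwards [hX.ae_norm_disp_le, hX.start] with ω hω h0 n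
  have := hω 0 n
  simp only [disp, zero_add, h0] at this
  have h0' : toVec (0 : Fin d → ℤ) = 0 := by ext i; simp [toVec]
  rwa [h0', sub_zero] at this

theorem measurable_comp {β : Type*} [MeasurableSpace β] (hX : Adapted ℱ X) (n : ℕ)
    (f : (Fin d → ℤ) → β) : Measurable[ℱ n] fun ω => f (X n ω) :=
  Measurable.of_discrete.comp (hX n)

theorem measurable_jump (hX : Adapted ℱ X) (n : ℕ) : Measurable (jump X n) :=
  (((measurable_comp hX (n + 1) toVec).mono (ℱ.le _) le_rfl)).sub
    ((measurable_comp hX n toVec).mono (ℱ.le _) le_rfl)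

theorem IsGeneralizedExcitedRandomWalk.integrable_jump
    (hX : IsGeneralizedExcitedRandomWalk μ ℱ l K h r lam X) (n : ℕ) :
    Integrable (jump X n) μ :=
  Integrable.of_bound (measurable_jump hX.adapted n).aestronglyMeasurable K
    (by filter_upwards [hX.condB] with ω hω using hω n)

theorem IsGeneralizedExcitedRandomWalk.integrable_inner
    (hX : IsGeneralizedExcitedRandomWalk μ ℱ l K h r lam X) (g : EuclideanSpace ℝ (Fin d)) (n : ℕ) :
    Integrable (fun ω => inner ℝ g (jump X n ω)) μ :=
  (hX.integrable_jump n).const_inner g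

theorem IsGeneralizedExcitedRandomWalk.condExp_inner
    (hX : IsGeneralizedExcitedRandomWalk μ ℱ l K h r lam X) (g : EuclideanSpace ℝ (Fin d)) (n : ℕ) :
    μ[fun ω => inner ℝ g (jump X n ω) | ℱ n] =ᵐ[μ] fun ω => inner ℝ g (drift μ ℱ X n ω) :=
  ((innerSL ℝ g).comp_condExp_comm (m := ℱ n) (hX.integrable_jump n)).symm

theorem IsGeneralizedExcitedRandomWalk.condExp_inner_revisit
    (hX : IsGeneralizedExcitedRandomWalk μ ℱ l K h r lam X) (g : EuclideanSpace ℝ (Fin d)) (n : ℕ) :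
    ∀ᵐ ω ∂μ, Revisits X n ω → (μ[fun ω => inner ℝ g (jump X n ω) | ℱ n]) ω = 0 := by
  filter_upwards [hX.condExp_inner g n, (hX.condCPlus n).1] with ω h1 h2 h3
  rw [h1, h2 h3, inner_zero_right]

theorem IsGeneralizedExcitedRandomWalk.condExp_inner_new
    (hX : IsGeneralizedExcitedRandomWalk μ ℱ l K h r lam X) (n : ℕ) :
    ∀ᵐ ω ∂μ, ¬ Revisits X n ω → lam ≤ (μ[fun ω => inner ℝ l (jump X n ω) | ℱ n]) ω := by
  filter_upwards [hX.condExp_inner l n, (hX.condCPlus n).2] with ω h1 h2 h3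
  rw [h1, real_inner_comm]
  exact h2 h3

theorem IsGeneralizedExcitedRandomWalk.condExp_inner_le
    (hX : IsGeneralizedExcitedRandomWalk μ ℱ l K h r lam X) (g : EuclideanSpace ℝ (Fin d)) (n : ℕ) :
    ∀ᵐ ω ∂μ, (μ[fun ω => inner ℝ g (jump X n ω) | ℱ n]) ω ≤ ‖g‖ * K := by
  have h1 := condExp_mono (m := ℱ n) (hX.integrable_inner g n) (integrable_const (‖g‖ * K))
    (by
      filter_upwards [hX.condB] with ω hω
      exact (real_inner_le_norm _ _).trans (mul_le_mul_of_nonneg_left (hω n) (norm_nonneg g)))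
  rw [condExp_const (ℱ.le n)] at h1
  exact h1

/-- The bound on the conditional expectation is asked only where the weight is nonzero, so
restrictions to events and stopping rules can be hidden in `W` as indicators. -/
theorem integral_mul_le_of_condExp_le {n : ℕ} {W ξ η : Ω → ℝ} {C : ℝ}
    (hW : StronglyMeasurable[ℱ n] W) (hW0 : ∀ ω, 0 ≤ W ω) (hWC : ∀ᵐ ω ∂μ, W ω ≤ C)
    (hξ : Integrable ξ μ) (hη : Integrable η μ)
    (hle : ∀ᵐ ω ∂μ, W ω ≠ 0 → (μ[ξ | ℱ n]) ω ≤ η ω) :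
    ∫ ω, W ω * ξ ω ∂μ ≤ ∫ ω, W ω * η ω ∂μ := by
  have hWm : AEStronglyMeasurable W μ := (hW.mono (ℱ.le n)).aestronglyMeasurable
  have hb : ∀ᵐ ω ∂μ, ‖W ω‖ ≤ C := by
    filter_upwards [hWC] with ω hω
    rwa [Real.norm_eq_abs, abs_of_nonneg (hW0 ω)]
  have h1 : μ[W * ξ | ℱ n] =ᵐ[μ] W * μ[ξ | ℱ n] :=
    condExp_stronglyMeasurable_mul_of_bound₀ (ℱ.le n) hW.aestronglyMeasurable hξ C hb
  calc ∫ ω, W ω * ξ ω ∂μ = ∫ ω, (μ[W * ξ | ℱ n]) ω ∂μ := (integral_condExp (ℱ.le n)).symm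
    _ = ∫ ω, W ω * (μ[ξ | ℱ n]) ω ∂μ := integral_congr_ae h1
    _ ≤ ∫ ω, W ω * η ω ∂μ := by
        refine integral_mono_ae (integrable_condExp.bdd_mul hWm hb) (hη.bdd_mul hWm hb) ?_
        filter_upwards [hle] with ω hω
        rcases eq_or_ne (W ω) 0 with h0 | h0
        · simp [h0]
        · exact mul_le_mul_of_nonneg_left (hω h0) (hW0 ω)

theorem exp_le_quadratic {x : ℝ} (hx : |x| ≤ 1) : Real.exp x ≤ 1 + x + x ^ 2 := by
  have := Real.abs_exp_sub_one_sub_id_le hx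
  linarith [(abs_le.1 this).2]

open Classical in
/-- Exponential supermartingale for the displacement in a fixed direction. -/
theorem IsGeneralizedExcitedRandomWalk.setIntegral_exp_le
    (hX : IsGeneralizedExcitedRandomWalk μ ℱ l K h r lam X) (hK : 0 < K)
    {g : EuclideanSpace ℝ (Fin d)} (hg : ‖g‖ = 1) {κ θ : ℝ}
    (hκ : ∀ n, ∀ᵐ ω ∂μ, (μ[fun ω => inner ℝ g (jump X n ω) | ℱ n]) ω
      ≤ if Revisits X n ω then 0 else κ)
    (hθ : 0 ≤ θ) (hθK : θ * K ≤ 1) {n : ℕ} {A : Set Ω} (hA : MeasurableSet[ℱ n] A) (i : ℕ) :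
    IntegrableOn (fun ω => Real.exp (θ * inner ℝ g (disp X n i ω) - θ * κ * newCount X n i ω
      - θ ^ 2 * K ^ 2 * i)) A μ ∧
    ∫ ω in A, Real.exp (θ * inner ℝ g (disp X n i ω) - θ * κ * newCount X n i ω
      - θ ^ 2 * K ^ 2 * i) ∂μ ≤ μ.real A := by
  set Z : ℕ → Ω → ℝ := fun i ω => Real.exp (θ * inner ℝ g (disp X n i ω)
    - θ * κ * newCount X n i ω - θ ^ 2 * K ^ 2 * i) with hZ
  have hAm : MeasurableSet A := ℱ.le n _ hA
  have hZm : ∀ i, Measurable[ℱ (n + i)] (Z i) := by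
    intro i
    refine DeterminedBy.measurable (X := X) (fun ω ω' hj => ?_) hX.adapted
    simp only [hZ, disp]
    rw [hj n (by omega), hj (n + i) le_rfl, newCount_congr (p := n + i) (by omega) hj]
  have hcard : ∀ i ω, newCount X n i ω ≤ i := fun i ω => by
    have := Finset.card_filter_le (Finset.range i) (fun j => ¬ Revisits X (n + j) ω)
    rw [Finset.card_range] at this
    unfold newCount
    convert this
  have hZb : ∀ i, ∀ᵐ ω ∂μ, Z i ω ≤ Real.exp (i + |θ * κ| * i) := by
    intro i
    filter_upwards [hX.ae_norm_disp_le] with ω hω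
    apply Real.exp_le_exp.2
    have h1 : θ * inner ℝ g (disp X n i ω) ≤ i := by
      have h2 := real_inner_le_norm g (disp X n i ω)
      rw [hg, one_mul] at h2
      calc θ * inner ℝ g (disp X n i ω) ≤ θ * (K * i) := by gcongr; exact h2.trans (hω n i)
        _ = (θ * K) * i := by ring
        _ ≤ 1 * i := by gcongr
        _ = i := one_mul _
    have h3 : -(θ * κ * newCount X n i ω) ≤ |θ * κ| * i := by
      calc -(θ * κ * newCount X n i ω) = -(θ * κ) * newCount X n i ω := by ring
        _ ≤ |θ * κ| * newCount X n i ω := by gcongr; exact neg_le_abs _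
        _ ≤ |θ * κ| * i := by gcongr; exact hcard i ω
    have h4 : 0 ≤ θ ^ 2 * K ^ 2 * i := by positivity
    linarith
  have hZint : ∀ i, Integrable (Z i) μ := by
    intro i
    refine Integrable.of_bound ((hZm i).mono (ℱ.le _) le_rfl).aestronglyMeasurable _
      (by filter_upwards [hZb i] with ω hω
          rw [Real.norm_eq_abs, abs_of_nonneg (Real.exp_pos _).le]; exact hω)
  refine ⟨(hZint i).integrableOn, ?_⟩
  show ∫ ω in A, Z i ω ∂μ ≤ _
  induction i with
  | zero => simp [hZ, disp_zero, newCount_zero]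
  | succ i ih =>
    refine le_trans ?_ ih
    set ν : Ω → ℝ := fun ω => if Revisits X (n + i) ω then 0 else κ with hν
    set W : Ω → ℝ := A.indicator fun ω => Z i ω * Real.exp (-(θ * ν ω) - θ ^ 2 * K ^ 2) with hWdef
    have hνm : Measurable[ℱ (n + i)] ν := by
      refine DeterminedBy.measurable (X := X) (fun ω ω' hj => ?_) hX.adapted
      simp only [hν]
      rw [revisits_congr hj]
    have hνint : Integrable ν μ := by
      refine Integrable.of_bound (hνm.mono (ℱ.le _) le_rfl).aestronglyMeasurable |κ|
        (ae_of_all _ fun ω => ?_)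
      simp only [hν]
      split_ifs <;> simp
    have hWm : StronglyMeasurable[ℱ (n + i)] W := by
      refine Measurable.stronglyMeasurable ?_
      refine Measurable.indicator ?_ (ℱ.mono (Nat.le_add_right n i) _ hA)
      exact (hZm i).mul (((hνm.const_mul θ).neg.sub_const _).exp)
    have hW0 : ∀ ω, 0 ≤ W ω := fun ω => Set.indicator_nonneg (fun _ _ => by positivity) ω
    have hWb : ∀ᵐ ω ∂μ, W ω ≤ Real.exp (i + |θ * κ| * i) * Real.exp |θ * κ| := by
      filter_upwards [hZb i] with ω hω
      refine (Set.indicator_le_self' (fun _ _ => by positivity) ω).trans ?_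
      refine mul_le_mul hω (Real.exp_le_exp.2 ?_) (Real.exp_pos _).le (Real.exp_pos _).le
      have h4 : 0 ≤ θ ^ 2 * K ^ 2 := by positivity
      simp only [hν]
      split_ifs
      · have := abs_nonneg (θ * κ); linarith
      · have := neg_le_abs (θ * κ); linarith
    have hint := hX.integrable_inner g (n + i)
    have hstep := integral_mul_le_of_condExp_le (μ := μ) hWm hW0 hWb hint hνint
      (by filter_upwards [hκ (n + i)] with ω hω _ using hω)
    have hWb' : ∀ᵐ ω ∂μ, ‖W ω‖ ≤ Real.exp (i + |θ * κ| * i) * Real.exp |θ * κ| := by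
      filter_upwards [hWb] with ω hω
      rwa [Real.norm_eq_abs, abs_of_nonneg (hW0 ω)]
    have hWae : AEStronglyMeasurable W μ := (hWm.mono (ℱ.le _)).aestronglyMeasurable
    have hWint : Integrable W μ := Integrable.of_bound hWae _ hWb'
    -- With `y` the new increment in direction `g`, `exp (θ y) ≤ 1 + θ y + θ² K²` makes the step
    -- linear in `y`. The conditional drift is then replaced by `ν`, and `1 + u ≤ exp u` turns the
    -- result back into `Z i`.
    calc ∫ ω in A, Z (i + 1) ω ∂μ
        = ∫ ω, A.indicator (Z (i + 1)) ω ∂μ := (integral_indicator hAm).symm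
      _ ≤ ∫ ω, (1 + θ ^ 2 * K ^ 2) * W ω + θ * (W ω * inner ℝ g (jump X (n + i) ω)) ∂μ := by
          refine integral_mono_ae ((hZint (i + 1)).indicator hAm)
            ((hWint.const_mul _).add ((hint.bdd_mul hWae hWb').const_mul _)) ?_
          filter_upwards [hX.condB] with ω hω
          by_cases hωA : ω ∈ A
          · simp only [hWdef, Set.indicator_of_mem hωA]
            set y : ℝ := inner ℝ g (jump X (n + i) ω) with hy
            have hyK : |y| ≤ K := by
              refine (abs_real_inner_le_norm _ _).trans ?_
              rw [hg, one_mul]; exact hω _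
            have hzz : Z (i + 1) ω
                = Z i ω * Real.exp (-(θ * ν ω) - θ ^ 2 * K ^ 2) * Real.exp (θ * y) := by
              simp only [hZ]
              rw [← Real.exp_add, ← Real.exp_add, disp_succ, inner_add_right, newCount_succ]
              congr 1
              simp only [hν]
              push_cast
              split_ifs <;> ring
            have hθy : |θ * y| ≤ 1 := by
              rw [abs_mul, abs_of_nonneg hθ]
              exact (mul_le_mul_of_nonneg_left hyK hθ).trans hθK
            have hexp := exp_le_quadratic hθy
            have hy2 : (θ * y) ^ 2 ≤ θ ^ 2 * K ^ 2 := by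
              rw [mul_pow]
              refine mul_le_mul_of_nonneg_left ?_ (sq_nonneg θ)
              rw [← sq_abs]
              gcongr
            rw [hzz]
            calc _ ≤ Z i ω * Real.exp (-(θ * ν ω) - θ ^ 2 * K ^ 2) * (1 + θ * y + θ ^ 2 * K ^ 2) := by
                  gcongr; linarith
              _ = _ := by ring
          · simp [hWdef, Set.indicator_of_notMem hωA]
      _ = (1 + θ ^ 2 * K ^ 2) * ∫ ω, W ω ∂μ + θ * ∫ ω, W ω * inner ℝ g (jump X (n + i) ω) ∂μ := by
          rw [integral_add (hWint.const_mul _) ((hint.bdd_mul hWae hWb').const_mul _),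
            integral_const_mul, integral_const_mul]
      _ ≤ (1 + θ ^ 2 * K ^ 2) * ∫ ω, W ω ∂μ + θ * ∫ ω, W ω * ν ω ∂μ := by gcongr
      _ = ∫ ω, (1 + θ ^ 2 * K ^ 2) * W ω + θ * (W ω * ν ω) ∂μ := by
          rw [integral_add (hWint.const_mul _) ((hνint.bdd_mul hWae hWb').const_mul _),
            integral_const_mul, integral_const_mul]
      _ ≤ ∫ ω, A.indicator (Z i) ω ∂μ := by
          refine integral_mono ((hWint.const_mul _).add ((hνint.bdd_mul hWae hWb').const_mul _))
            ((hZint i).indicator hAm) fun ω => ?_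
          by_cases hωA : ω ∈ A
          · simp only [hWdef, Set.indicator_of_mem hωA]
            have h1 : θ * ν ω + θ ^ 2 * K ^ 2 + 1 ≤ Real.exp (θ * ν ω + θ ^ 2 * K ^ 2) :=
              Real.add_one_le_exp _
            have h2 : Real.exp (-(θ * ν ω) - θ ^ 2 * K ^ 2) * Real.exp (θ * ν ω + θ ^ 2 * K ^ 2) = 1 := by
              rw [← Real.exp_add, ← Real.exp_zero]; congr 1; ring
            have hz0 : 0 ≤ Z i ω := (Real.exp_pos _).le
            calc (1 + θ ^ 2 * K ^ 2) * (Z i ω * Real.exp (-(θ * ν ω) - θ ^ 2 * K ^ 2))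
                  + θ * (Z i ω * Real.exp (-(θ * ν ω) - θ ^ 2 * K ^ 2) * ν ω)
                = Z i ω * (Real.exp (-(θ * ν ω) - θ ^ 2 * K ^ 2)
                    * (θ * ν ω + θ ^ 2 * K ^ 2 + 1)) := by ring
              _ ≤ Z i ω * (Real.exp (-(θ * ν ω) - θ ^ 2 * K ^ 2)
                    * Real.exp (θ * ν ω + θ ^ 2 * K ^ 2)) := by gcongr
              _ = Z i ω := by rw [h2, mul_one]
          · simp [hWdef, Set.indicator_of_notMem hωA]
      _ = ∫ ω in A, Z i ω ∂μ := integral_indicator hAm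

end

/-! ### Exponential tails for displacements and for numbers of visits -/

section

variable {d : ℕ} {Ω : Type*} {m : MeasurableSpace Ω} {μ : Measure Ω} [IsProbabilityMeasure μ]
  {ℱ : Filtration ℕ m} {l : EuclideanSpace ℝ (Fin d)} {K h r lam : ℝ}
  {X : ℕ → Ω → (Fin d → ℤ)}

/-- Chernoff's bound for the exponential supermartingale. It is used with `g = -l`, `κ = -lam`,
where first visits help, and with an arbitrary unit `g`, `κ = K`, where they are only known to do
limited harm. -/
theorem IsGeneralizedExcitedRandomWalk.measure_disp_ge_le
    (hX : IsGeneralizedExcitedRandomWalk μ ℱ l K h r lam X) (hK : 0 < K)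
    {g : EuclideanSpace ℝ (Fin d)} (hg : ‖g‖ = 1) {κ θ : ℝ}
    (hκ : ∀ n, ∀ᵐ ω ∂μ, ¬ Revisits X n ω →
      (μ[fun ω => inner ℝ g (jump X n ω) | ℱ n]) ω ≤ κ)
    (hθ : 0 ≤ θ) (hθK : θ * K ≤ 1) {n : ℕ} {A : Set Ω} (hA : MeasurableSet[ℱ n] A) (i : ℕ) (s : ℝ) :
    μ.real (A ∩ {ω | s ≤ inner ℝ g (disp X n i ω) - κ * newCount X n i ω})
      ≤ Real.exp (-(θ * s) + θ ^ 2 * K ^ 2 * i) * μ.real A := by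
  classical
  obtain ⟨hint, hle⟩ := hX.setIntegral_exp_le hK hg (κ := κ) (fun n => by
    filter_upwards [hκ n, hX.condExp_inner_revisit g n] with ω h1 h2
    split_ifs with hr
    · exact (h2 hr).le
    · exact h1 hr) hθ hθK hA i
  set Z : Ω → ℝ := fun ω => Real.exp (θ * inner ℝ g (disp X n i ω)
    - θ * κ * newCount X n i ω - θ ^ 2 * K ^ 2 * i) with hZ
  have hAm : MeasurableSet A := ℱ.le n _ hA
  have hm := mul_meas_ge_le_integral_of_nonneg (μ := μ.restrict A) (f := Z)
    (ae_of_all _ fun ω => (Real.exp_pos _).le) hint (Real.exp (θ * s - θ ^ 2 * K ^ 2 * i))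
  have hsub : μ.real (A ∩ {ω | s ≤ inner ℝ g (disp X n i ω) - κ * newCount X n i ω})
      ≤ (μ.restrict A).real {ω | Real.exp (θ * s - θ ^ 2 * K ^ 2 * i) ≤ Z ω} := by
    rw [measureReal_restrict_apply' hAm]
    refine measureReal_mono ?_ (measure_ne_top _ _)
    rintro ω ⟨hωA, hω⟩
    refine ⟨Real.exp_le_exp.2 ?_, hωA⟩
    have : θ * s ≤ θ * (inner ℝ g (disp X n i ω) - κ * newCount X n i ω) :=
      mul_le_mul_of_nonneg_left hω hθ
    linarith
  have h3 := hm.trans hle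
  have hpos := Real.exp_pos (θ * s - θ ^ 2 * K ^ 2 * i)
  have h4 : Real.exp (-(θ * s) + θ ^ 2 * K ^ 2 * i) * Real.exp (θ * s - θ ^ 2 * K ^ 2 * i) = 1 := by
    rw [← Real.exp_add, ← Real.exp_zero]; congr 1; ring
  calc _ ≤ _ := hsub
    _ = Real.exp (-(θ * s) + θ ^ 2 * K ^ 2 * i) * (Real.exp (θ * s - θ ^ 2 * K ^ 2 * i)
        * (μ.restrict A).real {ω | Real.exp (θ * s - θ ^ 2 * K ^ 2 * i) ≤ Z ω}) := by
        rw [← mul_assoc, h4, one_mul]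
    _ ≤ _ := by gcongr

open Classical in
/-- The number of visits before time `i`, for a sequence of events `vis`. -/
def visitCount (vis : ℕ → Set Ω) (i : ℕ) (ω : Ω) : ℕ :=
  ((Finset.range i).filter fun j => ω ∈ vis j).card

open Classical in
theorem visitCount_succ (vis : ℕ → Set Ω) (i : ℕ) (ω : Ω) :
    visitCount vis (i + 1) ω = visitCount vis i ω + if ω ∈ vis i then 1 else 0 := by
  unfold visitCount
  rw [Finset.range_add_one, Finset.filter_insert]
  split_ifs <;> simp_all

theorem visitCount_le (vis : ℕ → Set Ω) (i : ℕ) (ω : Ω) : visitCount vis i ω ≤ i := by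
  classical
  induction i with
  | zero => simp [visitCount]
  | succ i ih => rw [visitCount_succ]; split_ifs <;> omega

theorem measurable_visitCount {n : ℕ} {vis : ℕ → Set Ω}
    (hvis : ∀ i, MeasurableSet[ℱ (n + i)] (vis i)) (i p : ℕ) (hp : n + i ≤ p + 1) :
    Measurable[ℱ p] fun ω => (visitCount vis i ω : ℝ) := by
  classical
  induction i with
  | zero => simp only [visitCount, Finset.range_zero, Finset.filter_empty, Finset.card_empty,
      Nat.cast_zero]; exact measurable_const
  | succ i ih =>
    have : (fun ω => (visitCount vis (i + 1) ω : ℝ))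
        = fun ω => (visitCount vis i ω : ℝ) + (vis i).indicator (fun _ => (1 : ℝ)) ω := by
      funext ω
      rw [visitCount_succ, Set.indicator_apply]
      push_cast
      rfl
    rw [this]
    exact (ih (by omega)).add (measurable_const.indicator (ℱ.mono (by omega) _ (hvis i)))

/-- A bounded function with negative drift at each visit forces the number of visits to have an
exponential tail. -/
theorem measure_visitCount_ge_le {n : ℕ} {A : Set Ω} (hA : MeasurableSet[ℱ n] A)
    {U : ℕ → Ω → ℝ} {act vis : ℕ → Set Ω} {B c : ℝ} (hB : 0 < B) (hc : 0 < c)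
    (hUint : ∀ i, Integrable (U i) μ)
    (hact : ∀ i, MeasurableSet[ℱ (n + i)] (act i))
    (hvis : ∀ i, MeasurableSet[ℱ (n + i)] (vis i))
    (hU0 : ∀ i, ∀ᵐ ω ∂μ, ω ∈ A → (∀ j < i, ω ∈ act j) → 0 ≤ U i ω)
    (hUB : ∀ i ω, U i ω ≤ B)
    (hstep : ∀ i, ∀ᵐ ω ∂μ, ω ∈ A → (∀ j ≤ i, ω ∈ act j) →
      (μ[U (i + 1) | ℱ (n + i)]) ω ≤ U i ω - (vis i).indicator (fun _ => c) ω) (N : ℕ) (L : ℝ) :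
    μ.real (A ∩ {ω | (∀ j < N, ω ∈ act j) ∧ L ≤ visitCount vis N ω})
      ≤ 2 * Real.exp (-(c * L / (2 * B))) * μ.real A := by
  classical
  set θ := c / (2 * B) with hθ
  have hθ0 : 0 < θ := by positivity
  have hAm : MeasurableSet A := ℱ.le n _ hA
  set S : ℕ → Set Ω := fun i => A ∩ {ω | ∀ j < i, ω ∈ act j} with hS
  have hSm : ∀ i p, n + i ≤ p + 1 → n ≤ p → MeasurableSet[ℱ p] (S i) := by
    intro i p hp hnp
    refine (ℱ.mono hnp _ hA).inter ?_
    have : {ω | ∀ j < i, ω ∈ act j} = ⋂ j ∈ Finset.range i, act j := by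
      ext ω; simp
    rw [this]
    refine Finset.measurableSet_biInter _ fun j hj => ?_
    rw [Finset.mem_range] at hj
    exact ℱ.mono (by omega) _ (hact j)
  -- On `S i` the factor `1 + U / B` lies between 1 and 2. A visit multiplies the exponential by
  -- `exp θ` but lowers the other factor on average by `c / B = 2 θ`, hence by a relative amount at
  -- least `θ`; so the integral of `Ψ` does not increase. The upper bound 2 at time 0 is the
  -- prefactor in the result.
  set Ψ : ℕ → Ω → ℝ := fun i => (S i).indicator fun ω =>
    Real.exp (θ * visitCount vis i ω) * (1 + U i ω / B) with hΨ
  have hEm : ∀ i p, n + i ≤ p + 1 → Measurable[ℱ p] fun ω => Real.exp (θ * visitCount vis i ω) :=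
    fun i p hp => ((measurable_visitCount hvis i p hp).const_mul θ).exp
  have hEb : ∀ i ω, Real.exp (θ * visitCount vis i ω) ≤ Real.exp (θ * i) := by
    intro i ω
    apply Real.exp_le_exp.2
    have : (visitCount vis i ω : ℝ) ≤ i := by exact_mod_cast visitCount_le vis i ω
    gcongr
  have h1U : ∀ i, Integrable (fun ω => 1 + U i ω / B) μ := fun i =>
    (integrable_const 1).add ((hUint i).div_const B)
  have hΨint : ∀ i, Integrable (Ψ i) μ := by
    intro i
    refine Integrable.indicator ?_ (ℱ.le _ _ (hSm i (n + i) (by omega) (by omega)))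
    refine (h1U i).bdd_mul (((hEm i (n + i) (by omega)).mono (ℱ.le _) le_rfl).aestronglyMeasurable)
      (c := Real.exp (θ * i)) (ae_of_all _ fun ω => ?_)
    rw [Real.norm_eq_abs, abs_of_nonneg (Real.exp_pos _).le]
    exact hEb i ω
  have hmono : ∀ i, ∫ ω, Ψ (i + 1) ω ∂μ ≤ ∫ ω, Ψ i ω ∂μ := by
    intro i
    set W : Ω → ℝ := (S (i + 1)).indicator fun ω => Real.exp (θ * visitCount vis (i + 1) ω) with hW
    have hWm : StronglyMeasurable[ℱ (n + i)] W :=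
      (Measurable.indicator (hEm (i + 1) (n + i) (by omega))
        (hSm (i + 1) (n + i) (by omega) (by omega))).stronglyMeasurable
    have hW0 : ∀ ω, 0 ≤ W ω := fun ω => Set.indicator_nonneg (fun _ _ => (Real.exp_pos _).le) ω
    have hWb : ∀ ω, W ω ≤ Real.exp (θ * (i + 1 : ℕ)) := fun ω =>
      (Set.indicator_le_self' (fun _ _ => (Real.exp_pos _).le) ω).trans (hEb _ ω)
    have hWae : AEStronglyMeasurable W μ := (hWm.mono (ℱ.le _)).aestronglyMeasurable
    have hWb' : ∀ᵐ ω ∂μ, ‖W ω‖ ≤ Real.exp (θ * (i + 1 : ℕ)) := ae_of_all _ fun ω => by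
      rw [Real.norm_eq_abs, abs_of_nonneg (hW0 ω)]; exact hWb ω
    have hWint : Integrable W μ := Integrable.of_bound hWae _ hWb'
    set η : Ω → ℝ := fun ω => U i ω - (vis i).indicator (fun _ => c) ω with hη
    have hηint : Integrable η μ :=
      (hUint i).sub ((integrable_const c).indicator (ℱ.le _ _ (hvis i)))
    have hs := integral_mul_le_of_condExp_le (μ := μ) hWm hW0 (ae_of_all _ hWb) (hUint (i + 1)) hηint
      (by
        filter_upwards [hstep i] with ω hω hne
        have : ω ∈ S (i + 1) := Set.mem_of_indicator_ne_zero hne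
        exact hω this.1 fun j hj => this.2 j (Nat.lt_succ_of_le hj))
    calc ∫ ω, Ψ (i + 1) ω ∂μ = ∫ ω, W ω + B⁻¹ * (W ω * U (i + 1) ω) ∂μ := by
          refine integral_congr_ae (ae_of_all _ fun ω => ?_)
          simp only [hΨ, hW, Set.indicator_apply]
          split_ifs <;> ring
      _ = ∫ ω, W ω ∂μ + B⁻¹ * ∫ ω, W ω * U (i + 1) ω ∂μ := by
          rw [integral_add hWint (((hUint (i + 1)).bdd_mul hWae hWb').const_mul _),
            integral_const_mul]
      _ ≤ ∫ ω, W ω ∂μ + B⁻¹ * ∫ ω, W ω * η ω ∂μ := by gcongr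
      _ = ∫ ω, W ω + B⁻¹ * (W ω * η ω) ∂μ := by
          rw [integral_add hWint ((hηint.bdd_mul hWae hWb').const_mul _), integral_const_mul]
      _ ≤ ∫ ω, Ψ i ω ∂μ := by
          refine integral_mono_ae (hWint.add ((hηint.bdd_mul hWae hWb').const_mul _)) (hΨint i) ?_
          filter_upwards [hU0 i] with ω hω
          simp only [hΨ, hW]
          by_cases hi : ω ∈ S i
          · have hu0 := hω hi.1 hi.2
            have huB := hUB i ω
            rw [Set.indicator_of_mem hi]
            by_cases hi' : ω ∈ S (i + 1)
            · rw [Set.indicator_of_mem hi', visitCount_succ]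
              simp only [hη, Set.indicator_apply]
              split_ifs with hv
              · push_cast
                rw [mul_add, mul_one, Real.exp_add]
                have h1 : 1 + B⁻¹ * (U i ω - c) ≤ (1 + U i ω / B) * (1 - θ) := by
                  have : (1 + U i ω / B) * (1 - θ) - (1 + B⁻¹ * (U i ω - c))
                      = θ * (1 - U i ω / B) := by
                    rw [hθ]; field_simp; ring
                  have h2 : U i ω / B ≤ 1 := (div_le_one hB).2 huB
                  nlinarith
                have h2 : 1 - θ ≤ Real.exp (-θ) := by
                  have := Real.add_one_le_exp (-θ); linarith
                have h3 : Real.exp θ * Real.exp (-θ) = 1 := by rw [← Real.exp_add]; simp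
                have h4 : 0 ≤ 1 + U i ω / B := by positivity
                calc _ = Real.exp (θ * visitCount vis i ω) * Real.exp θ * (1 + B⁻¹ * (U i ω - c)) := by
                      ring
                  _ ≤ Real.exp (θ * visitCount vis i ω) * Real.exp θ *
                      ((1 + U i ω / B) * Real.exp (-θ)) := by
                      gcongr
                      exact h1.trans (by gcongr)
                  _ = Real.exp (θ * visitCount vis i ω) * (1 + U i ω / B)
                      * (Real.exp θ * Real.exp (-θ)) := by ring
                  _ = _ := by rw [h3, mul_one]
              · simp only [add_zero, sub_zero]
                apply le_of_eq; ring
            · rw [Set.indicator_of_notMem hi']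
              simp only [zero_mul, mul_zero, add_zero]
              positivity
          · have hi' : ω ∉ S (i + 1) := fun h => hi ⟨h.1, fun j hj => h.2 j (by omega)⟩
            rw [Set.indicator_of_notMem hi, Set.indicator_of_notMem hi']
            simp
  have hN : ∫ ω, Ψ N ω ∂μ ≤ ∫ ω, Ψ 0 ω ∂μ :=
    antitone_nat_of_succ_le (f := fun i => ∫ ω, Ψ i ω ∂μ) hmono (Nat.zero_le N)
  have h0 : ∫ ω, Ψ 0 ω ∂μ ≤ 2 * μ.real A := by
    calc ∫ ω, Ψ 0 ω ∂μ ≤ ∫ ω, A.indicator (fun _ => (2 : ℝ)) ω ∂μ := by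
          refine integral_mono (hΨint 0) ((integrable_const _).indicator hAm) fun ω => ?_
          have h2 : U 0 ω / B ≤ 1 := (div_le_one hB).2 (hUB 0 ω)
          simp only [hΨ, hS, visitCount, Set.indicator_apply]
          by_cases hωA : ω ∈ A <;> simp [hωA]
          linarith
      _ = 2 * μ.real A := by
          rw [integral_indicator hAm]; simp [mul_comm]
  set T : Set Ω := A ∩ {ω | (∀ j < N, ω ∈ act j) ∧ L ≤ visitCount vis N ω} with hT
  have hTm : MeasurableSet T := by
    have : T = S N ∩ {ω | L ≤ (visitCount vis N ω : ℝ)} := by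
      ext ω; simp only [hT, hS, Set.mem_inter_iff, Set.mem_ofPred_eq]; tauto
    rw [this]
    exact (ℱ.le _ _ (hSm N (n + N) (by omega) (by omega))).inter
      (measurableSet_le measurable_const
        ((measurable_visitCount hvis N (n + N) (by omega)).mono (ℱ.le _) le_rfl))
  have hlow : Real.exp (θ * L) * μ.real T ≤ ∫ ω, Ψ N ω ∂μ := by
    calc Real.exp (θ * L) * μ.real T = ∫ ω, T.indicator (fun _ => Real.exp (θ * L)) ω ∂μ := by
          rw [integral_indicator hTm]; simp [mul_comm]
      _ ≤ ∫ ω, Ψ N ω ∂μ := by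
          refine integral_mono_ae ((integrable_const _).indicator hTm) (hΨint N) ?_
          filter_upwards [hU0 N] with ω hω
          by_cases hωT : ω ∈ T
          · have hS' : ω ∈ S N := ⟨hωT.1, hωT.2.1⟩
            have hu := hω hS'.1 hS'.2
            simp only [hΨ, Set.indicator_of_mem hωT, Set.indicator_of_mem hS']
            have h1 : Real.exp (θ * L) ≤ Real.exp (θ * visitCount vis N ω) := by
              apply Real.exp_le_exp.2
              have := hωT.2.2
              gcongr
            have h2 : 0 ≤ U N ω / B := by positivity
            calc Real.exp (θ * L) ≤ Real.exp (θ * visitCount vis N ω) * 1 := by rwa [mul_one]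
              _ ≤ _ := by gcongr; linarith
          · rw [Set.indicator_of_notMem hωT]
            simp only [hΨ]
            by_cases hS' : ω ∈ S N
            · have hu := hω hS'.1 hS'.2
              rw [Set.indicator_of_mem hS']
              positivity
            · rw [Set.indicator_of_notMem hS']
  have hfin := hlow.trans (hN.trans h0)
  have h3 : Real.exp (-(c * L / (2 * B))) * Real.exp (θ * L) = 1 := by
    rw [← Real.exp_add, ← Real.exp_zero]; congr 1; rw [hθ]; ring
  calc μ.real T = Real.exp (-(c * L / (2 * B))) * (Real.exp (θ * L) * μ.real T) := by
        rw [← mul_assoc, h3, one_mul]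
    _ ≤ Real.exp (-(c * L / (2 * B))) * (2 * μ.real A) := by gcongr
    _ = _ := by ring

end

section

variable {d : ℕ} {Ω : Type*} {m : MeasurableSpace Ω} {μ : Measure Ω} [IsProbabilityMeasure μ]
  {ℱ : Filtration ℕ m} {l : EuclideanSpace ℝ (Fin d)} {K h r lam : ℝ}
  {X : ℕ → Ω → (Fin d → ℤ)}

/-! ### Local times -/

/-- The constraints on the exponent `ξ` and the offset `b` under which `(‖z‖² + b)^(1/2 - ξ)` is a
Lyapunov function for increments bounded by `K`. -/
structure LyapunovParams (K ρ ξ b : ℝ) : Prop where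
  xi_pos : 0 < ξ
  xi_le : ξ ≤ 1 / 4
  xi_small : 10 * ξ * K ^ 2 ≤ ρ
  one_le : 1 ≤ b
  large₁ : (2 * K + K ^ 2) * (1 + ξ) ≤ ξ * √b
  large₂ : 2 * (4 * K ^ 3 + K ^ 4) ≤ ρ * √b

theorem exists_lyapunovParams {K ρ : ℝ} (hK : 0 < K) (hρ : 0 < ρ) :
    ∃ ξ b, LyapunovParams K ρ ξ b := by
  set ξ := min (ρ / (10 * K ^ 2)) (1 / 4) with hξ
  have hξ0 : 0 < ξ := lt_min (by positivity) (by norm_num)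
  set M := max 1 (max ((2 * K + K ^ 2) * (1 + ξ) / ξ) (2 * (4 * K ^ 3 + K ^ 4) / ρ)) with hM
  have hM1 : 1 ≤ M := le_max_left _ _
  refine ⟨ξ, M ^ 2, hξ0, min_le_right _ _, ?_, one_le_pow₀ hM1, ?_, ?_⟩
  · have : ξ ≤ ρ / (10 * K ^ 2) := min_le_left _ _
    rw [le_div_iff₀ (by positivity)] at this
    linarith
  · rw [Real.sqrt_sq (by linarith)]
    have : (2 * K + K ^ 2) * (1 + ξ) / ξ ≤ M := (le_max_left _ _).trans (le_max_right _ _)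
    rw [div_le_iff₀ hξ0] at this
    linarith
  · rw [Real.sqrt_sq (by linarith)]
    have : 2 * (4 * K ^ 3 + K ^ 4) / ρ ≤ M := (le_max_right _ _).trans (le_max_right _ _)
    rw [div_le_iff₀ hρ] at this
    linarith

/-- The squared distance of `x` to `y`, shifted by `b`. -/
def shiftedSq (b : ℝ) (y x : Fin d → ℤ) : ℝ := ‖toVec x - toVec y‖ ^ 2 + b

theorem le_shiftedSq (b : ℝ) (y x : Fin d → ℤ) : b ≤ shiftedSq b y x := by
  unfold shiftedSq; nlinarith [sq_nonneg ‖toVec x - toVec y‖]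

theorem IsGeneralizedExcitedRandomWalk.integrable_comp
    (hX : IsGeneralizedExcitedRandomWalk μ ℱ l K h r lam X) {b γ : ℝ} (hb : 0 < b) (hγ : 0 ≤ γ)
    (y : Fin d → ℤ) (n : ℕ) : Integrable (fun ω => shiftedSq b y (X n ω) ^ γ) μ := by
  refine Integrable.of_bound (((measurable_comp hX.adapted n (fun x => shiftedSq b y x ^ γ)).mono
    (ℱ.le _) le_rfl).aestronglyMeasurable) (((K * n + ‖toVec y‖) ^ 2 + b) ^ γ) ?_
  filter_upwards [hX.ae_norm_le] with ω hω
  have h0 : 0 < shiftedSq b y (X n ω) := hb.trans_le (le_shiftedSq _ _ _)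
  rw [Real.norm_eq_abs, abs_of_nonneg (by positivity)]
  refine Real.rpow_le_rpow h0.le ?_ hγ
  unfold shiftedSq
  have := (norm_sub_le (toVec (X n ω)) (toVec y)).trans (add_le_add_left (hω n) _)
  gcongr

/-- At a revisit the drift vanishes, and ellipticity along the orthogonal direction gives a mean
squared component of at least `h r²`; taking `ρ = h r² / 2` keeps half of it. In general only the
first-order term can hurt, by at most `2 ‖z‖ K`. -/
theorem IsGeneralizedExcitedRandomWalk.condExp_lyapunov
    (hX : IsGeneralizedExcitedRandomWalk μ ℱ l K h r lam X) (hd : 2 ≤ d) (hK : 0 < K) (hr : 0 < r)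
    {ξ b : ℝ} (hp : LyapunovParams K (h * r ^ 2 / 2) ξ b) (y : Fin d → ℤ) (n : ℕ) :
    ∀ᵐ ω ∂μ,
      (Revisits X n ω → shiftedSq b y (X n ω) ^ (1 / 2 - ξ) + (1 / 2 - ξ) *
          shiftedSq b y (X n ω) ^ (1 / 2 - ξ - 1) * (h * r ^ 2 / 2)
        ≤ (μ[fun ω => shiftedSq b y (X (n + 1) ω) ^ (1 / 2 - ξ) | ℱ n]) ω) ∧
      shiftedSq b y (X n ω) ^ (1 / 2 - ξ) - (1 / 2 - ξ) * shiftedSq b y (X n ω) ^ (1 / 2 - ξ - 1) *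
          (2 * (‖toVec (X n ω) - toVec y‖ * K) + h * r ^ 2 / 2)
        ≤ (μ[fun ω => shiftedSq b y (X (n + 1) ω) ^ (1 / 2 - ξ) | ℱ n]) ω := by
  have hγ : 0 < 1 / 2 - ξ := by linarith [hp.xi_le]
  have hb : 0 < b := by linarith [hp.one_le]
  set F : Ω → ℝ := fun ω => shiftedSq b y (X (n + 1) ω) ^ (1 / 2 - ξ) with hF
  have hFint : Integrable F μ := hX.integrable_comp hb hγ.le y (n + 1)
  -- The orthogonal direction depends on the current position, while ellipticity holds almost surely
  -- for each fixed direction. Fixing the position makes the direction deterministic, and there are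
  -- only countably many positions.
  have key : ∀ x : Fin d → ℤ, ∀ᵐ ω ∂μ, X n ω = x →
      (Revisits X n ω → shiftedSq b y x ^ (1 / 2 - ξ) + (1 / 2 - ξ) *
          shiftedSq b y x ^ (1 / 2 - ξ - 1) * (h * r ^ 2 / 2) ≤ (μ[F | ℱ n]) ω) ∧
      shiftedSq b y x ^ (1 / 2 - ξ) - (1 / 2 - ξ) * shiftedSq b y x ^ (1 / 2 - ξ - 1) *
          (2 * (‖toVec x - toVec y‖ * K) + h * r ^ 2 / 2) ≤ (μ[F | ℱ n]) ω := by
    intro x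
    set z := toVec x - toVec y with hz
    obtain ⟨e, he, hze⟩ := exists_unit_orthogonal hd z
    set a := shiftedSq b y x ^ (1 / 2 - ξ) with ha
    set p := (1 / 2 - ξ) * shiftedSq b y x ^ (1 / 2 - ξ - 1) with hpdef
    have hq0 : 0 < shiftedSq b y x := hb.trans_le (le_shiftedSq _ _ _)
    have hp0 : 0 < p := by positivity
    set J : Set Ω := {ω | r < inner ℝ (jump X n ω) e} with hJ
    have hJm : MeasurableSet J := measurableSet_lt measurable_const
      ((measurable_jump hX.adapted n).inner_const)
    set f₁ : Ω → ℝ := fun ω => inner ℝ z (jump X n ω) with hf₁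
    set f₂ : Ω → ℝ := J.indicator (fun _ => (1 : ℝ)) with hf₂
    have hi₁ : Integrable f₁ μ := hX.integrable_inner z n
    have hi₂ : Integrable f₂ μ := (integrable_const 1).indicator hJm
    set G : Ω → ℝ := (fun _ => a - p * (h * r ^ 2 / 2)) + ((2 * p) • f₁ + (p * r ^ 2) • f₂) with hG
    have hGint : Integrable G μ := (integrable_const _).add ((hi₁.smul _).add (hi₂.smul _))
    have hGc : μ[G | ℱ n] =ᵐ[μ] (fun _ => a - p * (h * r ^ 2 / 2)) +
        ((2 * p) • μ[f₁ | ℱ n] + (p * r ^ 2) • μ[f₂ | ℱ n]) := by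
      have h1 := condExp_add (m := ℱ n) (integrable_const (μ := μ) (a - p * (h * r ^ 2 / 2)))
        ((hi₁.smul (2 * p)).add (hi₂.smul (p * r ^ 2)))
      have h2 := condExp_add (m := ℱ n) (hi₁.smul (2 * p)) (hi₂.smul (p * r ^ 2))
      have h3 := condExp_smul (μ := μ) (2 * p) f₁ (ℱ n)
      have h4 := condExp_smul (μ := μ) (p * r ^ 2) f₂ (ℱ n)
      rw [condExp_const (ℱ.le n)] at h1
      filter_upwards [h1, h2, h3, h4] with ω g1 g2 g3 g4
      rw [g1, Pi.add_apply, g2, Pi.add_apply, g3, g4]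
      rfl
    set s : Set Ω := {ω | X n ω = x} with hs
    have hsm : MeasurableSet[ℱ n] s := measurable_comp hX.adapted n id (MeasurableSet.singleton x)
    have hmono : s.indicator G ≤ᵐ[μ] s.indicator F := by
      filter_upwards [hX.condB] with ω hω
      by_cases hωs : ω ∈ s
      · rw [Set.indicator_of_mem hωs, Set.indicator_of_mem hωs]
        have hxω : X n ω = x := hωs
        have hinc := lyapunov_increment hp.xi_pos hp.xi_le hK hp.xi_small hp.one_le hp.large₁
          hp.large₂ z (jump X n ω) e he hze (hω n)
        have hzj : z + jump X n ω = toVec (X (n + 1) ω) - toVec y := by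
          rw [hz, jump, hxω]; abel
        rw [hzj] at hinc
        refine le_trans ?_ hinc
        show a - p * (h * r ^ 2 / 2) + (2 * p * f₁ ω + p * r ^ 2 * f₂ ω)
          ≤ a + p * (2 * f₁ ω + inner ℝ e (jump X n ω) ^ 2 - h * r ^ 2 / 2)
        have h5 : r ^ 2 * f₂ ω ≤ inner ℝ e (jump X n ω) ^ 2 := by
          simp only [hf₂, Set.indicator_apply]
          split_ifs with hωJ
          · rw [mul_one]
            have : r < inner ℝ e (jump X n ω) := by rw [real_inner_comm]; exact hωJ
            gcongr
          · rw [mul_zero]; positivity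
        have h6 := mul_le_mul_of_nonneg_left h5 hp0.le
        linarith
      · rw [Set.indicator_of_notMem hωs, Set.indicator_of_notMem hωs]
    have hcm := condExp_mono (m := ℱ n) (hGint.indicator (ℱ.le _ _ hsm))
      (hFint.indicator (ℱ.le _ _ hsm)) hmono
    have hlow := hX.condExp_inner_le (-z) n
    have hneg : μ[fun ω => inner ℝ (-z) (jump X n ω) | ℱ n] =ᵐ[μ] - μ[f₁ | ℱ n] := by
      have : (fun ω => inner ℝ (-z) (jump X n ω)) = -f₁ := by
        funext ω; simp [hf₁, inner_neg_left]
      rw [this]; exact condExp_neg _ _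
    have hP0 : 0 ≤ᵐ[μ] μ[f₂ | ℱ n] :=
      condExp_nonneg (ae_of_all _ fun ω => Set.indicator_nonneg (fun _ _ => zero_le_one) ω)
    filter_upwards [hcm, condExp_indicator hGint hsm, condExp_indicator hFint hsm, hGc, hlow, hneg,
      hP0, hX.condExp_inner_revisit z n, (hX.condE n).2 e he, (hX.condCPlus n).1]
      with ω g1 g2 g3 g4 g5 g6 g7 g8 g9 g10 hωs
    have hωs' : ω ∈ s := hωs
    rw [g2, g3, Set.indicator_of_mem hωs', Set.indicator_of_mem hωs', g4] at g1
    have g1' : a - p * (h * r ^ 2 / 2) + (2 * p * (μ[f₁ | ℱ n]) ω + p * r ^ 2 * (μ[f₂ | ℱ n]) ω)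
      ≤ (μ[F | ℱ n]) ω := g1
    constructor
    · intro hrev
      have h1 : (μ[f₁ | ℱ n]) ω = 0 := g8 hrev
      have h2 : h ≤ (μ[f₂ | ℱ n]) ω := g9 (g10 hrev)
      rw [h1] at g1'
      have h3 : p * r ^ 2 * h ≤ p * r ^ 2 * (μ[f₂ | ℱ n]) ω := by gcongr
      linarith
    · rw [g6, norm_neg, Pi.neg_apply] at g5
      have h2 : 0 ≤ (μ[f₂ | ℱ n]) ω := g7
      have h3 : 0 ≤ p * r ^ 2 * (μ[f₂ | ℱ n]) ω := by positivity
      have h4 : p * (-(μ[f₁ | ℱ n]) ω) ≤ p * (‖z‖ * K) := by gcongr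
      linarith
  filter_upwards [ae_all_iff.2 key] with ω hω
  exact hω (X n ω) rfl

theorem rpow_mul_sqrt_le {q z ξ : ℝ} (hq : 1 ≤ q) (hzq : z ^ 2 ≤ q) :
    q ^ (1 / 2 - ξ - 1) * z ≤ q ^ (-ξ) := by
  have hq0 : 0 < q := by linarith
  have : z ≤ q ^ (1 / 2 : ℝ) := by
    rw [← Real.sqrt_eq_rpow]; exact Real.le_sqrt_of_sq_le hzq
  calc q ^ (1 / 2 - ξ - 1) * z ≤ q ^ (1 / 2 - ξ - 1) * q ^ (1 / 2 : ℝ) := by gcongr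
    _ = q ^ (-ξ) := by rw [← Real.rpow_add hq0]; congr 1; ring

open Classical in
/-- The Lyapunov function gains a fixed amount at each visit of its centre, and loses at most a
small amount at each first visit. -/
theorem IsGeneralizedExcitedRandomWalk.condExp_lyapunov_gain
    (hX : IsGeneralizedExcitedRandomWalk μ ℱ l K h r lam X) (hd : 2 ≤ d) (hK : 0 < K) (hr : 0 < r)
    (hh : 0 < h) {ξ b : ℝ} (hp : LyapunovParams K (h * r ^ 2 / 2) ξ b) (y : Fin d → ℤ) (n : ℕ) :
    ∀ᵐ ω ∂μ,
      shiftedSq b y (X n ω) ^ (1 / 2 - ξ)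
          + (if X n ω = y then (1 / 2 - ξ) * b ^ (1 / 2 - ξ - 1) * (h * r ^ 2 / 2) else 0)
          - (if Revisits X n ω then 0 else (2 * K + h * r ^ 2) * shiftedSq b y (X n ω) ^ (-ξ))
        ≤ (μ[fun ω => shiftedSq b y (X (n + 1) ω) ^ (1 / 2 - ξ) | ℱ n]) ω := by
  have hγ : 0 < 1 / 2 - ξ := by linarith [hp.xi_le]
  have hb : 0 < b := by linarith [hp.one_le]
  filter_upwards [hX.condExp_lyapunov hd hK hr hp y n] with ω ⟨h1, h2⟩
  have hq1 : 1 ≤ shiftedSq b y (X n ω) := hp.one_le.trans (le_shiftedSq _ _ _)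
  have hq0 : 0 < shiftedSq b y (X n ω) := by linarith
  have hpn : 0 ≤ (1 / 2 - ξ) * shiftedSq b y (X n ω) ^ (1 / 2 - ξ - 1) * (h * r ^ 2 / 2) := by
    positivity
  have hgain : (if X n ω = y then (1 / 2 - ξ) * b ^ (1 / 2 - ξ - 1) * (h * r ^ 2 / 2) else 0)
      ≤ (1 / 2 - ξ) * shiftedSq b y (X n ω) ^ (1 / 2 - ξ - 1) * (h * r ^ 2 / 2) := by
    split_ifs with hy
    · rw [hy]; simp [shiftedSq]
    · exact hpn
  by_cases hrev : Revisits X n ω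
  · rw [if_pos hrev, sub_zero]
    exact le_trans (by linarith) (h1 hrev)
  · rw [if_neg hrev]
    refine le_trans ?_ h2
    have e1 : shiftedSq b y (X n ω) ^ (1 / 2 - ξ - 1) * ‖toVec (X n ω) - toVec y‖
        ≤ shiftedSq b y (X n ω) ^ (-ξ) :=
      rpow_mul_sqrt_le hq1 (by unfold shiftedSq; linarith)
    have e2 : shiftedSq b y (X n ω) ^ (1 / 2 - ξ - 1) * 1 ≤ shiftedSq b y (X n ω) ^ (-ξ) :=
      rpow_mul_sqrt_le hq1 (by simpa using hq1)
    have e3 : (1 / 2 - ξ) * shiftedSq b y (X n ω) ^ (1 / 2 - ξ - 1) *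
          (2 * (‖toVec (X n ω) - toVec y‖ * K) + h * r ^ 2 / 2)
          + (1 / 2 - ξ) * shiftedSq b y (X n ω) ^ (1 / 2 - ξ - 1) * (h * r ^ 2 / 2)
        ≤ (2 * K + h * r ^ 2) * shiftedSq b y (X n ω) ^ (-ξ) := by
      calc _ = (1 / 2 - ξ) * (2 * K * (shiftedSq b y (X n ω) ^ (1 / 2 - ξ - 1)
              * ‖toVec (X n ω) - toVec y‖)
            + h * r ^ 2 * (shiftedSq b y (X n ω) ^ (1 / 2 - ξ - 1) * 1)) := by ring
        _ ≤ 1 * (2 * K * shiftedSq b y (X n ω) ^ (-ξ)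
            + h * r ^ 2 * shiftedSq b y (X n ω) ^ (-ξ)) := by
            gcongr
            linarith [hp.xi_pos]
        _ = _ := by ring
    linarith

/-- The lattice points within sup-distance `R` of `y`. -/
def latticeBox (y : Fin d → ℤ) (R : ℕ) : Finset (Fin d → ℤ) :=
  Fintype.piFinset fun i => Finset.Icc (y i - R) (y i + R)

theorem card_latticeBox (y : Fin d → ℤ) (R : ℕ) : (latticeBox y R).card = (2 * R + 1) ^ d := by
  unfold latticeBox
  rw [Fintype.card_piFinset]
  have : ∀ i : Fin d, (Finset.Icc (y i - R) (y i + R)).card = 2 * R + 1 := by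
    intro i; rw [Int.card_Icc]; omega
  simp [this]

theorem mem_latticeBox_of_norm_le {y x : Fin d → ℤ} {R : ℕ} (hx : ‖toVec x - toVec y‖ ≤ R) :
    x ∈ latticeBox y R := by
  unfold latticeBox
  rw [Fintype.mem_piFinset]
  intro i
  have h1 := (PiLp.norm_apply_le (toVec x - toVec y) i).trans hx
  have h2 : (toVec x - toVec y) i = ((x i - y i : ℤ) : ℝ) := by simp [toVec]
  rw [h2, Real.norm_eq_abs, ← Int.cast_abs] at h1
  have h3 : |x i - y i| ≤ (R : ℤ) := by exact_mod_cast h1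
  rw [abs_le] at h3
  rw [Finset.mem_Icc]
  omega

open Classical in
/-- The total loss of the Lyapunov function at the first visits during `[n, n + i)`. -/
def lossSum (X : ℕ → Ω → (Fin d → ℤ)) (b ξ C : ℝ) (y : Fin d → ℤ) (n i : ℕ) (ω : Ω) : ℝ :=
  ∑ j ∈ Finset.range i, if Revisits X (n + j) ω then 0 else C * shiftedSq b y (X (n + j) ω) ^ (-ξ)

/-- First visits occur at distinct sites. Hence at most `(2 R + 1) ^ d` of them fall in the box
around `y`, each costing at most `C`; all others are farther than `R` and cost at most `C R^(-2ξ)`.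
-/
theorem lossSum_le {b ξ C : ℝ} (hb : 1 ≤ b) (hξ : 0 < ξ) (hC : 0 ≤ C) (y : Fin d → ℤ) (n i : ℕ)
    (ω : Ω) {R : ℕ} (hR : 1 ≤ R) :
    lossSum X b ξ C y n i ω
      ≤ C * ((2 * R + 1) ^ d + newCount X n i ω * ((R : ℝ) ^ 2) ^ (-ξ)) := by
  classical
  set S := (Finset.range i).filter fun j => ¬ Revisits X (n + j) ω with hS
  have hcard : newCount X n i ω = S.card := by
    unfold newCount; rw [hS]
  have hinj : Set.InjOn (fun j => X (n + j) ω) S := by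
    intro j hj k hk hjk
    simp only [hS, Finset.coe_filter, Set.mem_ofPred_eq] at hj hk
    rcases lt_trichotomy j k with h | h | h
    · exact absurd ⟨n + j, by omega, hjk⟩ hk.2
    · exact h
    · exact absurd ⟨n + k, by omega, hjk.symm⟩ hj.2
  have hq : ∀ x : Fin d → ℤ, 1 ≤ shiftedSq b y x := fun x => hb.trans (le_shiftedSq _ _ _)
  have h1 : lossSum X b ξ C y n i ω = ∑ j ∈ S, C * shiftedSq b y (X (n + j) ω) ^ (-ξ) := by
    unfold lossSum
    rw [hS, Finset.sum_filter]
    exact Finset.sum_congr rfl fun j _ => by split_ifs <;> simp_all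
  rw [h1, ← Finset.mul_sum]
  refine mul_le_mul_of_nonneg_left ?_ hC
  have hR0 : (0 : ℝ) < (R : ℝ) ^ 2 := by positivity
  rw [← Finset.sum_filter_add_sum_filter_not S fun j => X (n + j) ω ∈ latticeBox y R]
  refine add_le_add ?_ ?_
  · calc _ ≤ ∑ j ∈ S.filter (fun j => X (n + j) ω ∈ latticeBox y R), (1 : ℝ) := by
          refine Finset.sum_le_sum fun j _ => ?_
          exact Real.rpow_le_one_of_one_le_of_nonpos (hq _) (by linarith)
      _ = ((S.filter fun j => X (n + j) ω ∈ latticeBox y R).card : ℝ) := by simp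
      _ ≤ ((latticeBox y R).card : ℝ) := by
          have := Finset.card_le_card_of_injOn (s := S.filter fun j => X (n + j) ω ∈ latticeBox y R)
            (t := latticeBox y R) (fun j => X (n + j) ω)
            (fun j hj => (Finset.mem_filter.1 hj).2)
            (hinj.mono (by intro j hj; exact (Finset.mem_filter.1 hj).1))
          exact_mod_cast this
      _ = _ := by rw [card_latticeBox]; push_cast; ring
  · calc _ ≤ ∑ j ∈ S.filter (fun j => ¬ X (n + j) ω ∈ latticeBox y R), ((R : ℝ) ^ 2) ^ (-ξ) := by
          refine Finset.sum_le_sum fun j hj => ?_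
          have h2 : (R : ℝ) < ‖toVec (X (n + j) ω) - toVec y‖ := by
            by_contra hle
            exact (Finset.mem_filter.1 hj).2 (mem_latticeBox_of_norm_le (not_lt.1 hle))
          refine Real.rpow_le_rpow_of_nonpos hR0 ?_ (by linarith)
          unfold shiftedSq
          have : (R : ℝ) ^ 2 ≤ ‖toVec (X (n + j) ω) - toVec y‖ ^ 2 := by gcongr
          linarith
      _ ≤ _ := by
          rw [Finset.sum_const, nsmul_eq_mul, hcard]
          have := Finset.card_filter_le S fun j => ¬ X (n + j) ω ∈ latticeBox y R
          gcongr

theorem lossSum_nonneg {b ξ C : ℝ} (hb : 1 ≤ b) (hC : 0 ≤ C) (y : Fin d → ℤ) (n i : ℕ)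
    (ω : Ω) : 0 ≤ lossSum X b ξ C y n i ω := by
  refine Finset.sum_nonneg fun j _ => ?_
  have hq : 0 < shiftedSq b y (X (n + j) ω) := by linarith [le_shiftedSq b y (X (n + j) ω)]
  split_ifs
  · exact le_rfl
  · positivity

/-- As long as the walk stays near `y` and has made few first visits, the local time at `y` has an
exponential tail. -/
theorem IsGeneralizedExcitedRandomWalk.measure_localTime_ge_le
    (hX : IsGeneralizedExcitedRandomWalk μ ℱ l K h r lam X) (hd : 2 ≤ d) (hK : 0 < K) (hr : 0 < r)
    (hh : 0 < h) {ξ b : ℝ} (hp : LyapunovParams K (h * r ^ 2 / 2) ξ b) (y : Fin d → ℤ) {n : ℕ}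
    {A : Set Ω} (hA : MeasurableSet[ℱ n] A) {D M B : ℝ} {R : ℕ} (hR : 1 ≤ R) (hD : 0 ≤ D)
    (hAD : ∀ ω ∈ A, ‖toVec (X n ω) - toVec y‖ ≤ D) (hM : 0 ≤ M)
    (hB : ((D + K) ^ 2 + b) ^ (1 / 2 - ξ)
      + (2 * K + h * r ^ 2) * ((2 * R + 1) ^ d + (M + 1) * ((R : ℝ) ^ 2) ^ (-ξ)) ≤ B)
    (N : ℕ) (L : ℝ) :
    μ.real (A ∩ {ω | (∀ j < N, ‖toVec (X (n + j) ω) - toVec y‖ ≤ D ∧ newCount X n j ω ≤ M) ∧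
        L ≤ visitCount (fun j => {ω | X (n + j) ω = y}) N ω})
      ≤ 2 * Real.exp (-((1 / 2 - ξ) * b ^ (1 / 2 - ξ - 1) * (h * r ^ 2 / 2) * L / (2 * B)))
        * μ.real A := by
  classical
  have hγ : 0 < 1 / 2 - ξ := by linarith [hp.xi_le]
  have hb : 0 < b := by linarith [hp.one_le]
  have hC : 0 ≤ 2 * K + h * r ^ 2 := by positivity
  set C := 2 * K + h * r ^ 2 with hCdef
  set F : ℕ → Ω → ℝ := fun i ω => shiftedSq b y (X (n + i) ω) ^ (1 / 2 - ξ) with hF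
  have hF0 : ∀ i ω, 0 ≤ F i ω := fun i ω => by
    have : 0 < shiftedSq b y (X (n + i) ω) := hb.trans_le (le_shiftedSq _ _ _)
    positivity
  have hFint : ∀ i, Integrable (F i) μ := fun i => hX.integrable_comp hb hγ.le y (n + i)
  set Λ : ℕ → Ω → ℝ := fun i => lossSum X b ξ C y n i with hΛ
  have hΛm : ∀ i p, n + i ≤ p + 1 → Measurable[ℱ p] (Λ i) := by
    intro i p hip
    refine DeterminedBy.measurable (X := X) (fun ω ω' hj => ?_) hX.adapted
    refine Finset.sum_congr rfl fun j hji => ?_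
    rw [Finset.mem_range] at hji
    rw [revisits_congr fun k hk => hj k (by omega), hj (n + j) (by omega)]
  have hq1 : ∀ x : Fin d → ℤ, 1 ≤ shiftedSq b y x := fun x => hp.one_le.trans (le_shiftedSq _ _ _)
  have hΛ0 : ∀ i ω, 0 ≤ Λ i ω := fun i ω => lossSum_nonneg hp.one_le hC y n i ω
  have hΛint : ∀ i, Integrable (Λ i) μ := by
    intro i
    refine Integrable.of_bound (((hΛm i (n + i) (by omega)).mono (ℱ.le _) le_rfl).aestronglyMeasurable)
      (∑ j ∈ Finset.range i, C) (ae_of_all _ fun ω => ?_)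
    rw [Real.norm_eq_abs, abs_of_nonneg (hΛ0 i ω)]
    refine Finset.sum_le_sum fun j _ => ?_
    split_ifs
    · exact hC
    · have := Real.rpow_le_one_of_one_le_of_nonpos (hq1 (X (n + j) ω)) (neg_nonpos.2 hp.xi_pos.le)
      calc C * _ ≤ C * 1 := by gcongr
        _ = C := mul_one _
  have hDb : (0 : ℝ) ≤ ((D + K) ^ 2 + b) ^ (1 / 2 - ξ) := by positivity
  have hDb' : (0 : ℝ) < ((D + K) ^ 2 + b) ^ (1 / 2 - ξ) := by positivity
  have hB0 : 0 < B := by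
    refine lt_of_lt_of_le ?_ hB
    have : (0 : ℝ) ≤ C * ((2 * R + 1) ^ d + (M + 1) * ((R : ℝ) ^ 2) ^ (-ξ)) := by positivity
    linarith
  have hc : 0 < (1 / 2 - ξ) * b ^ (1 / 2 - ξ - 1) * (h * r ^ 2 / 2) := by positivity
  -- Adding the accumulated losses `Λ` to `F` leaves a process with nonnegative drift and a fixed
  -- gain at each visit to `y`. The increment of `Λ` at step `i` is already known at time `n + i`.
  -- The constraints in `act` are assumed only for earlier times, so the current state may overshoot
  -- by one step; this explains `D + K` and `M + 1` in `B`.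
  refine measure_visitCount_ge_le hA (U := fun i ω => B - Λ i ω - F i ω)
    (act := fun j => {ω | ‖toVec (X (n + j) ω) - toVec y‖ ≤ D ∧ (newCount X n j ω : ℝ) ≤ M})
    hB0 hc (fun i => ((integrable_const B).sub (hΛint i)).sub (hFint i)) (fun i => ?_) (fun i => ?_)
    (fun i => ?_) (fun i ω => ?_) (fun i => ?_) N L
  · refine measurableSet_of_determined hX.adapted fun ω ω' hj hω => ?_
    rwa [← hj (n + i) le_rfl, ← newCount_congr (p := n + i) (by omega) hj]
  · exact measurable_comp hX.adapted (n + i) id (MeasurableSet.singleton y)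
  · filter_upwards [hX.condB] with ω hω hωA hact
    have hloc : ‖toVec (X (n + i) ω) - toVec y‖ ≤ D + K ∧ (newCount X n i ω : ℝ) ≤ M + 1 := by
      cases i with
      | zero =>
        rw [newCount_zero]
        exact ⟨(hAD ω hωA).trans (by linarith), by push_cast; linarith⟩
      | succ j =>
        obtain ⟨h1, h2⟩ := hact j (Nat.lt_succ_self j)
        constructor
        · have : toVec (X (n + (j + 1)) ω) - toVec y
              = (toVec (X (n + j) ω) - toVec y) + jump X (n + j) ω := by
            rw [jump, ← add_assoc]; abel
          rw [this]
          exact (norm_add_le _ _).trans (add_le_add h1 (hω _))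
        · rw [newCount_succ]
          split_ifs <;> push_cast <;> linarith
    have h1 := lossSum_le (X := X) hp.one_le hp.xi_pos hC y n i ω hR
    have h2 : F i ω ≤ ((D + K) ^ 2 + b) ^ (1 / 2 - ξ) := by
      refine Real.rpow_le_rpow (by linarith [hq1 (X (n + i) ω)]) ?_ hγ.le
      unfold shiftedSq
      gcongr
      exact hloc.1
    have h3 : C * ((2 * R + 1) ^ d + newCount X n i ω * ((R : ℝ) ^ 2) ^ (-ξ))
        ≤ C * ((2 * R + 1) ^ d + (M + 1) * ((R : ℝ) ^ 2) ^ (-ξ)) := by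
      gcongr
      exact hloc.2
    show 0 ≤ B - Λ i ω - F i ω
    have h4 : Λ i ω ≤ C * ((2 * R + 1) ^ d + (M + 1) * ((R : ℝ) ^ 2) ^ (-ξ)) := h1.trans h3
    linarith
  · have := hΛ0 i ω
    have := hF0 i ω
    show B - Λ i ω - F i ω ≤ B
    linarith
  · have hsm : StronglyMeasurable[ℱ (n + i)] (fun ω => B - Λ (i + 1) ω) :=
      (measurable_const.sub (hΛm (i + 1) (n + i) (by omega))).stronglyMeasurable
    have hce := condExp_sub (m := ℱ (n + i)) ((integrable_const B).sub (hΛint (i + 1)))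
      (hFint (i + 1))
    have hce' := condExp_of_stronglyMeasurable (μ := μ) (ℱ.le (n + i)) hsm
      ((integrable_const B).sub (hΛint (i + 1)))
    filter_upwards [hX.condExp_lyapunov_gain hd hK hr hh hp y (n + i), hce] with ω g1 g2 _ _
    have g3 : (μ[fun ω => B - Λ (i + 1) ω - F (i + 1) ω | ℱ (n + i)]) ω
        = (B - Λ (i + 1) ω) - (μ[F (i + 1) | ℱ (n + i)]) ω := by
      refine g2.trans ?_
      rw [Pi.sub_apply]
      congr 1
      exact congrFun hce' ω
    rw [g3]
    have g4 : Λ (i + 1) ω = Λ i ω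
        + if Revisits X (n + i) ω then 0 else C * shiftedSq b y (X (n + i) ω) ^ (-ξ) :=
      Finset.sum_range_succ _ _
    rw [g4, Set.indicator_apply]
    have g5 : (μ[F (i + 1) | ℱ (n + i)]) ω
      = (μ[fun ω => shiftedSq b y (X (n + i + 1) ω) ^ (1 / 2 - ξ) | ℱ (n + i)]) ω := rfl
    rw [g5]
    simp only [Set.mem_ofPred_eq]
    have g6 : F i ω = shiftedSq b y (X (n + i) ω) ^ (1 / 2 - ξ) := rfl
    linarith

end

section

variable {d : ℕ} {Ω : Type*} {m : MeasurableSpace Ω} {μ : Measure Ω} [IsProbabilityMeasure μ]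
  {ℱ : Filtration ℕ m} {l : EuclideanSpace ℝ (Fin d)} {K h r lam : ℝ}
  {X : ℕ → Ω → (Fin d → ℤ)}

/-! ### Falling below a level -/

/-- The position at time `n` projected to direction `l`. -/
def height (l : EuclideanSpace ℝ (Fin d)) (X : ℕ → Ω → (Fin d → ℤ)) (n : ℕ) (ω : Ω) : ℝ :=
  inner ℝ (toVec (X n ω)) l

theorem height_add (n i : ℕ) (ω : Ω) :
    height l X (n + i) ω = height l X n ω + inner ℝ l (disp X n i ω) := by
  unfold height disp
  rw [inner_sub_right, real_inner_comm, real_inner_comm l]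
  ring

theorem measurable_height (hX : Adapted ℱ X) (n : ℕ) : Measurable[ℱ n] (height l X n) :=
  measurable_comp hX n fun x => inner ℝ (toVec x) l

theorem IsGeneralizedExcitedRandomWalk.ae_height_sub_le
    (hX : IsGeneralizedExcitedRandomWalk μ ℱ l K h r lam X) (hl : ‖l‖ = 1) :
    ∀ᵐ ω ∂μ, ∀ n i, |height l X (n + i) ω - height l X n ω| ≤ K * i := by
  filter_upwards [hX.ae_norm_disp_le] with ω hω n i
  rw [height_add, add_sub_cancel_left]
  refine (abs_real_inner_le_norm _ _).trans ?_
  rw [hl, one_mul]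
  exact hω n i

open Classical in
/-- The number of sites of height at least `a` visited before time `n`. -/
def priorCount (l : EuclideanSpace ℝ (Fin d)) (X : ℕ → Ω → (Fin d → ℤ)) (a : ℝ) (n : ℕ)
    (ω : Ω) : ℕ :=
  (((Finset.range n).image fun j => X j ω).filter fun x => a ≤ inner ℝ (toVec x) l).card

theorem measure_iUnion_le_mul {ι : Type*} [Countable ι] {S T : ι → Set Ω}
    (hS : ∀ i, MeasurableSet (S i)) (hdisj : Pairwise (Function.onFun Disjoint S)) {c : ENNReal}
    (h : ∀ i, μ (T i) ≤ c * μ (S i)) : μ (⋃ i, T i) ≤ c * μ (⋃ i, S i) := by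
  rw [measure_iUnion hdisj hS, ← ENNReal.tsum_mul_left]
  exact (measure_iUnion_le T).trans (ENNReal.tsum_le_tsum h)

theorem measureReal_iUnion_le_mul {ι : Type*} [Countable ι] {S T : ι → Set Ω}
    (hS : ∀ i, MeasurableSet (S i)) (hdisj : Pairwise (Function.onFun Disjoint S)) {c : ℝ}
    (hc : 0 ≤ c) (h : ∀ i, μ.real (T i) ≤ c * μ.real (S i)) :
    μ.real (⋃ i, T i) ≤ c * μ.real (⋃ i, S i) := by
  have hconv : ∀ U V : Set Ω, μ.real U ≤ c * μ.real V ↔ μ U ≤ ENNReal.ofReal c * μ V := by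
    intro U V
    rw [← ofReal_measureReal (μ := μ) (s := U), ← ofReal_measureReal (μ := μ) (s := V),
      ← ENNReal.ofReal_mul hc, ENNReal.ofReal_le_ofReal_iff (by positivity)]
  rw [hconv]
  exact measure_iUnion_le_mul hS hdisj fun i => (hconv _ _).1 (h i)

theorem norm_le_sum_abs (x : EuclideanSpace ℝ (Fin d)) : ‖x‖ ≤ ∑ i, |x i| := by
  rw [EuclideanSpace.norm_eq]
  apply Real.sqrt_le_iff.2
  refine ⟨Finset.sum_nonneg fun i _ => abs_nonneg _, ?_⟩
  simp only [Real.norm_eq_abs]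
  exact Finset.sum_sq_le_sq_sum_of_nonneg fun i _ => abs_nonneg _

theorem norm_sub_le_of_mem_latticeBox {x y : Fin d → ℤ} {R : ℕ} (hy : y ∈ latticeBox x R) :
    ‖toVec x - toVec y‖ ≤ d * R := by
  refine (norm_le_sum_abs _).trans ?_
  have : ∀ i : Fin d, |(toVec x - toVec y) i| ≤ R := by
    intro i
    have h1 := Finset.mem_Icc.1 (Fintype.mem_piFinset.1 hy i)
    have h2 : (toVec x - toVec y) i = ((x i - y i : ℤ) : ℝ) := by simp [toVec]
    rw [h2, ← Int.cast_abs]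
    have : |x i - y i| ≤ (R : ℤ) := by rw [abs_le]; omega
    calc ((|x i - y i| : ℤ) : ℝ) ≤ ((R : ℤ) : ℝ) := Int.cast_le.2 this
      _ = R := by simp
  calc ∑ i, |(toVec x - toVec y) i| ≤ ∑ _i : Fin d, (R : ℝ) := Finset.sum_le_sum fun i _ => this i
    _ = d * R := by simp

/-- If few sites are available and each is visited few times, then little time has elapsed. -/
theorem time_lt_of_visits_lt {t n : ℕ} {a L M b₀ : ℝ} {ω : Ω} (ht : 0 < t)
    (hL : ∀ y, (∃ j < t, X (n + j) ω = y) →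
      (visitCount (fun j => {ω | X (n + j) ω = y}) t ω : ℝ) < L)
    (hstay : ∀ j < t, a ≤ height l X (n + j) ω)
    (hM : (newCount X n t ω : ℝ) ≤ M) (hb : (priorCount l X a n ω : ℝ) ≤ b₀) :
    (t : ℝ) < (M + b₀) * L := by
  classical
  set S : Finset (Fin d → ℤ) := (Finset.range t).image fun j => X (n + j) ω with hS
  have hcardS : S.card ≤ newCount X n t ω + priorCount l X a n ω := by
    have hsub : S ⊆ (((Finset.range t).filter fun j => ¬ Revisits X (n + j) ω).image
        fun j => X (n + j) ω) ∪ (((Finset.range n).image fun j => X j ω).filter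
          fun x => a ≤ inner ℝ (toVec x) l) := by
      intro y hy
      obtain ⟨j₀, hj₀, rfl⟩ := Finset.mem_image.1 hy
      rw [Finset.mem_range] at hj₀
      have hex : ∃ j, X (n + j) ω = X (n + j₀) ω := ⟨j₀, rfl⟩
      -- The first passage at this site within the window is either a first visit or a return to a
      -- site seen before time `n`; in the second case the site has height at least `a` and is
      -- counted by `priorCount`.
      set j₁ := Nat.find hex with hj₁
      have h1 : X (n + j₁) ω = X (n + j₀) ω := Nat.find_spec hex
      have h2 : j₁ ≤ j₀ := Nat.find_min' hex rfl
      rw [Finset.mem_union]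
      by_cases hrev : Revisits X (n + j₁) ω
      · right
        obtain ⟨k, hk, e⟩ := hrev
        have hkn : k < n := by
          by_contra hkn
          have h3 := Nat.find_min hex (m := k - n) (by omega)
          apply h3
          rw [Nat.add_sub_cancel' (by omega), e, h1]
        rw [Finset.mem_filter, Finset.mem_image]
        refine ⟨⟨k, Finset.mem_range.2 hkn, by rw [e, h1]⟩, ?_⟩
        exact hstay j₀ hj₀
      · left
        exact Finset.mem_image.2 ⟨j₁, Finset.mem_filter.2 ⟨Finset.mem_range.2 (by omega), hrev⟩, h1⟩
    refine (Finset.card_le_card hsub).trans ((Finset.card_union_le _ _).trans ?_)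
    refine add_le_add ?_ ?_
    · refine Finset.card_image_le.trans (le_of_eq ?_)
      unfold newCount
      congr
    · exact le_of_eq (by unfold priorCount; congr)
  have hsum : t = ∑ y ∈ S, visitCount (fun j => {ω | X (n + j) ω = y}) t ω := by
    have := Finset.card_eq_sum_card_image (fun j => X (n + j) ω) (Finset.range t)
    rw [Finset.card_range] at this
    conv_lhs => rw [this]
    refine Finset.sum_congr rfl fun y _ => ?_
    unfold visitCount
    congr
  have hne : S.Nonempty := ⟨X (n + 0) ω, Finset.mem_image.2 ⟨0, Finset.mem_range.2 ht, rfl⟩⟩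
  have hLpos : 0 ≤ L := by
    have := hL (X (n + 0) ω) ⟨0, ht, rfl⟩
    exact le_trans (Nat.cast_nonneg _) this.le
  calc (t : ℝ) = ∑ y ∈ S, (visitCount (fun j => {ω | X (n + j) ω = y}) t ω : ℝ) := by
        exact_mod_cast hsum
    _ < ∑ _y ∈ S, L := by
        refine Finset.sum_lt_sum_of_nonempty hne fun y hy => hL y ?_
        obtain ⟨j, hj, e⟩ := Finset.mem_image.1 hy
        exact ⟨j, Finset.mem_range.1 hj, e⟩
    _ = S.card * L := by rw [Finset.sum_const, nsmul_eq_mul]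
    _ ≤ (M + b₀) * L := by
        have : (S.card : ℝ) ≤ newCount X n t ω + priorCount l X a n ω := by exact_mod_cast hcardS
        gcongr
        linarith

/-- With `M` first visits the accumulated drift is at least `lam * M`, so ending `s` lower than the
start takes a downward fluctuation of `s + lam * M`. -/
theorem IsGeneralizedExcitedRandomWalk.measure_newCount_gt_le
    (hX : IsGeneralizedExcitedRandomWalk μ ℱ l K h r lam X) (hK : 0 < K) (hl : ‖l‖ = 1)
    (hlam : 0 < lam) {θ : ℝ} (hθ : 0 ≤ θ) (hθK : θ * K ≤ 1) {n : ℕ} {A : Set Ω}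
    (hA : MeasurableSet[ℱ n] A) (t : ℕ) (M s : ℝ) :
    μ.real (A ∩ {ω | height l X (n + t) ω ≤ height l X n ω - s ∧ M ≤ newCount X n t ω})
      ≤ Real.exp (-(θ * (s + lam * M)) + θ ^ 2 * K ^ 2 * t) * μ.real A := by
  have h1 := hX.measure_disp_ge_le hK (g := -l) (by rwa [norm_neg]) (κ := -lam) (fun n => by
      have hneg : μ[fun ω => inner ℝ (-l) (jump X n ω) | ℱ n]
          =ᵐ[μ] - μ[fun ω => inner ℝ l (jump X n ω) | ℱ n] := by
        have : (fun ω => inner ℝ (-l) (jump X n ω)) = -(fun ω => inner ℝ l (jump X n ω)) := by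
          funext ω; simp [inner_neg_left]
        rw [this]; exact condExp_neg _ _
      filter_upwards [hX.condExp_inner_new n, hneg] with ω g1 g2 hnew
      rw [g2, Pi.neg_apply]
      linarith [g1 hnew]) hθ hθK hA t (s + lam * M)
  refine le_trans (measureReal_mono ?_ (measure_ne_top _ _)) h1
  rintro ω ⟨hωA, h2, h3⟩
  refine ⟨hωA, ?_⟩
  show s + lam * M ≤ inner ℝ (-l) (disp X n t ω) - -lam * newCount X n t ω
  rw [height_add] at h2
  rw [inner_neg_left]
  have := mul_le_mul_of_nonneg_left h3 hlam.le
  linarith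

/-- At most `M` first visits move the walk by drift at most `K * M` in any direction. The rest is
fluctuation, controlled in the `2 d` signed coordinate directions at each time; the factor `d` comes
from bounding the norm by the sum of the coordinates. -/
theorem IsGeneralizedExcitedRandomWalk.measure_disp_gt_le
    (hX : IsGeneralizedExcitedRandomWalk μ ℱ l K h r lam X) (hK : 0 < K)
    {θ : ℝ} (hθ : 0 ≤ θ) (hθK : θ * K ≤ 1) {n : ℕ} {A : Set Ω}
    (hA : MeasurableSet[ℱ n] A) (t : ℕ) (s M : ℝ) :
    μ.real (A ∩ {ω | ∃ i < t, newCount X n i ω ≤ M ∧ d * (s + K * M) < ‖disp X n i ω‖})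
      ≤ 2 * d * t * Real.exp (-(θ * s) + θ ^ 2 * K ^ 2 * t) * μ.real A := by
  set E : ℕ → EuclideanSpace ℝ (Fin d) → Set Ω := fun i g =>
    A ∩ {ω | s ≤ inner ℝ g (disp X n i ω) - K * newCount X n i ω} with hE
  have hEle : ∀ i < t, ∀ g, ‖g‖ = 1 →
      μ.real (E i g) ≤ Real.exp (-(θ * s) + θ ^ 2 * K ^ 2 * t) * μ.real A := by
    intro i hi g hg
    have h1 := hX.measure_disp_ge_le hK hg (κ := K) (fun n => by
      filter_upwards [hX.condExp_inner_le g n] with ω hω _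
      rwa [hg, one_mul] at hω) hθ hθK hA i s
    refine h1.trans ?_
    have : (i : ℝ) ≤ t := by exact_mod_cast hi.le
    gcongr
  set e : Fin d → EuclideanSpace ℝ (Fin d) := fun j => EuclideanSpace.single j (1 : ℝ) with he
  have hsub : A ∩ {ω | ∃ i < t, newCount X n i ω ≤ M ∧ d * (s + K * M) < ‖disp X n i ω‖}
      ⊆ ⋃ i ∈ Finset.range t, ⋃ j ∈ (Finset.univ : Finset (Fin d)), (E i (e j) ∪ E i (-e j)) := by
    rintro ω ⟨hωA, i, hi, hM, hD⟩
    by_contra hnot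
    simp only [Set.mem_iUnion, Finset.mem_range, Finset.mem_univ, exists_prop, true_and,
      not_exists, not_and, Set.mem_union, not_or] at hnot
    have hcoord : ∀ j : Fin d, |disp X n i ω j| ≤ s + K * M := by
      intro j
      obtain ⟨h1, h2⟩ := hnot i hi j
      have h1' : ¬ (s ≤ inner ℝ (e j) (disp X n i ω) - K * newCount X n i ω) :=
        fun hc => h1 ⟨hωA, hc⟩
      have h2' : ¬ (s ≤ inner ℝ (-e j) (disp X n i ω) - K * newCount X n i ω) :=
        fun hc => h2 ⟨hωA, hc⟩
      have h3 : inner ℝ (e j) (disp X n i ω) = disp X n i ω j := by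
        simp [he, EuclideanSpace.inner_single_left]
      rw [inner_neg_left] at h2'
      rw [h3] at h1' h2'
      have h4 := mul_le_mul_of_nonneg_left hM hK.le
      rw [abs_le]
      constructor <;> linarith
    have := norm_le_sum_abs (disp X n i ω)
    have h5 : ∑ j, |disp X n i ω j| ≤ ∑ _j : Fin d, (s + K * M) :=
      Finset.sum_le_sum fun j _ => hcoord j
    rw [Finset.sum_const, Finset.card_univ, Fintype.card_fin, nsmul_eq_mul] at h5
    linarith
  have hnorm : ∀ j, ‖e j‖ = 1 := fun j => by simp [he]
  set c := Real.exp (-(θ * s) + θ ^ 2 * K ^ 2 * t) * μ.real A with hc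
  calc _ ≤ μ.real (⋃ i ∈ Finset.range t, ⋃ j ∈ (Finset.univ : Finset (Fin d)),
        (E i (e j) ∪ E i (-e j))) := measureReal_mono hsub (measure_ne_top _ _)
    _ ≤ ∑ i ∈ Finset.range t, μ.real (⋃ j ∈ (Finset.univ : Finset (Fin d)),
        (E i (e j) ∪ E i (-e j))) := measureReal_biUnion_finset_le _ _
    _ ≤ ∑ i ∈ Finset.range t, ∑ _j : Fin d, (c + c) := by
        refine Finset.sum_le_sum fun i hi => (measureReal_biUnion_finset_le _ _).trans ?_
        refine Finset.sum_le_sum fun j _ => (measureReal_union_le _ _).trans ?_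
        exact add_le_add (hEle i (Finset.mem_range.1 hi) _ (hnorm j))
          (hEle i (Finset.mem_range.1 hi) _ (by rw [norm_neg]; exact hnorm j))
    _ = _ := by
        simp only [Finset.sum_const, Finset.card_univ, Fintype.card_fin, Finset.card_range,
          nsmul_eq_mul]
        ring

/-- Explicit bound on the probability that the walk first falls below level `a` after exactly `t`
steps, when few sites above level `a` were visited before. -/
theorem IsGeneralizedExcitedRandomWalk.measure_fall_le
    (hX : IsGeneralizedExcitedRandomWalk μ ℱ l K h r lam X) (hd : 2 ≤ d) (hK : 0 < K) (hr : 0 < r)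
    (hh : 0 < h) (hlam : 0 < lam) (hl : ‖l‖ = 1) {ξ b : ℝ}
    (hp : LyapunovParams K (h * r ^ 2 / 2) ξ b) {n : ℕ} {A : Set Ω} (hA : MeasurableSet[ℱ n] A)
    {a b₀ M s B L θ : ℝ} {R D₀ t : ℕ} (ht : 0 < t) (hR : 1 ≤ R) (hM : 0 ≤ M)
    (hθ : 0 ≤ θ) (hθK : θ * K ≤ 1) (hD₀ : d * (s + K * M) ≤ D₀)
    (hAa : ∀ ω ∈ A, a ≤ height l X n ω) (hAb : ∀ ω ∈ A, (priorCount l X a n ω : ℝ) ≤ b₀)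
    (hB : ((2 * d * D₀ + K) ^ 2 + b) ^ (1 / 2 - ξ)
      + (2 * K + h * r ^ 2) * ((2 * R + 1) ^ d + (M + 1) * ((R : ℝ) ^ 2) ^ (-ξ)) ≤ B)
    (hL : (M + b₀) * L ≤ t) :
    μ.real (A ∩ {ω | (∀ j < t, a ≤ height l X (n + j) ω) ∧ height l X (n + t) ω < a})
      ≤ (Real.exp (-(θ * (lam * M)) + θ ^ 2 * K ^ 2 * t)
        + 2 * d * t * Real.exp (-(θ * s) + θ ^ 2 * K ^ 2 * t)
        + (2 * D₀ + 1) ^ d * (2 * Real.exp (-((1 / 2 - ξ) * b ^ (1 / 2 - ξ - 1)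
            * (h * r ^ 2 / 2) * L / (2 * B))))) * μ.real A := by
  set T : Set Ω := {ω | (∀ j < t, a ≤ height l X (n + j) ω) ∧ height l X (n + t) ω < a} with hT
  set c₁ := Real.exp (-(θ * (lam * M)) + θ ^ 2 * K ^ 2 * t) with hc₁
  set c₂ := 2 * d * t * Real.exp (-(θ * s) + θ ^ 2 * K ^ 2 * t) with hc₂
  set c₃ := 2 * Real.exp (-((1 / 2 - ξ) * b ^ (1 / 2 - ξ - 1) * (h * r ^ 2 / 2) * L / (2 * B)))
    with hc₃
  have hunion : ∀ S : Set Ω, S = ⋃ x, S ∩ {ω | X n ω = x} := by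
    intro S; ext ω; simp
  have hxm : ∀ x, MeasurableSet[ℱ n] {ω | X n ω = x} := fun x =>
    measurable_comp hX.adapted n id (MeasurableSet.singleton x)
  have hc : 0 ≤ c₁ + c₂ + (2 * D₀ + 1) ^ d * c₃ := by positivity
  -- Splitting by the starting position makes the box of sites that can be visited deterministic, so
  -- that the local time bound can be summed over it.
  rw [hunion (A ∩ T)]
  conv_rhs => rw [hunion A]
  refine measureReal_iUnion_le_mul (fun x => (ℱ.le n _ hA).inter (ℱ.le n _ (hxm x))) ?_ hc ?_
  · intro x y hxy
    refine Set.disjoint_left.2 ?_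
    rintro ω ⟨_, h1⟩ ⟨_, h2⟩
    exact hxy (h1.symm.trans h2)
  intro x
  set A' := A ∩ {ω | X n ω = x} with hA'
  have hA'm : MeasurableSet[ℱ n] A' := hA.inter (hxm x)
  have b1 := hX.measure_newCount_gt_le hK hl hlam hθ hθK hA'm t M 0
  have b2 := hX.measure_disp_gt_le hK hθ hθK hA'm t s M
  have b3 : ∀ y ∈ latticeBox x D₀, _ := fun y hy =>
    hX.measure_localTime_ge_le hd hK hr hh hp y hA'm (D := 2 * d * D₀) (M := M) (B := B) hR
      (by positivity) (by
        rintro ω ⟨_, hω⟩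
        have hω' : X n ω = x := hω
        rw [hω']
        refine (norm_sub_le_of_mem_latticeBox hy).trans ?_
        have : (0 : ℝ) ≤ d * D₀ := by positivity
        linarith) hM hB t L
  rw [zero_add] at b1
  set E₁ := A' ∩ {ω | height l X (n + t) ω ≤ height l X n ω - 0 ∧ M ≤ newCount X n t ω}
  set E₂ := A' ∩ {ω | ∃ i < t, (newCount X n i ω : ℝ) ≤ M ∧ d * (s + K * M) < ‖disp X n i ω‖}
  set E₃ : (Fin d → ℤ) → Set Ω := fun y => A' ∩ {ω | (∀ j < t, ‖toVec (X (n + j) ω) - toVec y‖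
    ≤ 2 * d * D₀ ∧ (newCount X n j ω : ℝ) ≤ M) ∧
        L ≤ visitCount (fun j => {ω | X (n + j) ω = y}) t ω} with hE₃
  -- Outside these events there are fewer than `M` first visits, the walk stays within `D₀`, and
  -- every site is visited fewer than `L` times. Then `time_lt_of_visits_lt` gives `t < (M + b₀) *
  -- L`, against `hL`.
  have hsub : A ∩ T ∩ {ω | X n ω = x} ⊆ E₁ ∪ E₂ ∪ ⋃ y ∈ latticeBox x D₀, E₃ y := by
    rintro ω ⟨⟨hωA, hstay, hfall⟩, hωx⟩
    by_contra hnot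
    simp only [Set.mem_union, not_or, Set.mem_iUnion, exists_prop, not_exists, not_and] at hnot
    obtain ⟨⟨n1, n2⟩, n3⟩ := hnot
    have hωA' : ω ∈ A' := ⟨hωA, hωx⟩
    have hωx' : X n ω = x := hωx
    have f1 : (newCount X n t ω : ℝ) < M := by
      by_contra hge
      exact n1 ⟨hωA', by linarith [hAa ω hωA], not_lt.1 hge⟩
    have f1' : ∀ i < t, (newCount X n i ω : ℝ) ≤ M := by
      intro i hi
      have : newCount X n i ω ≤ newCount X n t ω := newCount_mono n ω hi.le
      have : (newCount X n i ω : ℝ) ≤ newCount X n t ω := by exact_mod_cast this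
      linarith
    have f2 : ∀ i < t, ‖disp X n i ω‖ ≤ D₀ := by
      intro i hi
      by_contra hgt
      exact n2 ⟨hωA', i, hi, f1' i hi, hD₀.trans_lt (not_le.1 hgt)⟩
    have f2' : ∀ i < t, X (n + i) ω ∈ latticeBox x D₀ := fun i hi =>
      mem_latticeBox_of_norm_le (by rw [← hωx']; exact f2 i hi)
    have f3 : ∀ y, (∃ j < t, X (n + j) ω = y) →
        (visitCount (fun j => {ω | X (n + j) ω = y}) t ω : ℝ) < L := by
      rintro y ⟨j, hj, rfl⟩
      by_contra hge
      refine n3 _ (f2' j hj) ⟨hωA', ⟨fun i hi => ⟨?_, f1' i hi⟩, not_lt.1 hge⟩⟩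
      have e1 : toVec (X (n + i) ω) - toVec (X (n + j) ω) = disp X n i ω - disp X n j ω := by
        simp only [disp]; abel
      rw [e1]
      refine (norm_sub_le _ _).trans ?_
      have hd2 : (2 : ℝ) ≤ d := by exact_mod_cast hd
      have hD0 : (0 : ℝ) ≤ D₀ := by positivity
      have := mul_le_mul_of_nonneg_right hd2 hD0
      linarith [f2 i hi, f2 j hj]
    have := time_lt_of_visits_lt ht f3 hstay f1.le (hAb ω hωA)
    linarith
  calc μ.real (A ∩ T ∩ {ω | X n ω = x})
      ≤ μ.real (E₁ ∪ E₂ ∪ ⋃ y ∈ latticeBox x D₀, E₃ y) := measureReal_mono hsub (measure_ne_top _ _)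
    _ ≤ μ.real E₁ + μ.real E₂ + ∑ y ∈ latticeBox x D₀, μ.real (E₃ y) :=
        (measureReal_union_le _ _).trans (add_le_add (measureReal_union_le _ _)
          (measureReal_biUnion_finset_le _ _))
    _ ≤ c₁ * μ.real A' + c₂ * μ.real A' + ∑ _y ∈ latticeBox x D₀, c₃ * μ.real A' :=
        add_le_add (add_le_add b1 b2) (Finset.sum_le_sum b3)
    _ = (c₁ + c₂ + (2 * D₀ + 1) ^ d * c₃) * μ.real A' := by
        rw [Finset.sum_const, card_latticeBox, nsmul_eq_mul]
        push_cast
        ring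

end

/-! ### Choice of scales and uniform decay of the fall probability -/

section

theorem tendsto_rpow_mul_exp_neg_mul_rpow (p : ℝ) {c ε : ℝ} (hc : 0 < c) (hε : 0 < ε) :
    Tendsto (fun t : ℝ => t ^ p * Real.exp (-(c * t ^ ε))) atTop (𝓝 0) := by
  have h1 := (tendsto_rpow_mul_exp_neg_mul_atTop_nhds_zero (p / ε) c hc).comp (tendsto_rpow_atTop hε)
  refine h1.congr' ?_
  filter_upwards [eventually_gt_atTop 0] with t ht
  simp only [Function.comp]
  rw [← Real.rpow_mul ht.le, mul_div_cancel₀ _ hε.ne', neg_mul]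

theorem eventually_pow_mul_exp_le (q k : ℕ) (C : ℝ) {c ε : ℝ} (hc : 0 < c) (hε : 0 < ε) :
    ∀ᶠ t : ℝ in atTop, C * t ^ k * Real.exp (-(c * t ^ ε)) ≤ (t ^ q)⁻¹ / 3 := by
  have h1 := (tendsto_rpow_mul_exp_neg_mul_rpow ((q + k : ℕ) : ℝ) hc hε).const_mul C
  rw [mul_zero] at h1
  filter_upwards [h1.eventually (gt_mem_nhds (by norm_num : (0 : ℝ) < 1 / 3)),
    eventually_gt_atTop 0] with t h2 ht
  rw [Real.rpow_natCast, pow_add] at h2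
  have hq : 0 < t ^ q := by positivity
  have h3 : (t ^ q)⁻¹ * t ^ q = 1 := inv_mul_cancel₀ hq.ne'
  calc C * t ^ k * Real.exp (-(c * t ^ ε))
      = (t ^ q)⁻¹ * t ^ q * (C * t ^ k * Real.exp (-(c * t ^ ε))) := by rw [h3, one_mul]
    _ = (t ^ q)⁻¹ * (C * (t ^ q * t ^ k * Real.exp (-(c * t ^ ε)))) := by ring
    _ ≤ (t ^ q)⁻¹ * (1 / 3) := by gcongr
    _ = _ := by ring

set_option maxHeartbeats 1000000 in
/-- The choice of scales in the bound for the fall probability. -/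
theorem exists_scales {d : ℕ} (hd : 2 ≤ d) {K lam ρ c₀ ξ b : ℝ} (hK : 0 < K) (hlam : 0 < lam)
    (hρ : 0 < ρ) (hc₀ : 0 < c₀) (hξ : 0 < ξ) (hξ' : ξ ≤ 1 / 4) (hb : 1 ≤ b) :
    ∃ ε : ℝ, 0 < ε ∧ ∀ q : ℕ, ∃ t₀ : ℕ, 1 ≤ t₀ ∧ ∀ t : ℕ, t₀ ≤ t → ∃ (M s B L θ : ℝ) (R D₀ : ℕ),
      1 ≤ R ∧ 0 ≤ M ∧ 0 ≤ θ ∧ θ * K ≤ 1 ∧ d * (s + K * M) ≤ D₀ ∧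
      ((2 * d * D₀ + K) ^ 2 + b) ^ (1 / 2 - ξ)
        + (2 * K + ρ) * ((2 * R + 1) ^ d + (M + 1) * ((R : ℝ) ^ 2) ^ (-ξ)) ≤ B ∧
      (M + (t : ℝ) ^ (1 / 2 + ε)) * L ≤ t ∧
      Real.exp (-(θ * (lam * M)) + θ ^ 2 * K ^ 2 * t)
        + 2 * d * t * Real.exp (-(θ * s) + θ ^ 2 * K ^ 2 * t)
        + (2 * D₀ + 1) ^ d * (2 * Real.exp (-(c₀ * L / (2 * B)))) ≤ ((t : ℝ) ^ q)⁻¹ := by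
  have hd2 : (2 : ℝ) ≤ d := by exact_mod_cast hd
  have hd0 : (0 : ℝ) < d := by linarith
  -- With `M = s = t^(1/2 + ε)`, `θ = t^(-1/2)` and `R ≈ t^(1/(4d))`, the far losses are of order `M
  -- R^(-2ξ) = t^(1/2 + ε - ξ/(2d))`; this `ε` makes the exponent exactly `1/2 - 3ε`. The other
  -- parts of `B` are no larger. With `L = t^(1/2 - 2ε)` both `θ M` and `L / B` are of order `t^ε`,
  -- so all three error terms are stretched exponentials, and `2 M L = 2 t^(1 - ε) ≤ t` once `t^ε ≥
  -- 2`.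
  set ε : ℝ := ξ / (8 * d) with hε
  have hε0 : 0 < ε := by positivity
  have hεd : 8 * d * ε = ξ := by rw [hε]; field_simp
  have hεξ : 16 * ε ≤ ξ := by
    have := mul_le_mul_of_nonneg_right hd2 hε0.le
    linarith
  set c₁ : ℝ := d * (1 + K) + 1 with hc₁
  have hc₁0 : 0 < c₁ := by positivity
  set C₁ : ℝ := (2 * d * c₁ + K) ^ 2 + b with hC₁
  have hC₁1 : 1 ≤ C₁ := by rw [hC₁]; linarith [sq_nonneg (2 * d * c₁ + K)]
  set C : ℝ := C₁ + (2 * K + ρ) * (5 ^ d + 2) with hC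
  have hC0 : 0 < C := by positivity
  refine ⟨ε, hε0, fun q => ?_⟩
  have ev1 := eventually_pow_mul_exp_le q 0 (Real.exp (K ^ 2)) hlam hε0
  have ev2 := eventually_pow_mul_exp_le q 1 (2 * d * Real.exp (K ^ 2)) one_pos hε0
  have ev3 := eventually_pow_mul_exp_le q d ((2 * c₁ + 1) ^ d * 2)
    (show 0 < c₀ / (2 * C) by positivity) hε0
  have ev4 : ∀ᶠ t : ℝ in atTop, 2 ≤ t ^ ε := (tendsto_rpow_atTop hε0).eventually_ge_atTop 2
  obtain ⟨t₁, ht₁⟩ := eventually_atTop.1 (ev1.and (ev2.and (ev3.and ev4)))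
  refine ⟨max 1 (max ⌈t₁⌉₊ ⌈K ^ 2⌉₊), le_max_left _ _, fun t ht => ?_⟩
  have ht1 : (1 : ℝ) ≤ t := by exact_mod_cast (le_max_left _ _).trans ht
  have ht0 : (0 : ℝ) < t := by linarith
  have htt₁ : t₁ ≤ t := by
    have h1 : ⌈t₁⌉₊ ≤ t := ((le_max_left _ _).trans (le_max_right _ _)).trans ht
    exact (Nat.le_ceil _).trans (by exact_mod_cast h1)
  have htK : K ^ 2 ≤ t := by
    have h1 : ⌈K ^ 2⌉₊ ≤ t := ((le_max_right _ _).trans (le_max_right _ _)).trans ht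
    exact (Nat.le_ceil _).trans (by exact_mod_cast h1)
  obtain ⟨e1, e2, e3, e4⟩ := ht₁ t htt₁
  set T : ℝ := (t : ℝ) ^ (1 / 2 + ε) with hT
  have hT1 : 1 ≤ T := Real.one_le_rpow ht1 (by linarith)
  have hTt : T ≤ t := by
    calc T ≤ (t : ℝ) ^ (1 : ℝ) := Real.rpow_le_rpow_of_exponent_le ht1 (by linarith)
      _ = t := Real.rpow_one _
  set θ : ℝ := (t : ℝ) ^ (-(1 / 2) : ℝ) with hθ
  have hθ0 : 0 < θ := by positivity
  have hθ2 : θ ^ 2 * t = 1 := by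
    rw [hθ, ← Real.rpow_natCast, ← Real.rpow_mul ht0.le]
    have : (t : ℝ) ^ (-(1 / 2) * ((2 : ℕ) : ℝ)) = (t : ℝ)⁻¹ := by
      rw [← Real.rpow_neg_one]; norm_num
    rw [this, inv_mul_cancel₀ ht0.ne']
  have hθT : θ * T = (t : ℝ) ^ ε := by
    rw [hθ, hT, ← Real.rpow_add ht0]; congr 1; ring
  have hθKt : θ ^ 2 * K ^ 2 * t = K ^ 2 := by
    calc θ ^ 2 * K ^ 2 * t = (θ ^ 2 * t) * K ^ 2 := by ring
      _ = K ^ 2 := by rw [hθ2, one_mul]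
  set D₀ : ℕ := ⌈d * (T + K * T)⌉₊ with hD₀
  have hD₀le : (D₀ : ℝ) ≤ c₁ * T := by
    have := (Nat.ceil_lt_add_one (a := d * (T + K * T)) (by positivity)).le
    rw [← hD₀] at this
    calc (D₀ : ℝ) ≤ d * (T + K * T) + 1 := this
      _ ≤ d * (T + K * T) + T := by gcongr
      _ = c₁ * T := by rw [hc₁]; ring
  set R : ℕ := ⌈(t : ℝ) ^ (1 / (4 * d) : ℝ)⌉₊ with hR
  set τ : ℝ := (t : ℝ) ^ (1 / (4 * d) : ℝ) with hτ
  have hτ1 : 1 ≤ τ := Real.one_le_rpow ht1 (by positivity)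
  have hRτ : τ ≤ R := Nat.le_ceil _
  have hR2 : (R : ℝ) ≤ 2 * τ := by
    have := (Nat.ceil_lt_add_one (a := τ) (by positivity)).le
    linarith
  have hR1 : 1 ≤ R := by
    have : (1 : ℝ) ≤ R := hτ1.trans hRτ
    exact_mod_cast this
  set Q : ℝ := (t : ℝ) ^ (1 / 2 - 3 * ε) with hQ
  have hQ0 : 0 < Q := by positivity
  have hBle : ((2 * d * D₀ + K) ^ 2 + b) ^ (1 / 2 - ξ)
        + (2 * K + ρ) * ((2 * R + 1) ^ d + (T + 1) * ((R : ℝ) ^ 2) ^ (-ξ)) ≤ C * Q := by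
    have p1 : ((2 * d * D₀ + K) ^ 2 + b) ^ (1 / 2 - ξ) ≤ C₁ * Q := by
      have q1 : (2 * d * D₀ + K) ^ 2 + b ≤ C₁ * T ^ 2 := by
        have q2 : 2 * d * (D₀ : ℝ) + K ≤ (2 * d * c₁ + K) * T := by
          calc 2 * d * (D₀ : ℝ) + K ≤ 2 * d * (c₁ * T) + K * T := by
                gcongr
                exact le_mul_of_one_le_right hK.le hT1
            _ = _ := by ring
        have q3 : (2 * d * (D₀ : ℝ) + K) ^ 2 ≤ ((2 * d * c₁ + K) * T) ^ 2 := by gcongr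
        have q4 : b ≤ b * T ^ 2 := le_mul_of_one_le_right (by linarith) (one_le_pow₀ hT1)
        calc _ ≤ ((2 * d * c₁ + K) * T) ^ 2 + b * T ^ 2 := add_le_add q3 q4
          _ = _ := by rw [hC₁]; ring
      calc ((2 * d * D₀ + K) ^ 2 + b) ^ (1 / 2 - ξ) ≤ (C₁ * T ^ 2) ^ (1 / 2 - ξ) := by
            refine Real.rpow_le_rpow (by positivity) q1 (by linarith)
        _ = C₁ ^ (1 / 2 - ξ) * (T ^ 2) ^ (1 / 2 - ξ) :=
            Real.mul_rpow (by linarith) (by positivity)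
        _ ≤ C₁ ^ (1 : ℝ) * Q := by
            refine mul_le_mul (Real.rpow_le_rpow_of_exponent_le hC₁1 (by linarith)) ?_
              (by positivity) (by positivity)
            rw [hT, ← Real.rpow_natCast, ← Real.rpow_mul ht0.le, ← Real.rpow_mul ht0.le]
            refine Real.rpow_le_rpow_of_exponent_le ht1 ?_
            push_cast
            have := mul_pos hε0 hξ
            linarith
        _ = C₁ * Q := by rw [Real.rpow_one]
    have p2 : (2 * (R : ℝ) + 1) ^ d ≤ 5 ^ d * Q := by
      calc (2 * (R : ℝ) + 1) ^ d ≤ (5 * τ) ^ d := by gcongr; linarith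
        _ = 5 ^ d * τ ^ d := mul_pow _ _ _
        _ ≤ 5 ^ d * Q := by
            gcongr
            rw [hτ, ← Real.rpow_natCast, ← Real.rpow_mul ht0.le]
            refine Real.rpow_le_rpow_of_exponent_le ht1 ?_
            have : 1 / (4 * (d : ℝ)) * d = 1 / 4 := by field_simp
            rw [this]
            linarith
    have p3 : (T + 1) * ((R : ℝ) ^ 2) ^ (-ξ) ≤ 2 * Q := by
      calc (T + 1) * ((R : ℝ) ^ 2) ^ (-ξ) ≤ (2 * T) * (τ ^ 2) ^ (-ξ) := by
            refine mul_le_mul (by linarith) ?_ (by positivity) (by positivity)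
            refine Real.rpow_le_rpow_of_nonpos (by positivity) ?_ (by linarith)
            gcongr
        _ = 2 * Q := by
            rw [hT, hτ, hQ, ← Real.rpow_natCast, ← Real.rpow_mul ht0.le, ← Real.rpow_mul ht0.le,
              mul_assoc, ← Real.rpow_add ht0]
            congr 2
            rw [← hεd]
            push_cast
            field_simp
            ring
    calc _ ≤ C₁ * Q + (2 * K + ρ) * (5 ^ d * Q + 2 * Q) := by gcongr
      _ = C * Q := by rw [hC]; ring
  refine ⟨T, T, C * Q, (t : ℝ) ^ (1 / 2 - 2 * ε), θ, R, D₀, hR1, by linarith, hθ0.le, ?_,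
    Nat.le_ceil _, hBle, ?_, ?_⟩
  · have h1 : (θ * K) ^ 2 ≤ 1 ^ 2 := by
      rw [mul_pow, one_pow]
      calc θ ^ 2 * K ^ 2 ≤ θ ^ 2 * t := by gcongr
        _ = 1 := hθ2
    exact (sq_le_sq₀ (by positivity) zero_le_one).1 h1
  · have h1 : T * (t : ℝ) ^ (1 / 2 - 2 * ε) * (t : ℝ) ^ ε = t := by
      rw [hT, ← Real.rpow_add ht0, ← Real.rpow_add ht0]
      have : (1 / 2 + ε + (1 / 2 - 2 * ε) + ε : ℝ) = 1 := by ring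
      rw [this, Real.rpow_one]
    have h2 : 0 < T * (t : ℝ) ^ (1 / 2 - 2 * ε) := by positivity
    calc (T + T) * (t : ℝ) ^ (1 / 2 - 2 * ε) = T * (t : ℝ) ^ (1 / 2 - 2 * ε) * 2 := by ring
      _ ≤ T * (t : ℝ) ^ (1 / 2 - 2 * ε) * (t : ℝ) ^ ε := by gcongr
      _ = t := h1
  · have a1 : Real.exp (-(θ * (lam * T)) + θ ^ 2 * K ^ 2 * t) ≤ ((t : ℝ) ^ q)⁻¹ / 3 := by
      have : -(θ * (lam * T)) + θ ^ 2 * K ^ 2 * t = K ^ 2 + -(lam * (t : ℝ) ^ ε) := by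
        rw [hθKt, ← hθT]; ring
      rw [this, Real.exp_add]
      simpa using e1
    have a2 : 2 * d * t * Real.exp (-(θ * T) + θ ^ 2 * K ^ 2 * t) ≤ ((t : ℝ) ^ q)⁻¹ / 3 := by
      have : -(θ * T) + θ ^ 2 * K ^ 2 * t = K ^ 2 + -(1 * (t : ℝ) ^ ε) := by
        rw [hθKt, ← hθT]; ring
      rw [this, Real.exp_add]
      refine le_trans (le_of_eq ?_) e2
      ring
    have a3 : (2 * (D₀ : ℝ) + 1) ^ d
        * (2 * Real.exp (-(c₀ * (t : ℝ) ^ (1 / 2 - 2 * ε) / (2 * (C * Q)))))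
        ≤ ((t : ℝ) ^ q)⁻¹ / 3 := by
      have h1 : c₀ * (t : ℝ) ^ (1 / 2 - 2 * ε) / (2 * (C * Q)) = c₀ / (2 * C) * (t : ℝ) ^ ε := by
        have : (t : ℝ) ^ (1 / 2 - 2 * ε) = Q * (t : ℝ) ^ ε := by
          rw [hQ, ← Real.rpow_add ht0]; congr 1; ring
        rw [this]
        field_simp
      rw [h1]
      have h2 : 2 * (D₀ : ℝ) + 1 ≤ (2 * c₁ + 1) * t := by
        calc 2 * (D₀ : ℝ) + 1 ≤ 2 * (c₁ * t) + t := by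
              gcongr
              exact hD₀le.trans (by gcongr)
          _ = _ := by ring
      calc _ ≤ ((2 * c₁ + 1) * t) ^ d * (2 * Real.exp (-(c₀ / (2 * C) * (t : ℝ) ^ ε))) := by
            gcongr
        _ = (2 * c₁ + 1) ^ d * 2 * (t : ℝ) ^ d * Real.exp (-(c₀ / (2 * C) * (t : ℝ) ^ ε)) := by
            rw [mul_pow]; ring
        _ ≤ _ := e3
    linarith

/-- `FallBound` records that the probability of first falling below a level after exactly `t` steps
decays like `t ^ (-q)`, provided at most `t ^ (1 / 2 + ε)` sites above that level were visited. -/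
def FallBound {d : ℕ} {Ω : Type*} {m : MeasurableSpace Ω} (μ : Measure Ω) (ℱ : Filtration ℕ m)
    (l : EuclideanSpace ℝ (Fin d)) (X : ℕ → Ω → (Fin d → ℤ)) (ε : ℝ) (q t₀ : ℕ) : Prop :=
  ∀ (n : ℕ) (A : Set Ω) (a : ℝ) (t : ℕ), MeasurableSet[ℱ n] A → t₀ ≤ t →
    (∀ ω ∈ A, a ≤ height l X n ω) →
    (∀ ω ∈ A, (priorCount l X a n ω : ℝ) ≤ (t : ℝ) ^ (1 / 2 + ε)) →
    μ.real (A ∩ {ω | (∀ j < t, a ≤ height l X (n + j) ω) ∧ height l X (n + t) ω < a})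
      ≤ ((t : ℝ) ^ q)⁻¹ * μ.real A

/-- The order of quantifiers is the point: `ε` precedes the power `q`, and the threshold `t₀`
precedes the direction, the space and the walk, so later constants depend on the parameters alone.
-/
theorem exists_fallBound {d : ℕ} (hd : 2 ≤ d) {K h r lam : ℝ} (hK : 0 < K) (hh : 0 < h)
    (hr : 0 < r) (hlam : 0 < lam) :
    ∃ ε : ℝ, 0 < ε ∧ ∀ q : ℕ, ∃ t₀ : ℕ, 1 ≤ t₀ ∧ ∀ (l : EuclideanSpace ℝ (Fin d)), ‖l‖ = 1 →
      ∀ (Ω : Type u) (m : MeasurableSpace Ω) (μ : Measure Ω), IsProbabilityMeasure μ →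
      ∀ (ℱ : Filtration ℕ m) (X : ℕ → Ω → (Fin d → ℤ)),
        IsGeneralizedExcitedRandomWalk μ ℱ l K h r lam X → FallBound μ ℱ l X ε q t₀ := by
  obtain ⟨ξ, b, hp⟩ := exists_lyapunovParams hK (show 0 < h * r ^ 2 / 2 by positivity)
  have hb : 0 < b := by linarith [hp.one_le]
  have hγ : 0 < 1 / 2 - ξ := by linarith [hp.xi_le]
  obtain ⟨ε, hε, H⟩ := exists_scales hd hK hlam (show 0 < h * r ^ 2 by positivity)
    (show 0 < (1 / 2 - ξ) * b ^ (1 / 2 - ξ - 1) * (h * r ^ 2 / 2) by positivity)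
    hp.xi_pos hp.xi_le hp.one_le
  refine ⟨ε, hε, fun q => ?_⟩
  obtain ⟨t₀, ht₀, H'⟩ := H q
  refine ⟨t₀, ht₀, fun l hl Ω m μ hμ ℱ X hX n A a t hA ht hAa hAb => ?_⟩
  obtain ⟨M, s, B, L, θ, R, D₀, hR, hM, hθ, hθK, hD₀, hB, hL, hle⟩ := H' t ht
  refine (hX.measure_fall_le hd hK hr hh hlam hl hp hA (by omega) hR hM hθ hθK hD₀ hAa hAb hB
    hL).trans ?_
  gcongr

end

section

variable {d : ℕ} {Ω : Type*} {m : MeasurableSpace Ω} {μ : Measure Ω} [IsProbabilityMeasure μ]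
  {ℱ : Filtration ℕ m} {l : EuclideanSpace ℝ (Fin d)} {K h r lam : ℝ}
  {X : ℕ → Ω → (Fin d → ℤ)}

/-! ### Escaping above a freshly reached level -/

theorem measureReal_mono_ae {S T : Set Ω} (h : ∀ᵐ ω ∂μ, ω ∈ S → ω ∈ T) :
    μ.real S ≤ μ.real T :=
  ENNReal.toReal_mono (measure_ne_top _ _) (measure_mono_ae h)

theorem measureReal_iUnion_le_of_range {T : ℕ → Set Ω} {c : ℝ}
    (hc : ∀ H, μ.real (⋃ t ∈ Finset.range H, T t) ≤ c) : μ.real (⋃ t, T t) ≤ c := by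
  have h1 := (ENNReal.tendsto_toReal (measure_ne_top μ (⋃ t, T t))).comp
    (tendsto_measure_iUnion_accumulate (μ := μ) (f := T))
  refine le_of_tendsto' h1 fun i => ?_
  refine le_trans (le_of_eq ?_) (hc (i + 1))
  show μ.real _ = _
  congr 1
  ext ω
  simp [Set.mem_accumulate]

theorem sum_Ico_inv_pow_le {q w : ℕ} (hq : 2 ≤ q) (hw : 1 ≤ w) (H : ℕ) :
    ∑ t ∈ Finset.Ico w H, ((t : ℝ) ^ q)⁻¹ ≤ 2 * ((w : ℝ) ^ (q - 1))⁻¹ := by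
  have hw0 : (0 : ℝ) < w := by exact_mod_cast hw
  calc ∑ t ∈ Finset.Ico w H, ((t : ℝ) ^ q)⁻¹
      ≤ ∑ t ∈ Finset.Ico w H, ((w : ℝ) ^ (q - 2))⁻¹ * ((t : ℝ) ^ 2)⁻¹ := by
        refine Finset.sum_le_sum fun t ht => ?_
        have h1 : (w : ℝ) ≤ t := by exact_mod_cast (Finset.mem_Ico.1 ht).1
        have h2 : q = (q - 2) + 2 := by omega
        have ht0 : (0 : ℝ) < t := hw0.trans_le h1
        conv_lhs => rw [h2, pow_add, mul_inv]
        gcongr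
    _ = ((w : ℝ) ^ (q - 2))⁻¹ * ∑ t ∈ Finset.Ioo (w - 1) H, ((t : ℝ) ^ 2)⁻¹ := by
        rw [← Finset.mul_sum]
        congr 2
        ext t
        simp only [Finset.mem_Ico, Finset.mem_Ioo]
        omega
    _ ≤ ((w : ℝ) ^ (q - 2))⁻¹ * (2 / ((w - 1 : ℕ) + 1)) := by
        gcongr
        exact sum_Ioo_inv_sq_le _ _
    _ = 2 * ((w : ℝ) ^ (q - 1))⁻¹ := by
        have h1 : ((w - 1 : ℕ) : ℝ) + 1 = w := by exact_mod_cast Nat.sub_add_cancel hw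
        have h2 : q - 1 = (q - 2) + 1 := by omega
        rw [h1, h2, pow_succ, mul_inv]
        ring

/-- The event that, from time `n`, the walk first goes below level `a` after exactly `t` steps. -/
def fallSet (l : EuclideanSpace ℝ (Fin d)) (X : ℕ → Ω → (Fin d → ℤ)) (a : ℝ) (n t : ℕ) : Set Ω :=
  {ω | (∀ j < t, a ≤ height l X (n + j) ω) ∧ height l X (n + t) ω < a}

theorem exists_mem_fallSet {a : ℝ} {n i : ℕ} {ω : Ω} (hi : height l X (n + i) ω < a) :
    ∃ t ≤ i, ω ∈ fallSet l X a n t := by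
  classical
  have hex : ∃ t, height l X (n + t) ω < a := ⟨i, hi⟩
  exact ⟨Nat.find hex, Nat.find_min' hex hi, fun j hj => not_lt.1 (Nat.find_min hex hj),
    Nat.find_spec hex⟩

/-- A union bound over the time of the fall. A count of earlier sites admissible at scale `w` is
admissible for every larger time, and the sum of `t^(-q)` costs one power of `w`. -/
theorem FallBound.measure_late_le {ε : ℝ} {q t₀ : ℕ} (hF : FallBound μ ℱ l X ε q t₀) (hε : 0 < ε)
    (hq : 2 ≤ q) {n w : ℕ} {a : ℝ} {A : Set Ω} (hA : MeasurableSet[ℱ n] A) (hw : 1 ≤ w)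
    (hwt : t₀ ≤ w) (hAa : ∀ ω ∈ A, a ≤ height l X n ω)
    (hAb : ∀ ω ∈ A, (priorCount l X a n ω : ℝ) ≤ (w : ℝ) ^ (1 / 2 + ε)) :
    μ.real (A ∩ {ω | ∃ t ≥ w, ω ∈ fallSet l X a n t}) ≤ 2 * ((w : ℝ) ^ (q - 1))⁻¹ * μ.real A := by
  have h1 : A ∩ {ω | ∃ t ≥ w, ω ∈ fallSet l X a n t}
      = ⋃ t, {ω | w ≤ t ∧ ω ∈ A ∩ fallSet l X a n t} := by
    ext ω
    simp only [Set.mem_inter_iff, Set.mem_ofPred_eq, Set.mem_iUnion]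
    constructor
    · rintro ⟨hA, t, ht, hf⟩; exact ⟨t, ht, hA, hf⟩
    · rintro ⟨t, ht, hA, hf⟩; exact ⟨hA, t, ht, hf⟩
  rw [h1]
  refine measureReal_iUnion_le_of_range fun H => ?_
  have h2 : (⋃ t ∈ Finset.range H, {ω | w ≤ t ∧ ω ∈ A ∩ fallSet l X a n t})
      ⊆ ⋃ t ∈ Finset.Ico w H, (A ∩ fallSet l X a n t) := by
    intro ω hω
    simp only [Set.mem_iUnion, Finset.mem_range, exists_prop, Set.mem_ofPred_eq] at hω
    obtain ⟨t, htH, hwt, hω⟩ := hω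
    exact Set.mem_biUnion (Finset.mem_coe.2 (Finset.mem_Ico.2 ⟨hwt, htH⟩)) hω
  refine (measureReal_mono h2 (measure_ne_top _ _)).trans ?_
  refine (measureReal_biUnion_finset_le _ _).trans ?_
  calc ∑ t ∈ Finset.Ico w H, μ.real (A ∩ fallSet l X a n t)
      ≤ ∑ t ∈ Finset.Ico w H, ((t : ℝ) ^ q)⁻¹ * μ.real A := by
        refine Finset.sum_le_sum fun t ht => ?_
        have hwt' := (Finset.mem_Ico.1 ht).1
        refine hF n A a t hA (hwt.trans hwt') hAa fun ω hω => (hAb ω hω).trans ?_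
        have : (w : ℝ) ≤ t := by exact_mod_cast hwt'
        gcongr
    _ ≤ _ := by
        rw [← Finset.sum_mul]
        gcongr
        exact sum_Ico_inv_pow_le hq hw H

/-- Ellipticity in direction `l` holds at every step, new site or not, so a run of `k` large upward
steps is available from any past. Measurability is included because the argument is restarted at
time `n + k` on this event. -/
theorem IsGeneralizedExcitedRandomWalk.measure_climb_ge
    (hX : IsGeneralizedExcitedRandomWalk μ ℱ l K h r lam X) {h' : ℝ} (hh : 0 ≤ h') (hh' : h' ≤ h)
    {n : ℕ} {A : Set Ω} (hA : MeasurableSet[ℱ n] A) (k : ℕ) :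
    MeasurableSet[ℱ (n + k)] (A ∩ {ω | ∀ j < k, r < inner ℝ (jump X (n + j) ω) l}) ∧
    h' ^ k * μ.real A ≤ μ.real (A ∩ {ω | ∀ j < k, r < inner ℝ (jump X (n + j) ω) l}) := by
  have hJm : ∀ j, MeasurableSet[ℱ (n + j + 1)] {ω | r < inner ℝ (jump X (n + j) ω) l} := by
    intro j
    refine measurableSet_of_determined hX.adapted fun ω ω' hj hω => ?_
    unfold jump at *
    rwa [← hj _ le_rfl, ← hj (n + j) (by omega)]
  induction k with
  | zero => simpa using hA
  | succ k ih =>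
    obtain ⟨ihm, ihle⟩ := ih
    set B := A ∩ {ω | ∀ j < k, r < inner ℝ (jump X (n + j) ω) l} with hB
    set S := {ω | r < inner ℝ (jump X (n + k) ω) l} with hS
    have heq : A ∩ {ω | ∀ j < k + 1, r < inner ℝ (jump X (n + j) ω) l} = B ∩ S := by
      ext ω
      simp only [hB, hS, Set.mem_inter_iff, Set.mem_ofPred_eq, Nat.lt_succ_iff_lt_or_eq]
      constructor
      · rintro ⟨h1, h2⟩; exact ⟨⟨h1, fun j hj => h2 j (Or.inl hj)⟩, h2 k (Or.inr rfl)⟩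
      · rintro ⟨⟨h1, h2⟩, h3⟩
        refine ⟨h1, fun j hj => ?_⟩
        rcases hj with hj | rfl
        · exact h2 j hj
        · exact h3
    rw [heq]
    have hSm : MeasurableSet S := ℱ.le _ _ (hJm k)
    refine ⟨(ℱ.mono (by omega) _ ihm).inter (hJm k), ?_⟩
    have h1 : ∫ ω in B, (μ⟦S | ℱ (n + k)⟧) ω ∂μ = μ.real (B ∩ S) := by
      rw [setIntegral_condExp (ℱ.le _) ((integrable_const 1).indicator hSm) ihm,
        setIntegral_indicator hSm]
      simp
    have h2 : h' * μ.real B ≤ ∫ ω in B, (μ⟦S | ℱ (n + k)⟧) ω ∂μ := by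
      calc h' * μ.real B = ∫ _ω in B, h' ∂μ := by simp [mul_comm]
        _ ≤ _ := by
          refine setIntegral_mono_ae (integrable_const _).integrableOn
            integrable_condExp.integrableOn ?_
          filter_upwards [(hX.condE (n + k)).1] with ω hω using hh'.trans hω
    rw [pow_succ, mul_comm _ h', mul_assoc]
    calc h' * (h' ^ k * μ.real A) ≤ h' * μ.real B := by gcongr
      _ ≤ _ := h2.trans h1.le

/-- Level `a` is reached for the first time at time `n`. -/
def Hit (l : EuclideanSpace ℝ (Fin d)) (X : ℕ → Ω → (Fin d → ℤ)) (a : ℝ) (n : ℕ) (ω : Ω) : Prop :=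
  (∀ j < n, height l X j ω < a) ∧ a ≤ height l X n ω

/-- Everything before the hitting time lies below `a`, so only sites occupied in the `k` steps from
time `n` on can count. -/
theorem priorCount_le_of_hit {a : ℝ} {n : ℕ} {ω : Ω} (hω : Hit l X a n ω) (k : ℕ) :
    priorCount l X a (n + k) ω ≤ k := by
  classical
  have hsub : (((Finset.range (n + k)).image fun j => X j ω).filter
      fun x => a ≤ inner ℝ (toVec x) l) ⊆ (Finset.range k).image fun j => X (n + j) ω := by
    intro x hx
    obtain ⟨h1, h2⟩ := Finset.mem_filter.1 hx
    obtain ⟨j, hj, rfl⟩ := Finset.mem_image.1 h1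
    rw [Finset.mem_range] at hj
    have hnj : n ≤ j := by
      by_contra hlt
      have := hω.1 j (not_le.1 hlt)
      unfold height at this
      linarith
    exact Finset.mem_image.2 ⟨j - n, Finset.mem_range.2 (by omega),
      by rw [Nat.add_sub_cancel' hnj]⟩
  calc priorCount l X a (n + k) ω ≤ ((Finset.range k).image fun j => X (n + j) ω).card := by
        unfold priorCount
        convert Finset.card_le_card hsub
    _ ≤ k := Finset.card_image_le.trans (by simp)

/-- The event that the walk goes below level `a` after time `n`. -/
def belowSet (l : EuclideanSpace ℝ (Fin d)) (X : ℕ → Ω → (Fin d → ℤ)) (a : ℝ) (n : ℕ) : Set Ω :=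
  {ω | ∃ i, height l X (n + i) ω < a}

theorem measurableSet_belowSet (hX : Adapted ℱ X) (a : ℝ) (n : ℕ) :
    MeasurableSet (belowSet l X a n) := by
  have : belowSet l X a n = ⋃ i, {ω | height l X (n + i) ω < a} := by
    ext ω; simp [belowSet]
  rw [this]
  exact MeasurableSet.iUnion fun i => measurableSet_lt
    ((measurable_height hX (n + i)).mono (ℱ.le _) le_rfl) measurable_const

theorem height_climb {n k : ℕ} {ω : Ω} (hω : ∀ j < k, r < inner ℝ (jump X (n + j) ω) l) :
    height l X n ω + r * k ≤ height l X (n + k) ω := by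
  induction k with
  | zero => simp
  | succ k ih =>
    have h1 := ih fun j hj => hω j (by omega)
    have h2 := hω k (Nat.lt_succ_self k)
    have h3 : height l X (n + (k + 1)) ω = height l X (n + k) ω + inner ℝ (jump X (n + k) ω) l := by
      unfold height jump
      rw [inner_sub_left, ← add_assoc]; ring
    rw [h3]
    push_cast
    linarith

/-- From a freshly reached level, the walk never returns below it with probability bounded away
from zero. -/
theorem exists_escape {d : ℕ} {K h r lam ε : ℝ} {q t₀ : ℕ} (hK : 0 < K) (hh : 0 < h)
    (hr : 0 < r) (hlam : 0 < lam) (hε : 0 < ε) (hq : 2 ≤ q) :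
    ∃ p : ℝ, 0 < p ∧ p < 1 ∧ ∀ (l : EuclideanSpace ℝ (Fin d)), ‖l‖ = 1 →
      ∀ (Ω : Type u) (m : MeasurableSpace Ω) (μ : Measure Ω), IsProbabilityMeasure μ →
      ∀ (ℱ : Filtration ℕ m) (X : ℕ → Ω → (Fin d → ℤ)),
        IsGeneralizedExcitedRandomWalk μ ℱ l K h r lam X → FallBound μ ℱ l X ε q t₀ →
        ∀ (n : ℕ) (a : ℝ) (A : Set Ω), MeasurableSet[ℱ n] A → (∀ ω ∈ A, Hit l X a n ω) →
          μ.real (A ∩ belowSet l X a n) ≤ (1 - p) * μ.real A := by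
  have ev1 := (tendsto_rpow_mul_exp_neg_mul_rpow 1 hr hε).const_mul (Real.exp (K ^ 2 + r))
  rw [mul_zero] at ev1
  have ev2 := ev1.eventually (gt_mem_nhds (by norm_num : (0 : ℝ) < 1 / 4))
  obtain ⟨τ, hτ1, hτ2⟩ := ((tendsto_natCast_atTop_atTop.eventually ev2).and
    (eventually_ge_atTop (max (max t₀ 8) ⌈K ^ 2⌉₊))).exists
  have hτt : t₀ ≤ τ := ((le_max_left _ _).trans (le_max_left _ _)).trans hτ2
  have hτ8 : 8 ≤ τ := ((le_max_right _ _).trans (le_max_left _ _)).trans hτ2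
  have hτ8' : (8 : ℝ) ≤ τ := by exact_mod_cast hτ8
  have hτ0 : (0 : ℝ) < τ := by linarith
  have hτK : K ^ 2 ≤ τ := (Nat.le_ceil _).trans (by exact_mod_cast (le_max_right _ _).trans hτ2)
  -- The climb has to exceed the diffusive scale `√τ`, to rule out falls within `τ` steps, and to
  -- leave at most `τ^(1/2 + ε)` visited sites, so that `FallBound` covers all later falls. Rounding
  -- down costs the `r` in `exp (K ^ 2 + r)`.
  set k : ℕ := ⌊(τ : ℝ) ^ (1 / 2 + ε)⌋₊ with hk
  have hk1 : (k : ℝ) ≤ (τ : ℝ) ^ (1 / 2 + ε) := Nat.floor_le (by positivity)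
  have hk2 : (τ : ℝ) ^ (1 / 2 + ε) ≤ k + 1 := (Nat.lt_floor_add_one _).le
  -- Capping at 1 ensures `h' ^ k ≤ 1`, hence `p < 1`, without first deducing `h ≤ 1` from the
  -- existence of a walk.
  set h' := min h 1 with hh'
  have hh'0 : 0 < h' := lt_min hh one_pos
  have hhk : h' ^ k ≤ 1 := pow_le_one₀ hh'0.le (min_le_right _ _)
  refine ⟨h' ^ k / 2, by positivity, by linarith,
    fun l hl Ω m μ hμ ℱ X hX hF n a A hA hAa => ?_⟩
  obtain ⟨hcm, hcge⟩ := hX.measure_climb_ge hh'0.le (min_le_left _ _) hA k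
  set A' := A ∩ {ω | ∀ j < k, r < inner ℝ (jump X (n + j) ω) l} with hA'
  have hclimb : ∀ ω ∈ A', ∀ j ≤ k, a + r * j ≤ height l X (n + j) ω := by
    intro ω hω j hj
    have := height_climb (n := n) (k := j) (ω := ω) (r := r) (l := l)
      fun i hi => hω.2 i (by omega)
    linarith [(hAa ω hω.1).2]
  set θ : ℝ := (τ : ℝ) ^ (-(1 / 2) : ℝ) with hθ
  have hθ0 : 0 < θ := by positivity
  have hθ2 : θ ^ 2 * τ = 1 := by
    rw [hθ, ← Real.rpow_natCast, ← Real.rpow_mul hτ0.le]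
    have : (τ : ℝ) ^ (-(1 / 2) * ((2 : ℕ) : ℝ)) = (τ : ℝ)⁻¹ := by
      rw [← Real.rpow_neg_one]; norm_num
    rw [this, inv_mul_cancel₀ hτ0.ne']
  have hθK : θ * K ≤ 1 := by
    have h1 : (θ * K) ^ 2 ≤ 1 ^ 2 := by
      rw [mul_pow, one_pow]
      calc θ ^ 2 * K ^ 2 ≤ θ ^ 2 * τ := by gcongr
        _ = 1 := hθ2
    exact (sq_le_sq₀ (by positivity) zero_le_one).1 h1
  have hθ1 : θ ≤ 1 := Real.rpow_le_one_of_one_le_of_nonpos (by linarith) (by norm_num)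
  have hθk : (τ : ℝ) ^ ε - 1 ≤ θ * k := by
    have h1 : θ * (τ : ℝ) ^ (1 / 2 + ε) = (τ : ℝ) ^ ε := by
      rw [hθ, ← Real.rpow_add hτ0]; congr 1; ring
    have h2 := mul_le_mul_of_nonneg_left hk2 hθ0.le
    rw [h1] at h2
    linarith
  have hlate := hF.measure_late_le hε hq (w := τ) (a := a) hcm (by omega) hτt
    (fun ω hω => by
      have := hclimb ω hω k le_rfl
      have : 0 ≤ r * k := by positivity
      linarith)
    (fun ω hω => by
      have : (priorCount l X a (n + k) ω : ℝ) ≤ k := by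
        exact_mod_cast priorCount_le_of_hit (hAa ω hω.1) k
      exact this.trans hk1)
  have hlate' : 2 * ((τ : ℝ) ^ (q - 1))⁻¹ ≤ 1 / 4 := by
    have h1 : (8 : ℝ) ≤ (τ : ℝ) ^ (q - 1) :=
      hτ8'.trans (le_self_pow₀ (by linarith) (by omega))
    have h2 : ((τ : ℝ) ^ (q - 1))⁻¹ ≤ 8⁻¹ := inv_anti₀ (by norm_num) h1
    linarith
  have hearly : ∀ t < τ, μ.real (A' ∩ fallSet l X a (n + k) t)
      ≤ Real.exp (K ^ 2 + r) * Real.exp (-(r * (τ : ℝ) ^ ε)) * μ.real A' := by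
    intro t ht
    have h1 := hX.measure_newCount_gt_le hK hl hlam hθ0.le hθK hcm t 0 (r * k)
    refine le_trans (measureReal_mono ?_ (measure_ne_top _ _)) (h1.trans ?_)
    · rintro ω ⟨hωA, hf⟩
      refine ⟨hωA, ?_, by positivity⟩
      have := hclimb ω hωA k le_rfl
      linarith [hf.2]
    · rw [← Real.exp_add]
      refine mul_le_mul_of_nonneg_right (Real.exp_le_exp.2 ?_) measureReal_nonneg
      have h2 : θ ^ 2 * K ^ 2 * t ≤ K ^ 2 := by
        have : (t : ℝ) ≤ τ := by exact_mod_cast ht.le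
        calc θ ^ 2 * K ^ 2 * t ≤ θ ^ 2 * K ^ 2 * τ := by gcongr
          _ = (θ ^ 2 * τ) * K ^ 2 := by ring
          _ = K ^ 2 := by rw [hθ2, one_mul]
      have h3 := mul_le_mul_of_nonneg_left hθk hr.le
      linarith
  have hbelow : μ.real (A' ∩ belowSet l X a (n + k)) ≤ 1 / 2 * μ.real A' := by
    have hsub : A' ∩ belowSet l X a (n + k) ⊆ (⋃ t ∈ Finset.range τ, (A' ∩ fallSet l X a (n + k) t))
        ∪ (A' ∩ {ω | ∃ t ≥ τ, ω ∈ fallSet l X a (n + k) t}) := by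
      rintro ω ⟨hωA, i, hi⟩
      obtain ⟨t, -, ht⟩ := exists_mem_fallSet hi
      rcases lt_or_ge t τ with h1 | h1
      · left
        exact Set.mem_biUnion (Finset.mem_coe.2 (Finset.mem_range.2 h1)) ⟨hωA, ht⟩
      · right
        exact ⟨hωA, t, h1, ht⟩
    calc _ ≤ _ := measureReal_mono hsub (measure_ne_top _ _)
      _ ≤ ∑ t ∈ Finset.range τ, μ.real (A' ∩ fallSet l X a (n + k) t)
          + μ.real (A' ∩ {ω | ∃ t ≥ τ, ω ∈ fallSet l X a (n + k) t}) :=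
        (measureReal_union_le _ _).trans (by
          gcongr
          exact measureReal_biUnion_finset_le _ _)
      _ ≤ ∑ _t ∈ Finset.range τ, Real.exp (K ^ 2 + r) * Real.exp (-(r * (τ : ℝ) ^ ε)) * μ.real A'
          + 1 / 4 * μ.real A' := by
        refine add_le_add (Finset.sum_le_sum fun t ht => hearly t (Finset.mem_range.1 ht)) ?_
        exact hlate.trans (by gcongr)
      _ = (Real.exp (K ^ 2 + r) * ((τ : ℝ) ^ (1 : ℝ) * Real.exp (-(r * (τ : ℝ) ^ ε)))) * μ.real A'
          + 1 / 4 * μ.real A' := by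
        rw [Finset.sum_const, Finset.card_range, nsmul_eq_mul, Real.rpow_one]; ring
      _ ≤ 1 / 4 * μ.real A' + 1 / 4 * μ.real A' := by gcongr
      _ = _ := by ring
  -- After the climb the walk stays above `a` with conditional probability at least 1/2, and during
  -- the climb it cannot be below `a`. Hence the event of never falling keeps at least `h' ^ k / 2`
  -- of the mass of `A`.
  have hBm : MeasurableSet (belowSet l X a n) := measurableSet_belowSet hX.adapted a n
  have hsplit := measureReal_inter_add_sdiff (μ := μ) (s := A) hBm
  have hsplit' := measureReal_inter_add_sdiff (μ := μ) (s := A')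
    (measurableSet_belowSet (l := l) hX.adapted a (n + k))
  have hsub2 : A' \ belowSet l X a (n + k) ⊆ A \ belowSet l X a n := by
    rintro ω ⟨hωA, hω⟩
    refine ⟨hωA.1, ?_⟩
    rintro ⟨i, hi⟩
    rcases le_or_gt i k with hik | hik
    · have := hclimb ω hωA i hik
      have : 0 ≤ r * i := by positivity
      linarith
    · exact hω ⟨i - k, by rwa [add_assoc, Nat.add_sub_cancel' hik.le]⟩
  have hmono := measureReal_mono (μ := μ) hsub2 (measure_ne_top _ _)
  linarith

end

section

variable {d : ℕ} {Ω : Type*} {m : MeasurableSpace Ω} {μ : Measure Ω} [IsProbabilityMeasure μ]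
  {ℱ : Filtration ℕ m} {l : EuclideanSpace ℝ (Fin d)} {K h r lam : ℝ}
  {X : ℕ → Ω → (Fin d → ℤ)}

/-! ### The past of a hitting time, and levels that are never revisited from above -/

theorem Hit.unique {a : ℝ} {n n' : ℕ} {ω : Ω} (h1 : Hit l X a n ω) (h2 : Hit l X a n' ω) :
    n = n' := by
  rcases lt_trichotomy n n' with hlt | heq | hlt
  · linarith [h2.1 n hlt, h1.2]
  · exact heq
  · linarith [h1.1 n' hlt, h2.2]

theorem exists_hit {a : ℝ} {n : ℕ} {ω : Ω} (hn : a ≤ height l X n ω) :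
    ∃ n' ≤ n, Hit l X a n' ω := by
  classical
  have hex : ∃ n, a ≤ height l X n ω := ⟨n, hn⟩
  exact ⟨Nat.find hex, Nat.find_min' hex hn, fun j hj => not_le.1 (Nat.find_min hex hj),
    Nat.find_spec hex⟩

theorem height_congr {n : ℕ} {ω ω' : Ω} (h : X n ω = X n ω') :
    height l X n ω = height l X n ω' := by
  unfold height; rw [h]

theorem hit_congr {a : ℝ} {n : ℕ} {ω ω' : Ω} (hj : ∀ j ≤ n, X j ω = X j ω') :
    Hit l X a n ω ↔ Hit l X a n ω' := by
  unfold Hit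
  rw [height_congr (hj n le_rfl)]
  refine and_congr_left fun _ => forall₂_congr fun j hjn => ?_
  rw [height_congr (hj j hjn.le)]

theorem measurableSet_hit (hX : Adapted ℱ X) (a : ℝ) (n : ℕ) :
    MeasurableSet[ℱ n] {ω | Hit l X a n ω} :=
  measurableSet_of_determined hX fun _ _ hj hω => (hit_congr hj).1 hω

/-- The events whose occurrence is known when level `a` is first reached. -/
@[reducible]
def pastSpace (hX : Adapted ℱ X) (l : EuclideanSpace ℝ (Fin d)) (a : ℝ) : MeasurableSpace Ω where
  -- The first clause controls the part of `A` on which level `a` is never reached; the second says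
  -- nothing there.
  MeasurableSet' A := MeasurableSet[m] A ∧ ∀ n, MeasurableSet[ℱ n] (A ∩ {ω | Hit l X a n ω})
  measurableSet_empty := by simp
  measurableSet_compl A hA := by
    refine ⟨hA.1.compl, fun n => ?_⟩
    have : Aᶜ ∩ {ω | Hit l X a n ω} = {ω | Hit l X a n ω} \ (A ∩ {ω | Hit l X a n ω}) := by
      ext ω; simp only [Set.mem_inter_iff, Set.mem_compl_iff, Set.mem_sdiff]; tauto
    rw [this]
    exact (measurableSet_hit hX a n).diff (hA.2 n)
  measurableSet_iUnion f hf := by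
    refine ⟨MeasurableSet.iUnion fun i => (hf i).1, fun n => ?_⟩
    rw [Set.iUnion_inter]
    exact MeasurableSet.iUnion fun i => (hf i).2 n

theorem pastSpace_le (hX : Adapted ℱ X) (a : ℝ) : pastSpace hX l a ≤ m := fun _ hA => hA.1

/-- The walk cannot be at height `b` or more without having reached `a` at that time or before, so
what is known at the first hitting time is known at the second. -/
theorem pastSpace_mono (hX : Adapted ℱ X) {a b : ℝ} (hab : a ≤ b) :
    pastSpace hX l a ≤ pastSpace hX l b := by
  refine fun A hA => ⟨hA.1, fun n => ?_⟩
  have : A ∩ {ω | Hit l X b n ω}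
      = (⋃ j ∈ Finset.range (n + 1), (A ∩ {ω | Hit l X a j ω})) ∩ {ω | Hit l X b n ω} := by
    ext ω
    simp only [Set.mem_inter_iff, Set.mem_iUnion, Finset.mem_range, exists_prop, Set.mem_ofPred_eq]
    constructor
    · rintro ⟨h1, h2⟩
      obtain ⟨j, hj, hit⟩ := exists_hit (hab.trans h2.2)
      exact ⟨⟨j, by omega, h1, hit⟩, h2⟩
    · rintro ⟨⟨j, _, h1, _⟩, h2⟩
      exact ⟨h1, h2⟩
  rw [this]
  refine MeasurableSet.inter (Finset.measurableSet_biUnion _ fun j hj => ?_) (measurableSet_hit hX b n)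
  exact ℱ.mono (by rw [Finset.mem_range] at hj; omega) _ (hA.2 j)

/-- A substitute for the strong Markov property at a hitting time: the possible hitting times split
the event into disjoint pieces, and the bound at each deterministic time is summed. -/
theorem measure_hit_inter_le (hX : Adapted ℱ X) {a c : ℝ} (hc : 0 ≤ c) {A : Set Ω}
    (hA : MeasurableSet[pastSpace hX l a] A) {T : ℕ → Set Ω}
    (hT : ∀ n B, MeasurableSet[ℱ n] B → (∀ ω ∈ B, Hit l X a n ω) →
      μ.real (B ∩ T n) ≤ c * μ.real B) :
    μ.real (A ∩ {ω | ∃ n, Hit l X a n ω ∧ ω ∈ T n}) ≤ c * μ.real A := by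
  have h1 : A ∩ {ω | ∃ n, Hit l X a n ω ∧ ω ∈ T n}
      = ⋃ n, (A ∩ {ω | Hit l X a n ω} ∩ T n) := by
    ext ω
    simp only [Set.mem_inter_iff, Set.mem_iUnion, Set.mem_ofPred_eq]
    constructor
    · rintro ⟨h1, n, h2, h3⟩; exact ⟨n, ⟨h1, h2⟩, h3⟩
    · rintro ⟨n, ⟨h1, h2⟩, h3⟩; exact ⟨h1, n, h2, h3⟩
  rw [h1]
  refine (measureReal_iUnion_le_mul (S := fun n => A ∩ {ω | Hit l X a n ω})
    (fun n => ℱ.le n _ (hA.2 n)) ?_ hc fun n => hT n _ (hA.2 n) fun ω hω => hω.2).trans ?_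
  · intro i j hij
    refine Set.disjoint_left.2 ?_
    rintro ω ⟨_, h1⟩ ⟨_, h2⟩
    exact hij (Hit.unique h1 h2)
  · refine mul_le_mul_of_nonneg_left (measureReal_mono ?_ (measure_ne_top _ _)) hc
    exact Set.iUnion_subset fun n => Set.inter_subset_left

/-- From a freshly reached level, the walk never returns below it with probability at least `p`. -/
def EscapeBound (μ : Measure Ω) (ℱ : Filtration ℕ m) (l : EuclideanSpace ℝ (Fin d))
    (X : ℕ → Ω → (Fin d → ℤ)) (p : ℝ) : Prop :=
  ∀ (n : ℕ) (a : ℝ) (A : Set Ω), MeasurableSet[ℱ n] A → (∀ ω ∈ A, Hit l X a n ω) →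
    μ.real (A ∩ belowSet l X a n) ≤ (1 - p) * μ.real A

/-- The walk reaches level `a` and later goes below it. -/
def fellSet (l : EuclideanSpace ℝ (Fin d)) (X : ℕ → Ω → (Fin d → ℤ)) (a : ℝ) : Set Ω :=
  {ω | ∃ n, Hit l X a n ω ∧ ω ∈ belowSet l X a n}

/-- The walk reaches level `a`, and goes below it before it reaches level `b`. -/
def fellBefore (l : EuclideanSpace ℝ (Fin d)) (X : ℕ → Ω → (Fin d → ℤ)) (a b : ℝ) : Set Ω :=
  {ω | ∃ n i, Hit l X a n ω ∧ height l X (n + i) ω < a ∧ ∀ j ≤ n + i, height l X j ω < b}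

/-- If `b` is first reached at time `k`, the fall must have occurred before `k`, so the path up to
`k` decides the event. -/
theorem measurableSet_fellBefore (hX : Adapted ℱ X) (a b : ℝ) :
    MeasurableSet[pastSpace hX l b] (fellBefore l X a b) := by
  have hd : ∀ n i, MeasurableSet[ℱ (n + i)] {ω | Hit l X a n ω ∧ height l X (n + i) ω < a ∧
      ∀ j ≤ n + i, height l X j ω < b} := by
    intro n i
    refine measurableSet_of_determined hX ?_
    rintro ω ω' hj ⟨h1, h2, h3⟩
    refine ⟨(hit_congr fun j hjn => hj j (by omega)).1 h1, ?_, fun j hjn => ?_⟩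
    · rwa [← height_congr (hj _ le_rfl)]
    · rw [← height_congr (hj j hjn)]; exact h3 j hjn
  constructor
  · have : fellBefore l X a b = ⋃ n, ⋃ i, {ω | Hit l X a n ω ∧ height l X (n + i) ω < a ∧
        ∀ j ≤ n + i, height l X j ω < b} := by
      ext ω; simp [fellBefore]
    rw [this]
    exact MeasurableSet.iUnion fun n => MeasurableSet.iUnion fun i => ℱ.le _ _ (hd n i)
  · intro k
    refine measurableSet_of_determined hX ?_
    rintro ω ω' hj ⟨⟨n, i, h1, h2, h3⟩, h4⟩
    have hk : n + i ≤ k := by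
      by_contra hlt
      linarith [h3 k (by omega), h4.2]
    refine ⟨⟨n, i, (hit_congr fun j hjn => hj j (by omega)).1 h1, ?_, fun j hjn => ?_⟩,
      (hit_congr hj).1 h4⟩
    · rwa [← height_congr (hj _ hk)]
    · rw [← height_congr (hj j (by omega))]; exact h3 j hjn

/-- Among `J` successive levels it is unlikely that the walk falls below each of them after having
reached it. -/
theorem IsGeneralizedExcitedRandomWalk.measure_all_fell_le
    (hX : IsGeneralizedExcitedRandomWalk μ ℱ l K h r lam X) (hK : 0 < K) (hl : ‖l‖ = 1)
    {p ε : ℝ} {q t₀ : ℕ} (hp1 : p < 1) (hε : 0 < ε) (hq : 2 ≤ q)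
    (hE : EscapeBound μ ℱ l X p) (hF : FallBound μ ℱ l X ε q t₀)
    {a δ : ℝ} {w : ℕ} (hw : 1 ≤ w) (hwt : t₀ ≤ w) (hδ : K * w ≤ δ) (J : ℕ) {A : Set Ω}
    (hA : MeasurableSet[pastSpace hX.adapted l a] A) :
    μ.real (A ∩ {ω | ∀ i < J, ω ∈ fellSet l X (a + i * δ)})
      ≤ ((1 - p) ^ J + J * (2 * ((w : ℝ) ^ (q - 1))⁻¹)) * μ.real A := by
  have hδ0 : 0 ≤ δ := le_trans (by positivity) hδ
  set lv : ℕ → ℝ := fun i => a + i * δ with hlv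
  have hlv0 : ∀ i, a ≤ lv i := fun i => by simp only [hlv]; linarith [mul_nonneg i.cast_nonneg hδ0]
  -- Falling below a level before the next one is reached is known when the next one is reached.
  -- These falls are therefore successive trials, each costing a factor `1 - p`.
  set G : ℕ → Set Ω := fun J => A ∩ {ω | ∀ i < J, ω ∈ fellBefore l X (lv i) (lv (i + 1))} with hG
  have hGm : ∀ J, MeasurableSet[pastSpace hX.adapted l (lv J)] (G J) ∧
      μ.real (G J) ≤ (1 - p) ^ J * μ.real A := by
    intro J
    induction J with
    | zero =>
      have h0 : lv 0 = a := by simp [hlv]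
      have h1 : G 0 = A := by simp [hG]
      rw [h0, h1, pow_zero, one_mul]
      exact ⟨hA, le_rfl⟩
    | succ J ih =>
      have heq : G (J + 1) = G J ∩ fellBefore l X (lv J) (lv (J + 1)) := by
        ext ω
        simp only [hG, Set.mem_inter_iff, Set.mem_ofPred_eq, Nat.lt_succ_iff_lt_or_eq]
        constructor
        · rintro ⟨h1, h2⟩; exact ⟨⟨h1, fun i hi => h2 i (Or.inl hi)⟩, h2 J (Or.inr rfl)⟩
        · rintro ⟨⟨h1, h2⟩, h3⟩
          refine ⟨h1, fun i hi => ?_⟩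
          rcases hi with hi | rfl
          · exact h2 i hi
          · exact h3
      have hle : lv J ≤ lv (J + 1) := by simp only [hlv]; push_cast; linarith
      rw [heq]
      refine ⟨(pastSpace_mono hX.adapted hle _ ih.1).inter
        (measurableSet_fellBefore hX.adapted _ _), ?_⟩
      have hsub : G J ∩ fellBefore l X (lv J) (lv (J + 1))
          ⊆ G J ∩ {ω | ∃ n, Hit l X (lv J) n ω ∧ ω ∈ belowSet l X (lv J) n} := by
        rintro ω ⟨h1, n, i, h2, h3, _⟩
        exact ⟨h1, n, h2, i, h3⟩
      calc _ ≤ _ := measureReal_mono hsub (measure_ne_top _ _)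
        _ ≤ (1 - p) * μ.real (G J) := measure_hit_inter_le hX.adapted (by linarith) ih.1
            fun n B hB hBh => hE n _ B hB hBh
        _ ≤ (1 - p) * ((1 - p) ^ J * μ.real A) := by
            have := ih.2
            have : 0 ≤ 1 - p := by linarith
            gcongr
        _ = _ := by ring
  -- A fall below a level after the next one was reached means a descent of more than `δ ≥ K * w`,
  -- which takes at least `w` steps. It is thus a late fall, and at the hitting time no site above
  -- the level has been visited.
  set Q : ℕ → Set Ω := fun i => A ∩ {ω | ∃ n, Hit l X (lv i) n ω ∧
    ω ∈ {ω | ∃ t ≥ w, ω ∈ fallSet l X (lv i) n t}} with hQ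
  have hQle : ∀ i, μ.real (Q i) ≤ 2 * ((w : ℝ) ^ (q - 1))⁻¹ * μ.real A := by
    intro i
    refine measure_hit_inter_le hX.adapted (by positivity)
      (pastSpace_mono hX.adapted (hlv0 i) _ hA) fun n B hB hBh => ?_
    refine hF.measure_late_le hε hq hB hw hwt (fun ω hω => (hBh ω hω).2) fun ω hω => ?_
    have := priorCount_le_of_hit (hBh ω hω) 0
    rw [add_zero] at this
    have h0 : priorCount l X (lv i) n ω = 0 := by omega
    rw [h0, Nat.cast_zero]
    positivity
  have hmain : ∀ᵐ ω ∂μ, ω ∈ A ∩ {ω | ∀ i < J, ω ∈ fellSet l X (lv i)} →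
      ω ∈ G J ∪ ⋃ i ∈ Finset.range J, Q i := by
    filter_upwards [hX.ae_height_sub_le hl] with ω hω
    rintro ⟨hωA, hfell⟩
    by_contra hnot
    simp only [Set.mem_union, not_or, Set.mem_iUnion, Finset.mem_range, exists_prop, not_exists,
      not_and] at hnot
    apply hnot.1
    refine ⟨hωA, fun i hi => ?_⟩
    obtain ⟨n, hn, i', hi'⟩ := hfell i hi
    obtain ⟨t, -, ht⟩ := exists_mem_fallSet hi'
    have hlate := hnot.2 i hi
    by_cases hbef : ∀ j ≤ n + t, height l X j ω < lv (i + 1)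
    · exact ⟨n, t, hn, ht.2, hbef⟩
    · exfalso
      push Not at hbef
      obtain ⟨j, hj, hjl⟩ := hbef
      have hle : lv (i + 1) = lv i + δ := by simp only [hlv]; push_cast; ring
      have hnj : n ≤ j := by
        by_contra hlt
        linarith [hn.1 j (not_le.1 hlt)]
      refine hlate ⟨hωA, n, hn, t, ?_, ht⟩
      have h1 := hω j (n + t - j)
      rw [Nat.add_sub_cancel' hj] at h1
      have h2 := (abs_le.1 h1).1
      have h3 : K * (w : ℝ) ≤ K * ((n + t - j : ℕ) : ℝ) := by linarith [ht.2]
      have h4 : (w : ℝ) ≤ ((n + t - j : ℕ) : ℝ) := le_of_mul_le_mul_left h3 hK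
      have h5 : w ≤ n + t - j := by exact_mod_cast h4
      show w ≤ t
      omega
  calc _ ≤ μ.real (G J ∪ ⋃ i ∈ Finset.range J, Q i) := measureReal_mono_ae hmain
    _ ≤ μ.real (G J) + ∑ i ∈ Finset.range J, μ.real (Q i) :=
        (measureReal_union_le _ _).trans (by
          gcongr
          exact measureReal_biUnion_finset_le _ _)
    _ ≤ (1 - p) ^ J * μ.real A + ∑ _i ∈ Finset.range J, 2 * ((w : ℝ) ^ (q - 1))⁻¹ * μ.real A := by
        gcongr with i hi
        · exact (hGm J).2
        · exact hQle i
    _ = _ := by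
        rw [Finset.sum_const, Finset.card_range, nsmul_eq_mul]; ring

/-! ### Leaving a strip -/

theorem IsGeneralizedExcitedRandomWalk.ae_abs_height_le
    (hX : IsGeneralizedExcitedRandomWalk μ ℱ l K h r lam X) (hl : ‖l‖ = 1) :
    ∀ᵐ ω ∂μ, ∀ n, |height l X n ω| ≤ K * n := by
  filter_upwards [hX.ae_norm_le] with ω hω n
  refine (abs_real_inner_le_norm _ _).trans ?_
  rw [hl, mul_one]
  exact hω n

/-- The drift in direction `l` is never negative, so above `a` the cross term of the square helps.
The squared jump contributes `h r²`, since the jump exceeds `r` with conditional probability at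
least `h`. -/
theorem IsGeneralizedExcitedRandomWalk.condExp_sq_height
    (hX : IsGeneralizedExcitedRandomWalk μ ℱ l K h r lam X) (hl : ‖l‖ = 1) (hr : 0 < r)
    (hlam : 0 < lam) (a : ℝ) (n : ℕ) :
    ∀ᵐ ω ∂μ, a ≤ height l X n ω → (height l X n ω - a) ^ 2 + h * r ^ 2
      ≤ (μ[fun ω => (height l X (n + 1) ω - a) ^ 2 | ℱ n]) ω := by
  have hHm : ∀ n, Measurable[ℱ n] (height l X n) := measurable_height hX.adapted
  have hbd : ∀ n, ∀ᵐ ω ∂μ, ‖height l X n ω - a‖ ≤ K * n + |a| := fun n => by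
    filter_upwards [hX.ae_abs_height_le hl] with ω hω
    exact (abs_sub _ _).trans (by linarith [hω n])
  have hsq : ∀ n, Integrable (fun ω => (height l X n ω - a) ^ 2) μ := by
    intro n
    refine Integrable.of_bound ((((hHm n).mono (ℱ.le n) le_rfl).sub_const a).pow_const
      2).aestronglyMeasurable ((K * n + |a|) ^ 2) ?_
    filter_upwards [hbd n] with ω hω
    rw [norm_pow]
    gcongr
  set J : Set Ω := {ω | r < inner ℝ (jump X n ω) l} with hJ
  have hJm : MeasurableSet J := measurableSet_lt measurable_const
    ((measurable_jump hX.adapted n).inner_const)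
  set f₀ : Ω → ℝ := fun ω => (height l X n ω - a) ^ 2 with hf₀
  set f₁ : Ω → ℝ := fun ω => inner ℝ l (jump X n ω) with hf₁
  set f₂ : Ω → ℝ := J.indicator (fun _ => (1 : ℝ)) with hf₂
  set g : Ω → ℝ := fun ω => height l X n ω - a with hg
  have hgm : StronglyMeasurable[ℱ n] g := ((hHm n).sub_const a).stronglyMeasurable
  have hf₀m : StronglyMeasurable[ℱ n] f₀ := (((hHm n).sub_const a).pow_const 2).stronglyMeasurable
  have hi₁ : Integrable f₁ μ := hX.integrable_inner l n
  have hi₂ : Integrable f₂ μ := (integrable_const 1).indicator hJm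
  have hg₁ : Integrable (g * f₁) μ :=
    hi₁.bdd_mul (hgm.mono (ℱ.le n)).aestronglyMeasurable (hbd n)
  have hce : μ[g * f₁ | ℱ n] =ᵐ[μ] g * μ[f₁ | ℱ n] :=
    condExp_stronglyMeasurable_mul_of_bound₀ (ℱ.le n) hgm.aestronglyMeasurable hi₁ _ (hbd n)
  set G : Ω → ℝ := f₀ + ((2 : ℝ) • (g * f₁) + (r ^ 2) • f₂) with hG
  have hGint : Integrable G μ := (hsq n).add ((hg₁.smul _).add (hi₂.smul _))
  have hle : G ≤ᵐ[μ] fun ω => (height l X (n + 1) ω - a) ^ 2 := by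
    refine ae_of_all _ fun ω => ?_
    have h3 : height l X (n + 1) ω = height l X n ω + f₁ ω := by
      simp only [hf₁, height, jump]
      rw [inner_sub_right, real_inner_comm l, real_inner_comm l]; ring
    show f₀ ω + (2 * (g ω * f₁ ω) + r ^ 2 * f₂ ω) ≤ (height l X (n + 1) ω - a) ^ 2
    have h5 : r ^ 2 * f₂ ω ≤ f₁ ω ^ 2 := by
      simp only [hf₂, Set.indicator_apply]
      split_ifs with hωJ
      · rw [mul_one]
        have : r < f₁ ω := by simp only [hf₁]; rw [real_inner_comm]; exact hωJ
        gcongr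
      · rw [mul_zero]; positivity
    rw [h3]
    have : (height l X n ω + f₁ ω - a) ^ 2 = f₀ ω + 2 * (g ω * f₁ ω) + f₁ ω ^ 2 := by
      simp only [hf₀, hg]; ring
    linarith
  have h1 := condExp_add (m := ℱ n) (hsq n) ((hg₁.smul (2 : ℝ)).add (hi₂.smul (r ^ 2)))
  have h2 := condExp_add (m := ℱ n) (hg₁.smul (2 : ℝ)) (hi₂.smul (r ^ 2))
  have h3 := condExp_smul (μ := μ) (2 : ℝ) (g * f₁) (ℱ n)
  have h4 := condExp_smul (μ := μ) (r ^ 2) f₂ (ℱ n)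
  have h5 : μ[f₀ | ℱ n] = f₀ := condExp_of_stronglyMeasurable (ℱ.le n) hf₀m (hsq n)
  filter_upwards [condExp_mono (m := ℱ n) hGint (hsq (n + 1)) hle, h1, h2, h3, h4, hce,
    (hX.condE n).1, hX.condExp_inner_new n, hX.condExp_inner_revisit l n]
    with ω g0 g1 g2 g3 g4 g5 g6 g7 g8 ha
  refine le_trans ?_ g0
  have e1 : (μ[G | ℱ n]) ω = f₀ ω + (2 * (g ω * (μ[f₁ | ℱ n]) ω) + r ^ 2 * (μ[f₂ | ℱ n]) ω) := by
    refine g1.trans ?_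
    rw [Pi.add_apply]
    refine congrArg₂ _ (congrFun h5 ω) ?_
    rw [g2, Pi.add_apply, g3, g4, Pi.smul_apply, Pi.smul_apply, g5]
    rfl
  rw [e1]
  have e2 : h ≤ (μ[f₂ | ℱ n]) ω := g6
  have e3 : 0 ≤ (μ[f₁ | ℱ n]) ω := by
    by_cases hrev : Revisits X n ω
    · exact (g8 hrev).ge
    · exact hlam.le.trans (g7 hrev)
  have e4 : 0 ≤ g ω := sub_nonneg.2 ha
  have e5 := mul_nonneg e4 e3
  have e6 := mul_le_mul_of_nonneg_left e2 (sq_nonneg r)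
  have e7 : f₀ ω = (height l X n ω - a) ^ 2 := rfl
  linarith

/-- The visit-count estimate with every step counted as a visit and `U = (b - a + K)² - (height -
a)²`; the extra `K` keeps `U` nonnegative at the step that leaves the strip. -/
theorem IsGeneralizedExcitedRandomWalk.measure_strip_le
    (hX : IsGeneralizedExcitedRandomWalk μ ℱ l K h r lam X) (hl : ‖l‖ = 1) (hK : 0 < K)
    (hh : 0 < h) (hr : 0 < r) (hlam : 0 < lam) {a b : ℝ} (hab : a ≤ b) {n : ℕ} {A : Set Ω}
    (hA : MeasurableSet[ℱ n] A) {N : ℕ} (hN : 0 < N) :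
    μ.real (A ∩ {ω | ∀ j < N, a ≤ height l X (n + j) ω ∧ height l X (n + j) ω < b})
      ≤ 2 * Real.exp (-(h * r ^ 2 * N / (2 * (b - a + K) ^ 2))) * μ.real A := by
  classical
  have hB : 0 < (b - a + K) ^ 2 := by
    have : 0 < b - a + K := by linarith
    positivity
  set act : ℕ → Set Ω := fun j => {ω | a ≤ height l X (n + j) ω ∧ height l X (n + j) ω < b}
    with hact
  have hactm : ∀ j, MeasurableSet[ℱ (n + j)] (act j) := fun j =>
    measurableSet_of_determined hX.adapted fun ω ω' hj hω => by
      rwa [← height_congr (hj _ le_rfl)]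
  set A' := A ∩ act 0 with hA'
  have hA'm : MeasurableSet[ℱ n] A' := hA.inter (hactm 0)
  have hbd : ∀ i, ∀ᵐ ω ∂μ, ‖(height l X (n + i) ω - a) ^ 2‖ ≤ (K * (n + i : ℕ) + |a|) ^ 2 := by
    intro i
    filter_upwards [hX.ae_abs_height_le hl] with ω hω
    rw [norm_pow]
    gcongr
    exact (abs_sub _ _).trans (by linarith [hω (n + i)])
  have hint : ∀ i, Integrable (fun ω => (height l X (n + i) ω - a) ^ 2) μ := fun i =>
    Integrable.of_bound (((((measurable_height hX.adapted (n + i)).mono (ℱ.le _)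
      le_rfl).sub_const a).pow_const 2).aestronglyMeasurable) _ (hbd i)
  have key := measure_visitCount_ge_le (μ := μ) hA'm
    (U := fun i ω => (b - a + K) ^ 2 - (height l X (n + i) ω - a) ^ 2) (act := act)
    (vis := fun _ => Set.univ) hB (show 0 < h * r ^ 2 by positivity)
    (fun i => (integrable_const _).sub (hint i)) hactm (fun i => MeasurableSet.univ)
    (fun i => ?_) (fun i ω => ?_) (fun i => ?_) N (N : ℝ)
  · refine le_trans (measureReal_mono ?_ (measure_ne_top _ _)) (key.trans ?_)
    · rintro ω ⟨hωA, hω⟩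
      refine ⟨⟨hωA, hω 0 hN⟩, hω, ?_⟩
      simp [visitCount]
    · gcongr
      · exact measure_ne_top _ _
      · exact Set.inter_subset_left
  · filter_upwards [hX.ae_height_sub_le hl] with ω hω hωA hj
    have : |height l X (n + i) ω - a| ≤ b - a + K := by
      cases i with
      | zero =>
        have h1 : a ≤ height l X (n + 0) ω ∧ height l X (n + 0) ω < b := hωA.2
        rw [abs_le]; constructor <;> linarith [h1.1, h1.2]
      | succ i =>
        obtain ⟨h1, h2⟩ : a ≤ height l X (n + i) ω ∧ height l X (n + i) ω < b := hj i (Nat.lt_succ_self i)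
        have h3 := abs_le.1 (hω (n + i) 1)
        rw [Nat.cast_one, mul_one] at h3
        have h4 : n + (i + 1) = n + i + 1 := rfl
        rw [h4, abs_le]; constructor <;> linarith [h3.1, h3.2]
    have h2 : (height l X (n + i) ω - a) ^ 2 ≤ (b - a + K) ^ 2 := by
      rw [← sq_abs]; gcongr
    linarith
  · linarith [sq_nonneg (height l X (n + i) ω - a)]
  · have hce := condExp_sub (m := ℱ (n + i)) (integrable_const ((b - a + K) ^ 2)) (hint (i + 1))
    have hcc : μ[fun _ : Ω => (b - a + K) ^ 2 | ℱ (n + i)] = fun _ => (b - a + K) ^ 2 :=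
      condExp_const (ℱ.le _) _
    filter_upwards [hce, hX.condExp_sq_height hl hr hlam a (n + i)] with ω g1 g2 _ hj
    have g3 := g2 (hj i le_rfl).1
    have g4 : (μ[fun ω => (b - a + K) ^ 2 - (height l X (n + (i + 1)) ω - a) ^ 2 | ℱ (n + i)]) ω
        = (b - a + K) ^ 2 - (μ[fun ω => (height l X (n + i + 1) ω - a) ^ 2 | ℱ (n + i)]) ω := by
      refine g1.trans ?_
      rw [Pi.sub_apply]
      congr 1
      exact congrFun hcc ω
    rw [g4, Set.indicator_of_mem (Set.mem_univ _)]
    linarith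

end

section

variable {d : ℕ} {Ω : Type*} {m : MeasurableSpace Ω} {μ : Measure Ω} [IsProbabilityMeasure μ]
  {ℱ : Filtration ℕ m} {l : EuclideanSpace ℝ (Fin d)} {K h r lam : ℝ}
  {X : ℕ → Ω → (Fin d → ℤ)}

/-! ### The time spent in a slab -/

/-- The walk falls below each of the levels `a + i δ`, `i < J`, after having reached it. -/
def allFell (l : EuclideanSpace ℝ (Fin d)) (X : ℕ → Ω → (Fin d → ℤ)) (a δ : ℝ) (J : ℕ) : Set Ω :=
  {ω | ∀ i < J, ω ∈ fellSet l X (a + i * δ)}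

/-- If not all levels between `a` and `a + J δ` are fallen below, then the walk stays above `a`
once it has reached `a + J δ`. -/
theorem le_height_of_notMem_allFell {a δ : ℝ} {J n n' : ℕ} {ω : Ω} (hδ : 0 ≤ δ)
    (hω : ω ∉ allFell l X a δ J) (hn : a + J * δ ≤ height l X n ω) (hnn' : n ≤ n') :
    a ≤ height l X n' ω := by
  simp only [allFell, Set.mem_ofPred_eq, not_forall] at hω
  obtain ⟨i, hi, hfell⟩ := hω
  have hiJ : (i : ℝ) ≤ J := by exact_mod_cast hi.le
  have h1 : a + i * δ ≤ height l X n ω := by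
    have := mul_le_mul_of_nonneg_right hiJ hδ
    linarith
  obtain ⟨n₀, hn₀, hit⟩ := exists_hit h1
  have h2 : 0 ≤ i * δ := by positivity
  by_contra hlt
  refine hfell ⟨n₀, hit, n' - n₀, ?_⟩
  rw [Nat.add_sub_cancel' (hn₀.trans hnn')]
  linarith [not_le.1 hlt]

open Classical in
/-- The times before `n` spent in the slab of heights `[k, k + 1)`. -/
def slabTimes (l : EuclideanSpace ℝ (Fin d)) (X : ℕ → Ω → (Fin d → ℤ)) (n : ℕ) (k : ℝ) (ω : Ω) :
    Finset ℕ :=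
  (Finset.range n).filter fun t => k ≤ height l X t ω ∧ height l X t ω < k + 1

open Classical in
/-- The times before `n` spent in the slab of heights `[k, k + 1)` before reaching `k + 1 + u`. -/
def slabTimesBefore (l : EuclideanSpace ℝ (Fin d)) (X : ℕ → Ω → (Fin d → ℤ)) (n : ℕ) (k u : ℝ)
    (ω : Ω) : Finset ℕ :=
  (slabTimes l X n k ω).filter fun t => ∀ j ≤ t, height l X j ω < k + 1 + u

/-- The walk spends the first `N` steps after reaching level `k` in the strip `[a, b)`. -/
def staySet (l : EuclideanSpace ℝ (Fin d)) (X : ℕ → Ω → (Fin d → ℤ)) (k a b : ℝ) (N : ℕ) : Set Ω :=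
  {ω | ∃ n, Hit l X k n ω ∧ ∀ j < N, a ≤ height l X (n + j) ω ∧ height l X (n + j) ω < b}

/-- The exceptional event on which the walk may spend a time of order `w ^ 6` in a slab. -/
def badSlab (l : EuclideanSpace ℝ (Fin d)) (X : ℕ → Ω → (Fin d → ℤ)) (κ w : ℕ) (k : ℝ) : Set Ω :=
  allFell l X (k - κ * w ^ 2) (κ * w) w ∪ allFell l X (k + 1) (κ * w) w ∪
    staySet l X k (k - κ * w ^ 2) (k + 1 + κ * w ^ 2) (w ^ 6)

/-- Off the second family of falls, a walk that has reached `k + 1 + κ w²` stays above `k + 1`, so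
it spends no more time in the slab. The height is `w` levels at distance `κ w`. -/
theorem slabTimesBefore_eq {κ w n : ℕ} {k : ℝ} {ω : Ω} (hω : ω ∉ badSlab l X κ w k) :
    slabTimesBefore l X n k (κ * w ^ 2) ω = slabTimes l X n k ω := by
  simp only [badSlab, Set.mem_union, not_or] at hω
  obtain ⟨⟨-, h2⟩, -⟩ := hω
  refine Finset.filter_true_of_mem fun t ht j hj => ?_
  have ht' := (Finset.mem_filter.1 ht).2
  by_contra hge
  have := le_height_of_notMem_allFell (by positivity) h2 (n := j) (n' := t)
    (le_trans (le_of_eq (by ring)) (not_lt.1 hge)) hj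
  linarith [ht'.2]

/-- All slab times lie between the first passage at `k` and the last slab time. Outside the two
families of falls the walk stays in the surrounding strip during this interval, and a stay of `w ^
6` steps there is excluded. -/
theorem card_slabTimes_lt {κ w n : ℕ} {k : ℝ} {ω : Ω} (hw : 1 ≤ w) (hω : ω ∉ badSlab l X κ w k) :
    (slabTimes l X n k ω).card < w ^ 6 := by
  have heq := slabTimesBefore_eq (n := n) hω
  simp only [badSlab, Set.mem_union, not_or] at hω
  obtain ⟨⟨h1, -⟩, h3⟩ := hω
  by_contra hge
  rw [not_lt] at hge
  set S := slabTimes l X n k ω with hS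
  have hne : S.Nonempty := Finset.card_pos.1 (lt_of_lt_of_le (by positivity) hge)
  set t := S.max' hne with ht
  have htS : t ∈ S := S.max'_mem hne
  have htk := (Finset.mem_filter.1 htS).2
  obtain ⟨n₀, hn₀, hit⟩ := exists_hit htk.1
  have hsub : S ⊆ Finset.Icc n₀ t := by
    intro j hj
    rw [Finset.mem_Icc]
    refine ⟨?_, S.le_max' j hj⟩
    by_contra hlt
    have := (Finset.mem_filter.1 hj).2.1
    linarith [hit.1 j (not_le.1 hlt)]
  have hcard := Finset.card_le_card hsub
  rw [Nat.card_Icc] at hcard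
  refine h3 ⟨n₀, hit, fun j hj => ⟨?_, ?_⟩⟩
  · refine le_height_of_notMem_allFell (by positivity) h1 (n := n₀) ?_ (by omega)
    exact le_trans (le_of_eq (by ring)) hit.2
  · rw [← heq] at htS
    exact (Finset.mem_filter.1 htS).2 (n₀ + j) (by omega)

/-- The power `s + 2` leaves two powers of `w` to spare: one pays for the `w` levels, the other for
the numerical constants. -/
theorem eventually_slab_bound {p c : ℝ} (hp0 : 0 < p) (hp1 : p < 1) (hc : 0 < c) (s : ℕ) :
    ∀ᶠ w : ℕ in atTop, 2 * ((1 - p) ^ w + w * (2 * ((w : ℝ) ^ (s + 3 - 1))⁻¹))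
      + 2 * Real.exp (-(c * w ^ 2)) ≤ ((w : ℝ) ^ s)⁻¹ := by
  have h1 := tendsto_pow_const_mul_const_pow_of_abs_lt_one s (r := 1 - p)
    (by rw [abs_lt]; constructor <;> linarith)
  have h2 := tendsto_pow_const_mul_const_pow_of_abs_lt_one s (r := Real.exp (-c))
    (by rw [abs_of_pos (Real.exp_pos _)]; rw [Real.exp_lt_one_iff]; linarith)
  filter_upwards [h1.eventually (gt_mem_nhds (by norm_num : (0 : ℝ) < 1 / 8)),
    h2.eventually (gt_mem_nhds (by norm_num : (0 : ℝ) < 1 / 8)), eventually_ge_atTop 8]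
    with w g1 g2 hw
  have hw8 : (8 : ℝ) ≤ w := by exact_mod_cast hw
  have hw0 : (0 : ℝ) < w := by linarith
  have hs : 0 < (w : ℝ) ^ s := by positivity
  rw [← one_div ((w : ℝ) ^ s), le_div_iff₀ hs]
  have e1 : (w : ℝ) * (2 * ((w : ℝ) ^ (s + 3 - 1))⁻¹) * w ^ s = 2 / w := by
    have : s + 3 - 1 = s + 2 := by omega
    rw [this, pow_add]
    field_simp
  have e2 : 2 / (w : ℝ) ≤ 1 / 4 := by rw [div_le_div_iff₀ hw0 (by norm_num)]; linarith
  have e3 : Real.exp (-(c * w ^ 2)) ≤ Real.exp (-c) ^ w := by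
    rw [← Real.exp_nat_mul]
    apply Real.exp_le_exp.2
    have : (w : ℝ) * 1 ≤ w * w := by gcongr; linarith
    have := mul_le_mul_of_nonneg_left this hc.le
    linarith
  have e4 := mul_le_mul_of_nonneg_left e3 hs.le
  calc _ = 2 * ((w : ℝ) ^ s * (1 - p) ^ w) + 2 * ((w : ℝ) * (2 * ((w : ℝ) ^ (s + 3 - 1))⁻¹) * w ^ s)
        + 2 * ((w : ℝ) ^ s * Real.exp (-(c * w ^ 2))) := by ring
    _ ≤ 1 := by rw [e1]; linarith

/-- The strip has width of order `w²`, so its squared width is of order `w⁴` and staying `w ^ 6`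
steps costs `exp (-c w²)`. All events are conditioned on the past at the lowest level involved. -/
theorem IsGeneralizedExcitedRandomWalk.measure_badSlab_le
    (hX : IsGeneralizedExcitedRandomWalk μ ℱ l K h r lam X) (hl : ‖l‖ = 1) (hK : 0 < K)
    (hh : 0 < h) (hr : 0 < r) (hlam : 0 < lam) {p ε : ℝ} {s t₀ : ℕ} (hp1 : p < 1) (hε : 0 < ε)
    (hE : EscapeBound μ ℱ l X p) (hF : FallBound μ ℱ l X ε (s + 3) t₀) {κ w : ℕ} (hκ : K ≤ κ)
    (hw : 1 ≤ w) (hwt : t₀ ≤ w)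
    (hnum : 2 * ((1 - p) ^ w + w * (2 * ((w : ℝ) ^ (s + 3 - 1))⁻¹))
      + 2 * Real.exp (-(h * r ^ 2 / (2 * (2 * κ + 1 + K) ^ 2) * w ^ 2)) ≤ ((w : ℝ) ^ s)⁻¹)
    {k : ℝ} {A : Set Ω} (hA : MeasurableSet[pastSpace hX.adapted l (k - κ * w ^ 2)] A) :
    μ.real (A ∩ allFell l X (k - κ * w ^ 2) (κ * w) w) ≤ ((w : ℝ) ^ s)⁻¹ * μ.real A ∧
    μ.real (A ∩ badSlab l X κ w k) ≤ ((w : ℝ) ^ s)⁻¹ * μ.real A := by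
  have hw1 : (1 : ℝ) ≤ w := by exact_mod_cast hw
  have hδ : K * w ≤ κ * (w : ℝ) := by gcongr
  have hp0 : 0 ≤ (1 - p) ^ w := pow_nonneg (by linarith) _
  have hu : (0 : ℝ) ≤ κ * w ^ 2 := by positivity
  have b1 := hX.measure_all_fell_le hK hl hp1 hε (by omega) hE hF hw hwt hδ w hA
  have b2 := hX.measure_all_fell_le hK hl hp1 hε (by omega) hE hF hw hwt hδ w
    (pastSpace_mono hX.adapted (show k - κ * w ^ 2 ≤ k + 1 by linarith) _ hA)
  have b3 : μ.real (A ∩ staySet l X k (k - κ * w ^ 2) (k + 1 + κ * w ^ 2) (w ^ 6))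
      ≤ 2 * Real.exp (-(h * r ^ 2 / (2 * (2 * κ + 1 + K) ^ 2) * w ^ 2)) * μ.real A := by
    refine measure_hit_inter_le hX.adapted (by positivity)
      (pastSpace_mono hX.adapted (show k - κ * w ^ 2 ≤ k by linarith) _ hA)
      (T := fun n => {ω | ∀ j < w ^ 6, k - κ * w ^ 2 ≤ height l X (n + j) ω ∧
        height l X (n + j) ω < k + 1 + κ * w ^ 2}) fun n B hB _ => ?_
    refine (hX.measure_strip_le hl hK hh hr hlam (a := k - κ * w ^ 2) (b := k + 1 + κ * w ^ 2)
      (by linarith) hB (N := w ^ 6) (by positivity)).trans ?_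
    refine mul_le_mul_of_nonneg_right ?_ measureReal_nonneg
    refine mul_le_mul_of_nonneg_left (Real.exp_le_exp.2 (neg_le_neg ?_)) zero_le_two
    have e1 : k + 1 + κ * (w : ℝ) ^ 2 - (k - κ * w ^ 2) + K ≤ (2 * κ + 1 + K) * w ^ 2 := by
      have : (1 : ℝ) ≤ (w : ℝ) ^ 2 := one_le_pow₀ hw1
      have h3 : K * 1 ≤ K * (w : ℝ) ^ 2 := by gcongr
      linarith
    have e0 : 0 < k + 1 + κ * (w : ℝ) ^ 2 - (k - κ * w ^ 2) + K := by linarith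
    have e2 : h * r ^ 2 / (2 * (2 * κ + 1 + K) ^ 2) * w ^ 2
        = h * r ^ 2 * (w : ℝ) ^ 6 / (2 * ((2 * κ + 1 + K) * w ^ 2) ^ 2) := by
      have : (0 : ℝ) < w := by linarith
      have : (0 : ℝ) < 2 * κ + 1 + K := by positivity
      field_simp
    rw [e2]
    push_cast
    gcongr
  have hsum : μ.real (A ∩ badSlab l X κ w k) ≤
      (2 * ((1 - p) ^ w + w * (2 * ((w : ℝ) ^ (s + 3 - 1))⁻¹))
        + 2 * Real.exp (-(h * r ^ 2 / (2 * (2 * κ + 1 + K) ^ 2) * w ^ 2))) * μ.real A := by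
    have : A ∩ badSlab l X κ w k = (A ∩ allFell l X (k - κ * w ^ 2) (κ * w) w)
        ∪ (A ∩ allFell l X (k + 1) (κ * w) w)
        ∪ (A ∩ staySet l X k (k - κ * w ^ 2) (k + 1 + κ * w ^ 2) (w ^ 6)) := by
      rw [badSlab, Set.inter_union_distrib_left, Set.inter_union_distrib_left]
    rw [this]
    refine (measureReal_union_le _ _).trans ((add_le_add (measureReal_union_le _ _) b3).trans ?_)
    refine (add_le_add (add_le_add b1 b2) le_rfl).trans (le_of_eq ?_)
    ring
  refine ⟨b1.trans ?_, hsum.trans (by gcongr)⟩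
  refine mul_le_mul_of_nonneg_right (le_trans ?_ hnum) measureReal_nonneg
  have : (0 : ℝ) ≤ w * (2 * ((w : ℝ) ^ (s + 3 - 1))⁻¹) := by positivity
  have := Real.exp_pos (-(h * r ^ 2 / (2 * (2 * κ + 1 + K) ^ 2) * w ^ 2))
  linarith

/-- The truncated number of visits to a slab. -/
def slabCount (l : EuclideanSpace ℝ (Fin d)) (X : ℕ → Ω → (Fin d → ℤ)) (κ w n : ℕ) (k : ℝ)
    (ω : Ω) : ℕ :=
  min (w ^ 6) (slabTimesBefore l X n k (κ * w ^ 2) ω).card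

theorem slabCount_le (κ w n : ℕ) (k : ℝ) (ω : Ω) : slabCount l X κ w n k ω ≤ w ^ 6 :=
  min_le_left _ _

theorem slabCount_eq {κ w n : ℕ} {k : ℝ} {ω : Ω} (hw : 1 ≤ w) (hω : ω ∉ badSlab l X κ w k) :
    slabCount l X κ w n k ω = (slabTimes l X n k ω).card := by
  rw [slabCount, slabTimesBefore_eq hω, min_eq_right (card_slabTimes_lt hw hω).le]

/-- Only times before reaching `k + 1 + κ w²` are counted, so the count is known once that level is
reached; in any case it is determined by the path up to time `n`. -/
theorem measurable_slabCount (hX : Adapted ℱ X) (κ w n : ℕ) (k : ℝ) :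
    Measurable[pastSpace hX l (k + 1 + κ * w ^ 2)] (slabCount l X κ w n k) := by
  classical
  have hdet : ∀ N : ℕ, ∀ ω ω' : Ω, (∀ j ≤ N, X j ω = X j ω') →
      ((∀ t < n, t ≤ N) ∨ Hit l X (k + 1 + κ * w ^ 2) N ω) →
      slabTimesBefore l X n k (κ * w ^ 2) ω = slabTimesBefore l X n k (κ * w ^ 2) ω' := by
    intro N ω ω' hj hN
    have hN' : (∀ t < n, t ≤ N) ∨ (Hit l X (k + 1 + κ * w ^ 2) N ω ∧
        Hit l X (k + 1 + κ * w ^ 2) N ω') := by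
      rcases hN with hN | hN
      · exact Or.inl hN
      · exact Or.inr ⟨hN, (hit_congr hj).1 hN⟩
    ext t
    simp only [slabTimesBefore, slabTimes, Finset.mem_filter, Finset.mem_range]
    by_cases htN : t ≤ N
    · rw [height_congr (hj t htN)]
      refine and_congr_right fun _ => forall₂_congr fun j hjt => ?_
      rw [height_congr (hj j (hjt.trans htN))]
    · constructor
      · rintro ⟨⟨h1, h2⟩, h3⟩
        rcases hN' with h4 | ⟨h4, _⟩
        · exact absurd (h4 t h1) htN
        · linarith [h3 N (by omega), h4.2]
      · rintro ⟨⟨h1, h2⟩, h3⟩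
        rcases hN' with h4 | ⟨_, h4⟩
        · exact absurd (h4 t h1) htN
        · linarith [h3 N (by omega), h4.2]
  refine @measurable_to_countable' _ _ _ _ (pastSpace hX l (k + 1 + κ * w ^ 2)) _ fun v => ⟨?_, fun N => ?_⟩
  · refine ℱ.le n _ (measurableSet_of_determined (P := fun ω => slabCount l X κ w n k ω = v) hX
      fun ω ω' hj hω => ?_)
    rw [← hω, slabCount, slabCount, hdet n ω ω' hj (Or.inl fun t ht => ht.le)]
  · refine measurableSet_of_determined (P := fun ω => slabCount l X κ w n k ω = v ∧
      Hit l X (k + 1 + κ * w ^ 2) N ω) hX ?_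
    rintro ω ω' hj ⟨hω, hit⟩
    refine ⟨?_, (hit_congr hj).1 hit⟩
    rw [← hω, slabCount, slabCount, hdet N ω ω' hj (Or.inr hit)]

theorem measurableSet_allFell (hX : Adapted ℱ X) (a δ : ℝ) (J : ℕ) :
    MeasurableSet (allFell l X a δ J) := by
  have h1 : ∀ a, MeasurableSet (fellSet l X a) := by
    intro a
    have : fellSet l X a = ⋃ n, ({ω | Hit l X a n ω} ∩ belowSet l X a n) := by
      ext ω; simp [fellSet]
    rw [this]
    exact MeasurableSet.iUnion fun n => (ℱ.le n _ (measurableSet_hit hX a n)).inter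
      (measurableSet_belowSet hX a n)
  have : allFell l X a δ J = ⋂ i ∈ Finset.range J, fellSet l X (a + i * δ) := by
    ext ω; simp [allFell]
  rw [this]
  exact Finset.measurableSet_biInter _ fun i _ => h1 _

theorem measurableSet_badSlab (hX : Adapted ℱ X) (κ w : ℕ) (k : ℝ) :
    MeasurableSet (badSlab l X κ w k) := by
  refine ((measurableSet_allFell hX _ _ _).union (measurableSet_allFell hX _ _ _)).union ?_
  have : ∀ k a b : ℝ, ∀ N, MeasurableSet (staySet l X k a b N) := by
    intro k a b N
    have : staySet l X k a b N = ⋃ n, {ω | Hit l X k n ω ∧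
        ∀ j < N, a ≤ height l X (n + j) ω ∧ height l X (n + j) ω < b} := by
      ext ω; simp [staySet]
    rw [this]
    refine MeasurableSet.iUnion fun n => ℱ.le (n + N) _ (measurableSet_of_determined hX ?_)
    rintro ω ω' hj ⟨h1, h2⟩
    refine ⟨(hit_congr fun j hjn => hj j (by omega)).1 h1, fun j hjN => ?_⟩
    rw [← height_congr (hj (n + j) (by omega))]
    exact h2 j hjN
  exact this _ _ _ _

/-- For the largest scale `v < w` at which the slab is bad, either scale `v + 1` is good or it
equals `w`. In both cases the count is at most `(v + 1) ^ 6`. -/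
theorem slabCount_le_sum (κ w n : ℕ) (k : ℝ) {t₁ : ℕ} (ht₁ : 1 ≤ t₁) (ω : Ω) :
    (slabCount l X κ w n k ω : ENNReal) ≤ (t₁ : ENNReal) ^ 6
      + ∑ v ∈ Finset.Ico t₁ w, ((v + 1 : ℕ) : ENNReal) ^ 6 * (badSlab l X κ v k).indicator 1 ω := by
  classical
  rcases le_or_gt w t₁ with h | h
  · refine le_trans ?_ le_self_add
    have : slabCount l X κ w n k ω ≤ t₁ ^ 6 := (slabCount_le κ w n k ω).trans (by gcongr)
    exact_mod_cast this
  by_cases hex : ∃ v ∈ Finset.Ico t₁ w, ω ∈ badSlab l X κ v k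
  · have hex' : ((Finset.Ico t₁ w).filter fun v => ω ∈ badSlab l X κ v k).Nonempty := by
      obtain ⟨v, hv, hb⟩ := hex
      exact ⟨v, Finset.mem_filter.2 ⟨hv, hb⟩⟩
    set v := Finset.max' _ hex' with hv
    have hvm := Finset.mem_filter.1 (Finset.max'_mem _ hex')
    rw [← hv] at hvm
    have hvI := Finset.mem_Ico.1 hvm.1
    have hle : slabCount l X κ w n k ω ≤ (v + 1) ^ 6 := by
      rcases Nat.lt_or_ge (v + 1) w with h1 | h1
      · have hnot : ω ∉ badSlab l X κ (v + 1) k := by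
          intro hb
          have := Finset.le_max' ((Finset.Ico t₁ w).filter fun v => ω ∈ badSlab l X κ v k) (v + 1)
            (Finset.mem_filter.2 ⟨Finset.mem_Ico.2 ⟨hvI.1.trans (Nat.le_succ v), h1⟩, hb⟩)
          omega
        calc slabCount l X κ w n k ω ≤ (slabTimesBefore l X n k (κ * w ^ 2) ω).card := min_le_right _ _
          _ ≤ (slabTimes l X n k ω).card := Finset.card_filter_le _ _
          _ ≤ (v + 1) ^ 6 := (card_slabTimes_lt (by omega) hnot).le
      · exact (slabCount_le κ w n k ω).trans (by gcongr)
    calc (slabCount l X κ w n k ω : ENNReal) ≤ ((v + 1 : ℕ) : ENNReal) ^ 6 * (badSlab l X κ v k).indicator 1 ω := by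
          rw [Set.indicator_of_mem hvm.2, Pi.one_apply, mul_one]
          exact_mod_cast hle
      _ ≤ ∑ v ∈ Finset.Ico t₁ w, ((v + 1 : ℕ) : ENNReal) ^ 6 * (badSlab l X κ v k).indicator 1 ω :=
          Finset.single_le_sum (f := fun v => ((v + 1 : ℕ) : ENNReal) ^ 6 *
            (badSlab l X κ v k).indicator 1 ω) (fun _ _ => zero_le) hvm.1
      _ ≤ _ := le_add_self
  · push Not at hex
    refine le_trans ?_ le_self_add
    have hnot := hex t₁ (Finset.mem_Ico.2 ⟨le_rfl, h⟩)
    have : slabCount l X κ w n k ω ≤ t₁ ^ 6 :=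
      calc slabCount l X κ w n k ω ≤ (slabTimesBefore l X n k (κ * w ^ 2) ω).card := min_le_right _ _
        _ ≤ (slabTimes l X n k ω).card := Finset.card_filter_le _ _
        _ ≤ t₁ ^ 6 := (card_slabTimes_lt ht₁ hnot).le
    exact_mod_cast this

end

section

variable {d : ℕ} {Ω : Type*} {m : MeasurableSpace Ω} {μ : Measure Ω} [IsProbabilityMeasure μ]
  {ℱ : Filtration ℕ m} {l : EuclideanSpace ℝ (Fin d)} {K h r lam : ℝ}
  {X : ℕ → Ω → (Fin d → ℤ)}

/-! ### Linear growth -/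

theorem measure_le_ofReal_mul {S A : Set Ω} {c : ℝ} (hc : 0 ≤ c) (hS : μ.real S ≤ c * μ.real A) :
    μ S ≤ ENNReal.ofReal c * μ A := by
  rw [← ofReal_measureReal (μ := μ) (s := S), ← ofReal_measureReal (μ := μ) (s := A),
    ← ENNReal.ofReal_mul hc]
  exact ENNReal.ofReal_le_ofReal hS

/-- The bound does not depend on `w`: since `s ≥ 8`, the terms `(v + 1)^6 v^(-s)` are at most `64
v^(-2)` and sum to at most 128. Conditioning at level `k - κ w²` serves every smaller scale by
monotonicity of the past. -/
theorem setLIntegral_slabCount_le (hX : Adapted ℱ X) {κ w n t₁ s : ℕ} {k : ℝ} (ht₁ : 1 ≤ t₁)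
    (hs : 8 ≤ s)
    (hbad : ∀ v, t₁ ≤ v → ∀ A, MeasurableSet[pastSpace hX l (k - κ * v ^ 2)] A →
      μ.real (A ∩ badSlab l X κ v k) ≤ ((v : ℝ) ^ s)⁻¹ * μ.real A)
    {A : Set Ω} (hA : MeasurableSet[pastSpace hX l (k - κ * w ^ 2)] A) :
    ∫⁻ ω in A, slabCount l X κ w n k ω ∂μ ≤ ENNReal.ofReal (t₁ ^ 6 + 128) * μ A := by
  have hAm : MeasurableSet A := pastSpace_le hX _ _ hA
  have hbm := fun v => measurableSet_badSlab (l := l) hX κ v k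
  have hterm : ∀ v ∈ Finset.Ico t₁ w,
      ∫⁻ ω in A, ((v + 1 : ℕ) : ENNReal) ^ 6 * (badSlab l X κ v k).indicator 1 ω ∂μ
        ≤ ENNReal.ofReal (64 * ((v : ℝ) ^ 2)⁻¹) * μ A := by
    intro v hv
    obtain ⟨hv1, hv2⟩ := Finset.mem_Ico.1 hv
    have hv0 : (1 : ℝ) ≤ v := by exact_mod_cast ht₁.trans hv1
    rw [lintegral_const_mul _ (measurable_one.indicator (hbm v)), lintegral_indicator_one (hbm v),
      Measure.restrict_apply (hbm v), Set.inter_comm]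
    have hle : k - κ * (w : ℝ) ^ 2 ≤ k - κ * (v : ℝ) ^ 2 := by
      have : (v : ℝ) ≤ w := by exact_mod_cast hv2.le
      gcongr
    have h1 := measure_le_ofReal_mul (by positivity) (hbad v hv1 A (pastSpace_mono hX hle _ hA))
    calc ((v + 1 : ℕ) : ENNReal) ^ 6 * μ (A ∩ badSlab l X κ v k)
        ≤ ENNReal.ofReal (((v + 1 : ℕ) : ℝ) ^ 6) * (ENNReal.ofReal ((v : ℝ) ^ s)⁻¹ * μ A) := by
          rw [ENNReal.ofReal_pow (by positivity), ENNReal.ofReal_natCast]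
          gcongr
      _ = ENNReal.ofReal (((v + 1 : ℕ) : ℝ) ^ 6 * ((v : ℝ) ^ s)⁻¹) * μ A := by
          rw [ENNReal.ofReal_mul (by positivity), mul_assoc]
      _ ≤ _ := by
          refine mul_le_mul' (ENNReal.ofReal_le_ofReal ?_) le_rfl
          have e1 : ((v + 1 : ℕ) : ℝ) ≤ 2 * v := by push_cast; linarith
          calc ((v + 1 : ℕ) : ℝ) ^ 6 * ((v : ℝ) ^ s)⁻¹ ≤ (2 * v) ^ 6 * ((v : ℝ) ^ 8)⁻¹ := by
                gcongr
            _ = 64 * ((v : ℝ) ^ 2)⁻¹ := by field_simp; norm_num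
  calc ∫⁻ ω in A, slabCount l X κ w n k ω ∂μ
      ≤ ∫⁻ ω in A, ((t₁ : ENNReal) ^ 6 + ∑ v ∈ Finset.Ico t₁ w,
          ((v + 1 : ℕ) : ENNReal) ^ 6 * (badSlab l X κ v k).indicator 1 ω) ∂μ :=
        lintegral_mono fun ω => slabCount_le_sum κ w n k ht₁ ω
    _ = (t₁ : ENNReal) ^ 6 * μ A + ∑ v ∈ Finset.Ico t₁ w,
          ∫⁻ ω in A, ((v + 1 : ℕ) : ENNReal) ^ 6 * (badSlab l X κ v k).indicator 1 ω ∂μ := by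
        rw [lintegral_add_left measurable_const, lintegral_finsetSum]
        · simp
        · exact fun v _ => (measurable_one.indicator (hbm v)).const_mul _
    _ ≤ ENNReal.ofReal ((t₁ : ℝ) ^ 6) * μ A + ∑ v ∈ Finset.Ico t₁ w,
          ENNReal.ofReal (64 * ((v : ℝ) ^ 2)⁻¹) * μ A := by
        refine add_le_add (le_of_eq ?_) (Finset.sum_le_sum hterm)
        rw [ENNReal.ofReal_pow (by positivity), ENNReal.ofReal_natCast]
    _ = ENNReal.ofReal ((t₁ : ℝ) ^ 6 + 64 * ∑ v ∈ Finset.Ico t₁ w, ((v : ℝ) ^ 2)⁻¹) * μ A := by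
        rw [← Finset.sum_mul, ← ENNReal.ofReal_sum_of_nonneg (fun _ _ => by positivity), ← add_mul,
          ← ENNReal.ofReal_add (by positivity) (by positivity), Finset.mul_sum]
    _ ≤ _ := by
        gcongr
        have h1 := sum_Ico_inv_pow_le (q := 2) le_rfl ht₁ w
        have h2 : ((t₁ : ℝ) ^ (2 - 1))⁻¹ ≤ 1 := by
          apply inv_le_one_of_one_le₀
          simpa using ht₁
        linarith

/-- The hypothesis says that `f` has conditional mean at most `C` given `𝒢`. Read as a comparison of
measures on `𝒢`, it can be integrated against `g`. -/
theorem lintegral_mul_le_of_forall_setLIntegral_le {Ω : Type*} {𝒢 m : MeasurableSpace Ω}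
    {μ : Measure Ω} [IsFiniteMeasure μ] (h𝒢 : 𝒢 ≤ m) {f g : Ω → ENNReal} (hf : Measurable f) (hg : Measurable[𝒢] g) {C : ENNReal}
    (hle : ∀ A, MeasurableSet[𝒢] A → ∫⁻ ω in A, f ω ∂μ ≤ C * μ A) :
    ∫⁻ ω, f ω * g ω ∂μ ≤ C * ∫⁻ ω, g ω ∂μ := by
  have h1 : (μ.withDensity f).trim h𝒢 ≤ C • μ.trim h𝒢 := by
    refine Measure.le_intro fun A hA _ => ?_
    rw [trim_measurableSet_eq h𝒢 hA, withDensity_apply _ (h𝒢 _ hA), Measure.smul_apply,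
      trim_measurableSet_eq h𝒢 hA, smul_eq_mul]
    exact hle A hA
  calc ∫⁻ ω, f ω * g ω ∂μ = ∫⁻ ω, g ω ∂(μ.withDensity f) :=
        (lintegral_withDensity_eq_lintegral_mul _ hf (hg.mono h𝒢 le_rfl)).symm
    _ = ∫⁻ ω, g ω ∂((μ.withDensity f).trim h𝒢) := (lintegral_trim h𝒢 hg).symm
    _ ≤ ∫⁻ ω, g ω ∂(C • μ.trim h𝒢) := lintegral_mono' h1 le_rfl
    _ = C * ∫⁻ ω, g ω ∂μ := by rw [lintegral_smul_measure, smul_eq_mul, lintegral_trim h𝒢 hg]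

theorem exp_le_one_add_two_mul {x : ℝ} (hx : 0 ≤ x) (hx1 : x ≤ 1) : Real.exp x ≤ 1 + 2 * x := by
  have := exp_le_quadratic (abs_le.2 ⟨by linarith, hx1⟩)
  have h2 : x ^ 2 ≤ x := by rw [sq]; exact mul_le_of_le_one_left hx hx1
  linarith

/-- Exponential bound for the total time spent in well separated slabs. -/
theorem measure_sum_slabCount_ge_le (hX : Adapted ℱ X) {κ w n D I : ℕ} {C a x : ℝ} (hw : 1 ≤ w)
    (hC : 0 ≤ C) (hD : 2 * κ * w ^ 2 + 1 ≤ D)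
    (hcond : ∀ i : ℕ, ∀ A, MeasurableSet[pastSpace hX l (a + i * D - κ * w ^ 2)] A →
      ∫⁻ ω in A, slabCount l X κ w n (a + i * D) ω ∂μ ≤ ENNReal.ofReal C * μ A) :
    μ.real {ω | x ≤ ∑ i ∈ Finset.range I, (slabCount l X κ w n (a + i * D) ω : ℝ)}
      ≤ Real.exp (-(x / w ^ 6) + 2 * C / w ^ 6 * I) := by
  set N : ℕ → Ω → ℕ := fun i => slabCount l X κ w n (a + i * D) with hN
  have hw0 : (0 : ℝ) < (w : ℝ) ^ 6 := by positivity
  set θ : ℝ := ((w : ℝ) ^ 6)⁻¹ with hθ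
  have hθ0 : 0 < θ := by positivity
  -- Truncation gives `θ N ≤ 1`, so `exp (θ N) ≤ 1 + 2 θ N` and each factor is linear in `N`. The
  -- conditional mean bound then applies one slab at a time.
  set Φ : ℕ → Ω → ℝ := fun I ω => ∏ i ∈ Finset.range I, (1 + 2 * θ * N i ω) with hΦ
  have hΦ0 : ∀ I ω, 0 ≤ Φ I ω := fun I ω => Finset.prod_nonneg fun i _ => by positivity
  have hD' : 2 * κ * (w : ℝ) ^ 2 + 1 ≤ D := by exact_mod_cast hD
  have hNm : ∀ i I : ℕ, i < I →
      Measurable[pastSpace hX l (a + I * D - κ * w ^ 2)] fun ω => (N i ω : ℝ) := by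
    intro i I hiI
    -- The spacing `D` is chosen for this: the count of one slab is known before the level at which
    -- the next slab of the family is conditioned.
    have hle : a + i * D + 1 + κ * (w : ℝ) ^ 2 ≤ a + I * D - κ * w ^ 2 := by
      have h1 : (i : ℝ) + 1 ≤ I := by exact_mod_cast hiI
      have h2 := mul_le_mul_of_nonneg_right h1 (Nat.cast_nonneg (α := ℝ) D)
      linarith
    exact (measurable_from_top (f := fun v : ℕ => (v : ℝ))).comp
      ((measurable_slabCount hX κ w n (a + i * D)).mono (pastSpace_mono hX hle) le_rfl)
  have hΦm : ∀ I : ℕ, Measurable[pastSpace hX l (a + I * D - κ * w ^ 2)] (Φ I) := by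
    intro I
    refine Finset.measurable_fun_prod _ fun i hi => ?_
    exact measurable_const.add ((hNm i I (Finset.mem_range.1 hi)).const_mul _)
  have hNm' : ∀ i, Measurable fun ω => (N i ω : ENNReal) := fun i =>
    (measurable_from_top (f := fun v : ℕ => (v : ENNReal))).comp
      ((measurable_slabCount hX κ w n (a + i * D)).mono (pastSpace_le hX _) le_rfl)
  have hE : ∀ I, ∫⁻ ω, ENNReal.ofReal (Φ I ω) ∂μ ≤ ENNReal.ofReal ((1 + 2 * θ * C) ^ I) := by
    intro I
    have hmul : ∀ y : ℝ, ENNReal.ofReal (2 * θ * y) = ENNReal.ofReal (2 * θ) * ENNReal.ofReal y :=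
      fun y => ENNReal.ofReal_mul (by positivity)
    induction I with
    | zero => simp [hΦ]
    | succ I ih =>
      have hg : Measurable[pastSpace hX l (a + I * D - κ * w ^ 2)] fun ω => ENNReal.ofReal (Φ I ω) :=
        (hΦm I).ennreal_ofReal
      have hg' : Measurable fun ω => ENNReal.ofReal (Φ I ω) := hg.mono (pastSpace_le hX _) le_rfl
      have h1 := lintegral_mul_le_of_forall_setLIntegral_le (μ := μ) (pastSpace_le hX _) (hNm' I) hg
        (hcond I)
      calc ∫⁻ ω, ENNReal.ofReal (Φ (I + 1) ω) ∂μ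
          = ∫⁻ ω, ENNReal.ofReal (Φ I ω)
              + ENNReal.ofReal (2 * θ) * ((N I ω : ENNReal) * ENNReal.ofReal (Φ I ω)) ∂μ := by
            refine lintegral_congr fun ω => ?_
            have : Φ (I + 1) ω = Φ I ω + 2 * θ * (N I ω * Φ I ω) := by
              simp only [hΦ, Finset.prod_range_succ]; ring
            have h0 := hΦ0 I ω
            rw [this, ENNReal.ofReal_add h0 (by positivity), hmul,
              ENNReal.ofReal_mul (Nat.cast_nonneg (N I ω)), ENNReal.ofReal_natCast]
        _ = ∫⁻ ω, ENNReal.ofReal (Φ I ω) ∂μ + ENNReal.ofReal (2 * θ) *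
              ∫⁻ ω, (N I ω : ENNReal) * ENNReal.ofReal (Φ I ω) ∂μ := by
            rw [lintegral_add_left hg', lintegral_const_mul _
              (show Measurable fun ω => (N I ω : ENNReal) * ENNReal.ofReal (Φ I ω) from
                (hNm' I).mul hg')]
        _ ≤ ∫⁻ ω, ENNReal.ofReal (Φ I ω) ∂μ + ENNReal.ofReal (2 * θ) *
              (ENNReal.ofReal C * ∫⁻ ω, ENNReal.ofReal (Φ I ω) ∂μ) := by gcongr
        _ = ENNReal.ofReal (1 + 2 * θ * C) * ∫⁻ ω, ENNReal.ofReal (Φ I ω) ∂μ := by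
            rw [ENNReal.ofReal_add zero_le_one (by positivity), ENNReal.ofReal_one, add_mul, one_mul,
              hmul, mul_assoc]
        _ ≤ ENNReal.ofReal (1 + 2 * θ * C) * ENNReal.ofReal ((1 + 2 * θ * C) ^ I) := by gcongr
        _ = _ := by rw [← ENNReal.ofReal_mul (by positivity), pow_succ']
  have hmark := mul_meas_ge_le_lintegral (μ := μ)
    (((hΦm I).mono (pastSpace_le hX _) le_rfl).ennreal_ofReal) (ENNReal.ofReal (Real.exp (θ * x)))
  have hsub : {ω | x ≤ ∑ i ∈ Finset.range I, (N i ω : ℝ)}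
      ⊆ {ω | ENNReal.ofReal (Real.exp (θ * x)) ≤ ENNReal.ofReal (Φ I ω)} := by
    intro ω hω
    refine ENNReal.ofReal_le_ofReal ?_
    calc Real.exp (θ * x) ≤ Real.exp (θ * ∑ i ∈ Finset.range I, (N i ω : ℝ)) := by
          have : x ≤ ∑ i ∈ Finset.range I, (N i ω : ℝ) := hω
          gcongr
      _ = ∏ i ∈ Finset.range I, Real.exp (θ * N i ω) := by rw [Finset.mul_sum, Real.exp_sum]
      _ ≤ Φ I ω := by
          refine Finset.prod_le_prod (fun i _ => (Real.exp_pos _).le) fun i _ => ?_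
          have h1 : (N i ω : ℝ) ≤ (w : ℝ) ^ 6 := by exact_mod_cast slabCount_le κ w n _ ω
          have h2 : θ * N i ω ≤ 1 := by
            calc θ * N i ω ≤ θ * (w : ℝ) ^ 6 := by gcongr
              _ = 1 := inv_mul_cancel₀ hw0.ne'
          exact (exp_le_one_add_two_mul (by positivity) h2).trans (le_of_eq (by ring))
  have h1 : ENNReal.ofReal (Real.exp (θ * x)) * μ {ω | x ≤ ∑ i ∈ Finset.range I, (N i ω : ℝ)}
      ≤ ENNReal.ofReal ((1 + 2 * θ * C) ^ I) :=
    le_trans (by gcongr) (hmark.trans (hE I))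
  have h2 : Real.exp (θ * x) * μ.real {ω | x ≤ ∑ i ∈ Finset.range I, (N i ω : ℝ)}
      ≤ (1 + 2 * θ * C) ^ I := by
    rw [← ofReal_measureReal, ← ENNReal.ofReal_mul (Real.exp_pos _).le] at h1
    exact (ENNReal.ofReal_le_ofReal_iff (by positivity)).1 h1
  have h3 : (1 + 2 * θ * C) ^ I ≤ Real.exp (2 * C / w ^ 6 * I) := by
    calc (1 + 2 * θ * C) ^ I ≤ Real.exp (2 * θ * C) ^ I := by
          gcongr
          linarith [Real.add_one_le_exp (2 * θ * C)]
      _ = Real.exp (2 * C / w ^ 6 * I) := by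
          rw [← Real.exp_nat_mul]; congr 1; rw [hθ]; ring
  have h4 : Real.exp (-(x / w ^ 6)) * Real.exp (θ * x) = 1 := by
    rw [← Real.exp_add, ← Real.exp_zero]; congr 1; rw [hθ]; ring
  calc μ.real {ω | x ≤ ∑ i ∈ Finset.range I, (N i ω : ℝ)}
      = Real.exp (-(x / w ^ 6)) * (Real.exp (θ * x)
        * μ.real {ω | x ≤ ∑ i ∈ Finset.range I, (N i ω : ℝ)}) := by
        rw [← mul_assoc, h4, one_mul]
    _ ≤ Real.exp (-(x / w ^ 6)) * Real.exp (2 * C / w ^ 6 * I) := by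
        gcongr
        exact h2.trans h3
    _ = _ := (Real.exp_add _ _).symm

end

/-! ### From time in slabs to a linear lower bound on the height -/

section

variable {d : ℕ} {Ω : Type*} {m : MeasurableSpace Ω} {μ : Measure Ω} [IsProbabilityMeasure μ]
  {ℱ : Filtration ℕ m} {l : EuclideanSpace ℝ (Fin d)} {K h r lam : ℝ}
  {X : ℕ → Ω → (Fin d → ℤ)}

/-- The unit slabs above `b` are sorted by their index modulo `D`, so that slabs in one class are at
distance `D` from each other. -/
theorem le_sum_card_slabTimes {D I n : ℕ} {b : ℝ} {ω : Ω}
    (hω : ∀ t < n, b ≤ height l X t ω ∧ height l X t ω < b + I * D) :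
    n ≤ ∑ c ∈ Finset.range D, ∑ i ∈ Finset.range I, (slabTimes l X n (b + c + i * D) ω).card := by
  classical
  have hsub : Finset.range n ⊆ (Finset.range D).biUnion fun c => (Finset.range I).biUnion fun i =>
      slabTimes l X n (b + c + i * D) ω := by
    intro t ht
    obtain ⟨h1, h2⟩ := hω t (Finset.mem_range.1 ht)
    set j := ⌊height l X t ω - b⌋₊ with hj
    have h0 : 0 ≤ height l X t ω - b := by linarith
    have hj1 : (j : ℝ) ≤ height l X t ω - b := Nat.floor_le h0
    have hj2 : height l X t ω - b < j + 1 := Nat.lt_floor_add_one _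
    have hjlt : j < I * D := by
      have : (j : ℝ) < I * D := by linarith
      exact_mod_cast this
    have hD : 0 < D := by
      rcases Nat.eq_zero_or_pos D with h | h
      · simp [h] at hjlt
      · exact h
    have hdec : ((j % D : ℕ) : ℝ) + ((j / D : ℕ) : ℝ) * D = j := by
      exact_mod_cast (by rw [mul_comm]; exact Nat.mod_add_div j D : j % D + j / D * D = j)
    refine Finset.mem_biUnion.2 ⟨j % D, Finset.mem_range.2 (Nat.mod_lt _ hD),
      Finset.mem_biUnion.2 ⟨j / D, Finset.mem_range.2 ((Nat.div_lt_iff_lt_mul hD).2 hjlt),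
      Finset.mem_filter.2 ⟨ht, ?_, ?_⟩⟩⟩ <;> linarith
  calc n = (Finset.range n).card := (Finset.card_range n).symm
    _ ≤ _ := Finset.card_le_card hsub
    _ ≤ _ := Finset.card_biUnion_le.trans (Finset.sum_le_sum fun c _ => Finset.card_biUnion_le)

/-- Being below `z` at time `n` confines the first `n` steps to heights in `[-κ w², z + κ w²)`:
falling below the lower end is a late fall from the start (`B₀`), and coming back below `z` from the
upper end loses `w` levels (`B₁`). Off the bad slabs (`B₂`) the truncated counts are exact, so one
of the `D` classes of slabs must hold time at least `n / D` (`B₃`). -/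
theorem IsGeneralizedExcitedRandomWalk.measure_height_lt_le
    (hX : IsGeneralizedExcitedRandomWalk μ ℱ l K h r lam X) (hl : ‖l‖ = 1) (hK : 0 < K)
    {ε : ℝ} {s t₀ t₁ κ w n D I : ℕ} {z : ℝ} (hs : 8 ≤ s) (hε : 0 < ε)
    (hF : FallBound μ ℱ l X ε (s + 3) t₀) (hκ : K ≤ κ) (ht₁ : 1 ≤ t₁) (ht : t₀ ≤ t₁) (hw : t₁ ≤ w)
    (hbad : ∀ v : ℕ, t₁ ≤ v → ∀ (k : ℝ) (A : Set Ω),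
      MeasurableSet[pastSpace hX.adapted l (k - κ * v ^ 2)] A →
      μ.real (A ∩ allFell l X (k - κ * v ^ 2) (κ * v) v) ≤ ((v : ℝ) ^ s)⁻¹ * μ.real A ∧
      μ.real (A ∩ badSlab l X κ v k) ≤ ((v : ℝ) ^ s)⁻¹ * μ.real A)
    (hD : D = 2 * κ * w ^ 2 + 1) (hI : z + 2 * (κ * (w : ℝ) ^ 2) ≤ I * D) :
    μ.real {ω | height l X n ω < z} ≤ 2 * ((w : ℝ) ^ (s + 2))⁻¹ + ((w : ℝ) ^ s)⁻¹
      + D * I * ((w : ℝ) ^ s)⁻¹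
      + D * Real.exp (-(n / D / w ^ 6) + 2 * (t₁ ^ 6 + 128) / w ^ 6 * I) := by
  have hw1 : 1 ≤ w := ht₁.trans hw
  have hw1' : (1 : ℝ) ≤ w := by exact_mod_cast hw1
  have hD0 : 0 < D := by omega
  set b : ℝ := -(κ * (w : ℝ) ^ 2) with hb
  have hu : 0 ≤ κ * (w : ℝ) ^ 2 := by positivity
  set B₀ : Set Ω := {ω | Hit l X b 0 ω} ∩ {ω | ∃ t ≥ w, ω ∈ fallSet l X b 0 t} with hB₀
  set B₁ : Set Ω := allFell l X z (κ * w) w with hB₁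
  set B₂ : Set Ω := ⋃ c ∈ Finset.range D, ⋃ i ∈ Finset.range I, badSlab l X κ w (b + c + i * D)
    with hB₂
  set B₃ : Set Ω := ⋃ c ∈ Finset.range D, {ω | (n : ℝ) / D ≤
    ∑ i ∈ Finset.range I, (slabCount l X κ w n (b + c + i * D) ω : ℝ)} with hB₃
  have huniv : ∀ k, MeasurableSet[pastSpace hX.adapted l k] Set.univ := fun k =>
    @MeasurableSet.univ _ (pastSpace hX.adapted l k)
  have m0 : μ.real B₀ ≤ 2 * ((w : ℝ) ^ (s + 2))⁻¹ := by
    refine (hF.measure_late_le hε (by omega) (measurableSet_hit hX.adapted b 0) hw1 (ht.trans hw)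
      (fun ω hω => hω.2) fun ω hω => ?_).trans ?_
    · have : priorCount l X b 0 ω = 0 := Nat.le_zero.1 (priorCount_le_of_hit hω 0)
      rw [this, Nat.cast_zero]
      positivity
    · exact mul_le_of_le_one_right (by positivity) measureReal_le_one
  have m1 : μ.real B₁ ≤ ((w : ℝ) ^ s)⁻¹ := by
    have := (hbad w hw (z + κ * w ^ 2) Set.univ (huniv _)).1
    simpa [hB₁] using this
  have m2 : μ.real B₂ ≤ D * I * ((w : ℝ) ^ s)⁻¹ := by
    have h1 : ∀ k, μ.real (badSlab l X κ w k) ≤ ((w : ℝ) ^ s)⁻¹ := fun k => by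
      have := (hbad w hw k Set.univ (huniv _)).2
      simpa using this
    calc μ.real B₂ ≤ ∑ c ∈ Finset.range D, ∑ i ∈ Finset.range I, ((w : ℝ) ^ s)⁻¹ :=
          (measureReal_biUnion_finset_le _ _).trans (Finset.sum_le_sum fun c _ =>
            (measureReal_biUnion_finset_le _ _).trans (Finset.sum_le_sum fun i _ => h1 _))
      _ = _ := by simp; ring
  have m3 : μ.real B₃ ≤ D * Real.exp (-(n / D / w ^ 6) + 2 * (t₁ ^ 6 + 128) / w ^ 6 * I) := by
    refine (measureReal_biUnion_finset_le _ _).trans ?_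
    refine (Finset.sum_le_sum fun c _ => measure_sum_slabCount_ge_le hX.adapted (C := t₁ ^ 6 + 128)
      hw1 (by positivity) hD.ge fun i A hA => ?_).trans (le_of_eq (by simp))
    exact setLIntegral_slabCount_le hX.adapted ht₁ hs (fun v hv A hA => (hbad v hv _ A hA).2) hA
  refine (measureReal_mono_ae (T := B₀ ∪ B₁ ∪ B₂ ∪ B₃) ?_).trans ?_
  · filter_upwards [hX.start, hX.ae_abs_height_le hl] with ω hω0 hωK hz
    by_contra hnot
    simp only [Set.mem_union, not_or] at hnot
    obtain ⟨⟨⟨n0, n1⟩, n2⟩, n3⟩ := hnot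
    have hlow : ∀ t, b ≤ height l X t ω := by
      intro t
      by_contra hlt
      obtain ⟨t', -, ht'⟩ := exists_mem_fallSet (n := 0) (i := t) (by rw [zero_add]; exact not_le.1 hlt)
      have h0 := (abs_le.1 (hωK 0)).1
      rw [Nat.cast_zero, mul_zero, neg_zero] at h0
      refine n0 ⟨⟨fun j hj => absurd hj (Nat.not_lt_zero j), by linarith⟩, t', ?_, ht'⟩
      have h1 := ht'.2
      rw [zero_add] at h1
      have h2 := (abs_le.1 (hωK t')).1
      have h3 : K * (w : ℝ) ^ 2 < K * t' := by
        have : K * (w : ℝ) ^ 2 ≤ κ * (w : ℝ) ^ 2 := by gcongr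
        linarith
      have h4 := lt_of_mul_lt_mul_left h3 hK.le
      have h5 : (w : ℝ) * 1 ≤ w * w := by gcongr
      have h6 : (w : ℝ) ≤ t' := by linarith
      exact_mod_cast h6
    have hhigh : ∀ t < n, height l X t ω < z + κ * (w : ℝ) ^ 2 := by
      intro t htn
      by_contra hge
      have := le_height_of_notMem_allFell (by positivity) n1 (n := t)
        (le_trans (le_of_eq (by ring)) (not_lt.1 hge)) htn.le
      exact absurd hz (not_lt.2 this)
    have hle := le_sum_card_slabTimes (l := l) (X := X) (D := D) (I := I) (n := n) (b := b) (ω := ω)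
      fun t htn => ⟨hlow t, by linarith [hhigh t htn]⟩
    have heq : ∀ c ∈ Finset.range D, ∑ i ∈ Finset.range I, (slabTimes l X n (b + c + i * D) ω).card
        = ∑ i ∈ Finset.range I, slabCount l X κ w n (b + c + i * D) ω := by
      refine fun c hc => Finset.sum_congr rfl fun i hi => (slabCount_eq hw1 fun hmem => n2 ?_).symm
      exact Set.mem_biUnion hc (Set.mem_biUnion hi hmem)
    rw [Finset.sum_congr rfl heq] at hle
    have hlt : ∑ c ∈ Finset.range D, ∑ i ∈ Finset.range I,
        (slabCount l X κ w n (b + c + i * D) ω : ℝ) < ∑ c ∈ Finset.range D, (n : ℝ) / D := by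
      refine Finset.sum_lt_sum_of_nonempty (Finset.nonempty_range_iff.2 hD0.ne') fun c hc => ?_
      by_contra hge
      exact n3 (Set.mem_biUnion hc (not_lt.1 hge))
    rw [Finset.sum_const, Finset.card_range, nsmul_eq_mul,
      mul_div_cancel₀ _ (by positivity : (D : ℝ) ≠ 0)] at hlt
    have hle' : (n : ℝ) ≤ ∑ c ∈ Finset.range D, ∑ i ∈ Finset.range I,
        (slabCount l X κ w n (b + c + i * D) ω : ℝ) := by exact_mod_cast hle
    linarith
  · have u1 := measureReal_union_le (μ := μ) (B₀ ∪ B₁ ∪ B₂) B₃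
    have u2 := measureReal_union_le (μ := μ) (B₀ ∪ B₁) B₂
    have u3 := measureReal_union_le (μ := μ) B₀ B₁
    linarith

/-- Here `n ≈ w ^ 10` and `D ≈ w ^ 2`. The bad slabs cost at most `n w^(-31)`, of order `w^(-21)`,
which beats `w^(-20) ≈ n^(-2)`. The choice of `I` gives `2 C I ≤ n / (2 D)`, so the exponent is at
most `-n / (2 D w ^ 6)`, of order `-w ^ 2`. -/
theorem eventually_height_bound {κ : ℕ} {C : ℝ} (hκ : 1 ≤ κ) (hC : 1 ≤ C) :
    ∀ᶠ w : ℕ in atTop, ∀ n D : ℕ, w ^ 10 ≤ n → n < (w + 1) ^ 10 → D = 2 * κ * w ^ 2 + 1 →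
      2 * ((w : ℝ) ^ (31 + 2))⁻¹ + ((w : ℝ) ^ 31)⁻¹
        + D * ⌈(n / (8 * C) + 2 * (κ * (w : ℝ) ^ 2)) / D⌉₊ * ((w : ℝ) ^ 31)⁻¹
        + D * Real.exp (-(n / D / w ^ 6)
          + 2 * C / w ^ 6 * ⌈(n / (8 * C) + 2 * (κ * (w : ℝ) ^ 2)) / D⌉₊)
      ≤ 2 ^ 20 * ((n : ℝ) ^ 2)⁻¹ := by
  have hκ' : (1 : ℝ) ≤ κ := by exact_mod_cast hκ
  have hκ0 : (0 : ℝ) < κ := by linarith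
  have hev := tendsto_natCast_atTop_atTop.eventually (eventually_pow_mul_exp_le 20 2 (3 * κ)
    (show (0 : ℝ) < 1 / (6 * κ) by positivity) (two_pos : (0 : ℝ) < 2))
  have hev2 : ∀ᶠ w : ℕ in atTop, 48 * C * κ + 2 ^ 12 ≤ (w : ℝ) :=
    tendsto_natCast_atTop_atTop.eventually_ge_atTop _
  filter_upwards [hev, hev2] with w hexp hw n D hn1 hn2 hD
  have hCκ : 1 ≤ C * κ := one_le_mul_of_one_le_of_one_le hC hκ'
  have hw12 : (2 : ℝ) ^ 12 ≤ w := by linarith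
  have hw1 : (1 : ℝ) ≤ w := by linarith
  have hw0 : (0 : ℝ) < w := by linarith
  have hn1' : (w : ℝ) ^ 10 ≤ n := by exact_mod_cast hn1
  have hn2' : (n : ℝ) ≤ 2 ^ 10 * (w : ℝ) ^ 10 := by
    have h1 : (n : ℝ) ≤ (w + 1 : ℝ) ^ 10 := by exact_mod_cast hn2.le
    calc (n : ℝ) ≤ (w + 1 : ℝ) ^ 10 := h1
      _ ≤ (2 * w : ℝ) ^ 10 := by gcongr; linarith
      _ = _ := by ring
  have hn0 : (0 : ℝ) < n := lt_of_lt_of_le (by positivity) hn1'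
  have hD' : (D : ℝ) = 2 * (κ * (w : ℝ) ^ 2) + 1 := by rw [hD]; push_cast; ring
  have hw2 : (1 : ℝ) ≤ (w : ℝ) ^ 2 := one_le_pow₀ hw1
  have hκw : 1 ≤ κ * (w : ℝ) ^ 2 := one_le_mul_of_one_le_of_one_le hκ' hw2
  have hD0 : (0 : ℝ) < D := by linarith
  have hD3 : (D : ℝ) ≤ 3 * (κ * (w : ℝ) ^ 2) := by linarith
  have hbig : 16 * C * D ≤ n := by
    calc 16 * C * D ≤ 16 * C * (3 * (κ * (w : ℝ) ^ 2)) := by gcongr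
      _ = (48 * C * κ) * (w : ℝ) ^ 2 := by ring
      _ ≤ (w : ℝ) ^ 8 * (w : ℝ) ^ 2 := by
          gcongr
          exact (by linarith : 48 * C * κ ≤ (w : ℝ)).trans (le_self_pow₀ hw1 (by norm_num))
      _ = (w : ℝ) ^ 10 := by ring
      _ ≤ n := hn1'
  set I := ⌈(n / (8 * C) + 2 * (κ * (w : ℝ) ^ 2)) / D⌉₊ with hI
  have hIlt : (I : ℝ) ≤ (n / (8 * C) + 2 * (κ * (w : ℝ) ^ 2)) / D + 1 :=
    (Nat.ceil_lt_add_one (by positivity)).le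
  have hIn : D * (I : ℝ) ≤ n := by
    have h1 : D * (I : ℝ) ≤ n / (8 * C) + 2 * (κ * (w : ℝ) ^ 2) + D := by
      calc D * (I : ℝ) ≤ D * ((n / (8 * C) + 2 * (κ * (w : ℝ) ^ 2)) / D + 1) := by gcongr
        _ = _ := by field_simp
    have h2 : (n : ℝ) / (8 * C) ≤ n / 8 := by gcongr; linarith
    have h3 : 16 * (D : ℝ) ≤ 16 * C * D := by nlinarith
    linarith
  have hpart : 2 * ((w : ℝ) ^ (31 + 2))⁻¹ + ((w : ℝ) ^ 31)⁻¹ + D * I * ((w : ℝ) ^ 31)⁻¹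
      ≤ ((w : ℝ) ^ 20)⁻¹ / 2 := by
    have e1 : ((w : ℝ) ^ (31 + 2))⁻¹ ≤ ((w : ℝ) ^ 31)⁻¹ := by gcongr; simp
    have e2 : D * I * ((w : ℝ) ^ 31)⁻¹ ≤ 2 ^ 10 * (w : ℝ) ^ 10 * ((w : ℝ) ^ 31)⁻¹ :=
      mul_le_mul_of_nonneg_right (hIn.trans hn2') (by positivity)
    have e3 : (1 : ℝ) ≤ (w : ℝ) ^ 10 := one_le_pow₀ hw1
    have e4 : 3 * ((w : ℝ) ^ 31)⁻¹ ≤ 3 * (w : ℝ) ^ 10 * ((w : ℝ) ^ 31)⁻¹ := by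
      gcongr; linarith
    have e5 : ((w : ℝ) ^ 31)⁻¹ = ((w : ℝ) ^ 20)⁻¹ * ((w : ℝ) ^ 10)⁻¹ * (w : ℝ)⁻¹ := by
      rw [← mul_inv, ← mul_inv]; ring
    have e6 : (w : ℝ) ^ 10 * ((w : ℝ) ^ 31)⁻¹ = ((w : ℝ) ^ 20)⁻¹ * (w : ℝ)⁻¹ := by
      rw [e5]; field_simp
    have e7 : (w : ℝ)⁻¹ ≤ (2 ^ 12)⁻¹ := by gcongr
    have e8 : ((w : ℝ) ^ 20)⁻¹ * (w : ℝ)⁻¹ ≤ ((w : ℝ) ^ 20)⁻¹ * (2 ^ 12)⁻¹ := by gcongr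
    have e9 : 0 < ((w : ℝ) ^ 20)⁻¹ := by positivity
    rw [mul_assoc _ (_ ^ 10), e6] at e2 e4
    linarith
  have hexp' : D * Real.exp (-(n / D / w ^ 6) + 2 * C / w ^ 6 * I) ≤ ((w : ℝ) ^ 20)⁻¹ / 3 := by
    refine le_trans ?_ hexp
    have f1 : 2 * C * I ≤ n / (2 * D) := by
      have : (2 * C * I) * (2 * D) ≤ n := by
        calc (2 * C * I) * (2 * D) ≤ (2 * C * ((n / (8 * C) + 2 * (κ * (w : ℝ) ^ 2)) / D + 1))
              * (2 * D) := by gcongr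
          _ = n / 2 + 4 * C * (2 * (κ * (w : ℝ) ^ 2)) + 4 * C * D := by field_simp; ring
          _ ≤ n / 2 + 4 * C * D + 4 * C * D := by gcongr; linarith
          _ ≤ n := by linarith
      rwa [le_div_iff₀ (by positivity)]
    have f2 : -(n / D / w ^ 6) + 2 * C / w ^ 6 * I ≤ -(1 / (6 * κ) * (w : ℝ) ^ (2 : ℝ)) := by
      have g1 : -(n / D / w ^ 6) + 2 * C / w ^ 6 * I = (2 * C * I - n / D) / (w : ℝ) ^ 6 := by ring
      have g2 : (2 * C * I - n / D) ≤ -((w : ℝ) ^ 10 / (2 * (3 * (κ * (w : ℝ) ^ 2)))) := by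
        have : (w : ℝ) ^ 10 / (2 * (3 * (κ * (w : ℝ) ^ 2))) ≤ n / (2 * D) := by gcongr
        have g3 : (n : ℝ) / D = n / (2 * D) + n / (2 * D) := by field_simp; ring
        linarith
      rw [g1, Real.rpow_two]
      calc (2 * C * I - n / D) / (w : ℝ) ^ 6
          ≤ -((w : ℝ) ^ 10 / (2 * (3 * (κ * (w : ℝ) ^ 2)))) / (w : ℝ) ^ 6 := by gcongr
        _ = _ := by field_simp; norm_num
    calc D * Real.exp (-(n / D / w ^ 6) + 2 * C / w ^ 6 * I)
        ≤ 3 * (κ * (w : ℝ) ^ 2) * Real.exp (-(1 / (6 * κ) * (w : ℝ) ^ (2 : ℝ))) := by gcongr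
      _ = _ := by ring
  have hfin : ((w : ℝ) ^ 20)⁻¹ ≤ 2 ^ 20 * ((n : ℝ) ^ 2)⁻¹ := by
    have : (n : ℝ) ^ 2 ≤ 2 ^ 20 * (w : ℝ) ^ 20 := by
      calc (n : ℝ) ^ 2 ≤ (2 ^ 10 * (w : ℝ) ^ 10) ^ 2 := by gcongr
        _ = _ := by ring
    rw [← div_eq_mul_inv, le_div_iff₀ (by positivity), inv_mul_le_iff₀ (by positivity), mul_comm]
    exact this
  have : 0 < ((w : ℝ) ^ 20)⁻¹ := by positivity
  linarith

theorem exists_pow_le_lt_succ_pow (n : ℕ) : ∃ w : ℕ, w ^ 10 ≤ n ∧ n < (w + 1) ^ 10 := by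
  classical
  have hex : ∃ w : ℕ, n < (w + 1) ^ 10 :=
    ⟨n, lt_of_lt_of_le (Nat.lt_succ_self n) (Nat.le_self_pow (by norm_num) _)⟩
  refine ⟨Nat.find hex, ?_, Nat.find_spec hex⟩
  rcases Nat.eq_zero_or_pos (Nat.find hex) with h0 | hpos
  · rw [h0]; simp
  · have := Nat.find_min hex (Nat.sub_lt hpos one_pos)
    rwa [Nat.sub_one_add_one hpos.ne', not_lt] at this

theorem exists_speed (d : ℕ) (hd : 2 ≤ d) (K h r lam : ℝ)
    (hK : 0 < K) (hh : 0 < h) (hr : 0 < r) (hlam : 0 < lam) :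
    ∃ v : ℝ, 0 < v ∧ ∃ n₀ : ℕ, ∀ (l : EuclideanSpace ℝ (Fin d)), ‖l‖ = 1 →
      ∀ (Ω : Type u) (m : MeasurableSpace Ω) (μ : Measure Ω), IsProbabilityMeasure μ →
      ∀ (ℱ : Filtration ℕ m) (X : ℕ → Ω → (Fin d → ℤ)),
        IsGeneralizedExcitedRandomWalk μ ℱ l K h r lam X →
        ∀ n, n₀ ≤ n → μ.real {ω | height l X n ω < v * n} ≤ 2 ^ 20 * ((n : ℝ) ^ 2)⁻¹ := by
  obtain ⟨ε, hε, H⟩ := exists_fallBound.{u} hd hK hh hr hlam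
  obtain ⟨t₀, -, hF⟩ := H (31 + 3)
  obtain ⟨p, hp0, hp1, hE⟩ := exists_escape.{u} (d := d) (t₀ := t₀) hK hh hr hlam hε
    (show 2 ≤ 31 + 3 by norm_num)
  set κ := ⌈K⌉₊ with hκ
  have hκ1 : 1 ≤ κ := Nat.one_le_ceil_iff.2 hK
  have hc : 0 < h * r ^ 2 / (2 * (2 * (κ : ℝ) + 1 + K) ^ 2) := by positivity
  obtain ⟨t₁, ht₁⟩ := eventually_atTop.1 ((eventually_slab_bound hp0 hp1 hc 31).and
    (eventually_ge_atTop (max 1 t₀)))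
  have ht1 := (ht₁ t₁ le_rfl).2
  set C : ℝ := t₁ ^ 6 + 128 with hC
  have hC1 : 1 ≤ C := by
    have : (0 : ℝ) ≤ (t₁ : ℝ) ^ 6 := by positivity
    linarith
  obtain ⟨w₀, hw₀⟩ := eventually_atTop.1 ((eventually_height_bound hκ1 hC1).and
    (eventually_ge_atTop t₁))
  -- `C` bounds the conditional mean time in a unit slab, so a speed of order `1 / C` is expected.
  -- The 8 leaves room for the factor 2 in the exponential moment, the two boundary layers and the
  -- rounding of `I`.
  refine ⟨1 / (8 * C), by positivity, w₀ ^ 10, fun l hl Ω m μ hμ ℱ X hX n hn => ?_⟩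
  obtain ⟨w, hw1, hw2⟩ := exists_pow_le_lt_succ_pow n
  have hww₀ : w₀ ≤ w := by
    have := lt_of_pow_lt_pow_left₀ 10 (Nat.zero_le _) (hn.trans_lt hw2)
    omega
  obtain ⟨hnum, hwt⟩ := hw₀ w hww₀
  have hF' := hF l hl Ω m μ hμ ℱ X hX
  have hE' : EscapeBound μ ℱ l X p := hE l hl Ω m μ hμ ℱ X hX hF'
  refine le_trans ?_ (hnum n (2 * κ * w ^ 2 + 1) hw1 hw2 rfl)
  refine le_trans (measureReal_mono fun ω hω => ?_) (hX.measure_height_lt_le hl hK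
    (z := n / (8 * C)) (by norm_num) hε hF' (Nat.le_ceil K) (le_trans (le_max_left _ _) ht1)
    (le_trans (le_max_right _ _) ht1) hwt (fun v hv k A hA => ?_) rfl ?_)
  · rw [Set.mem_ofPred_eq] at hω ⊢
    exact hω.trans_eq (by ring)
  · obtain ⟨g1, g2⟩ := ht₁ v hv
    exact hX.measure_badSlab_le hl hK hh hr hlam hp1 hε hE' hF' (Nat.le_ceil K)
      (le_trans (le_max_left _ _) g2) (le_trans (le_max_right _ _) g2) g1 hA
  · rw [← div_le_iff₀ (by positivity)]
    exact Nat.le_ceil _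

end

end ExcitedWalk

end

/-! ### Almost sure conclusion by Borel–Cantelli -/

theorem theorem1 (d : ℕ) (hd : 2 ≤ d) (K h r lam : ℝ)
    (hK : 0 < K) (hh : 0 < h) (hr : 0 < r) (hlam : 0 < lam) :
    ∃ v : ℝ, 0 < v ∧
      ∀ (l : EuclideanSpace ℝ (Fin d)), ‖l‖ = 1 →
      ∀ (Ω : Type*) (m : MeasurableSpace Ω) (μ : Measure Ω), IsProbabilityMeasure μ →
      ∀ (ℱ : Filtration ℕ m) (X : ℕ → Ω → (Fin d → ℤ)),
        ExcitedWalk.IsGeneralizedExcitedRandomWalk μ ℱ l K h r lam X →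
        ∀ᵐ ω ∂μ,
          (v : EReal) ≤
            liminf (fun n : ℕ => ((inner ℝ (ExcitedWalk.toVec (X n ω)) l / (n : ℝ) : ℝ) : EReal))
              atTop := by
  obtain ⟨v, hv, n₀, H⟩ := ExcitedWalk.exists_speed d hd K h r lam hK hh hr hlam
  refine ⟨v, hv, fun l hl Ω m μ hμ ℱ X hX => ?_⟩
  -- Emptying the events before `n₀` makes the bound valid for every `n`, so that the whole series
  -- is summable.
  have hS : ∀ n, μ (if n₀ ≤ n then {ω | ExcitedWalk.height l X n ω < v * n} else ∅)
      ≤ ENNReal.ofReal (2 ^ 20 * ((n : ℝ) ^ 2)⁻¹) := by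
    intro n
    split_ifs with hn
    · rw [← ofReal_measureReal]
      exact ENNReal.ofReal_le_ofReal (H l hl Ω m μ hμ ℱ X hX n hn)
    · simp
  have hsum : Summable fun n : ℕ => (2 : ℝ) ^ 20 * ((n : ℝ) ^ 2)⁻¹ :=
    (Real.summable_nat_pow_inv.2 one_lt_two).mul_left _
  have hfin : ∑' n, μ (if n₀ ≤ n then {ω | ExcitedWalk.height l X n ω < v * n} else ∅) ≠ ⊤ :=
    ne_top_of_le_ne_top hsum.tsum_ofReal_ne_top (ENNReal.tsum_le_tsum hS)
  filter_upwards [ae_eventually_notMem hfin] with ω hω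
  refine le_liminf_of_le (by isBoundedDefault) ?_
  filter_upwards [hω, eventually_ge_atTop n₀, eventually_gt_atTop 0] with n hn hn₀ hpos
  rw [if_pos hn₀, Set.mem_ofPred_eq, not_lt] at hn
  refine EReal.coe_le_coe_iff.2 ?_
  rw [le_div_iff₀ (by exact_mod_cast hpos)]
  exact hn
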